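/- **Setting.** Let $\{F_\vartheta\}$ be a non-singular one-parameter natural exponential family on $\mathbb R$: for a reference measure $\nu$, natural parameter set $\mathcal T=\{\eta:\int e^{\eta y}\,\nu(dy)<\infty\}$ and $A(\eta)=\log\int e^{\eta y}\,\nu(dy)$, its members have densities $e^{\eta y-A(\eta)}$ with respect to $\nu$, with positive variance for every $\eta\in\mathcal T^{o}$. Let $M$ be the set of means obtained for $\eta\in\mathcal T^{o}$, let $F_\vartheta$ be the member with mean $\vartheta\in M$ and natural parameter $\eta(\vartheta)$, and let $d(\theta,\vartheta)=\mathrm{KL}(F_\theta\,\|\,F_\vartheta)$. For an arbitrary empirical mean $y\in\mathbb R$ let $d(y,\vartheta)=\sup_{\eta\in\mathcal T}\{(\eta-\eta(\vartheta))y-A(\eta)+A(\eta(\vartheta))\}$, the log-likelihood ratio per observation, which is the KL divergence when $y\in M$. Let $K\ge 1$ and let $\mathfrak T\in M$ be a threshold. The instances are $\Theta=\{\bm\theta\in M^K:\theta_i\neq\mathfrak T\ \forall i\}$, and the correct answer is $\mathcal I(\bm\theta)=\{i:\theta_i>\mathfrak T\}$. Rewards $Y_{t+1,i}\sim F_{\theta_i}$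 are independent over times $t\in\{0,1,\dots\}$ and arms $i$; at time $t$ an arm $I_t$ is chosen from the history $\mathcal H_t$ (possibly with independent randomization) and $Y_{t+1,I_t}$ is observed. Let $N_{t,i}$ be the number of samples of arm $i$ before time $t$, $p_{t,i}=N_{t,i}/t$, and $\theta_{t,i}$ the sample mean of arm $i$. For $\bm\theta\in\Theta$ and $\bm p$ in the probability simplex $\mathcal S_K$ put $$\mathrm{Alt}_x(\bm\theta)=\{\bm\vartheta\in\Theta:(\mathfrak T-\vartheta_x)(\mathfrak T-\theta_x)<0\},\qquad C_x(\bm p;\bm\theta)=\inf_{\bm\vartheta\in\mathrm{Alt}_x(\bm\theta)}\sum_{i}p_i\,d(\theta_i,\vartheta_i),$$ $\Gamma_{\bm\theta}(\bm p)=\min_{x}C_x(\bm p;\bm\theta)$ and $\Gamma^*_{\bm\theta}=\max_{\bm p\in\mathcal S_K}\Gamma_{\bm\theta}(\bm p)$. **Algorithm.** On data, $C_x(\bm p_t;\bm\theta_t)=p_{t,x}\,d(\theta_{t,x},\mathfrak T)$ (equal to $0$ if $N_{t,x}=0$) and $\Gamma_{\bm\theta_t}(\bm p_t)=\min_xC_x(\bm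 p_t;\bm\theta_t)$. EB-KKT-IDS detects a pitfall $x_t\in\arg\min_xC_x(\bm p_t;\bm\theta_t)$, ties being broken arbitrarily, and draws $I_t$ from the selection vector $\bm h^{x_t}$, which for this query is $h^x_x=1$, $h^x_i=0$ for $i\ne x$. For confidence parameter $\delta\in(0,1)$ the Chernoff stopping rule is $\tau_\delta=\inf\{t: t\,\Gamma_{\bm\theta_t}(\bm p_t)>\gamma(t,\delta)\}$ with $$\gamma(t,\delta)=3\sum_{i}\log(1+\log N_{t,i})+K\,\mathcal C_{\exp}\!\left(\tfrac{\log(1/\delta)}{K}\right),$$ where $\mathcal C_{\exp}(x)=2\,\widetilde h_{3/2}\bigl(\tfrac12(h^{-1}(1+x)+\log(2\zeta(2)))\bigr)$, $h(u)=u-\log u$ on $[1,\infty)$, and $\widetilde h_z(x)=e^{1/h^{-1}(x)}h^{-1}(x)$ if $x\ge h(1/\log z)$, $\widetilde h_z(x)=z(x-\log\log z)$ otherwise. The decision is $\mathcal I(\bm\theta_{\tau_\delta})$. **Theorem.** For every version of the EB-KKT-IDS allocation rule: 1. For every $\bm\theta\in\Theta$, the problem $\max_{\bm p\in\mathcal S_K}\Gamma_{\bm\theta}(\bm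 p)$ has a unique solution $\bm p^*$, it is componentwise strictly positive, and $\bm p_t\xrightarrow{\mathcal L}\bm p^*$ under $\mathbb P_{\bm\theta}$; that is, for all $i$ and $\epsilon>0$ there is an integrable random variable $T$ such that almost surely $|p_{t,i}-p^*_i|\le\epsilon$ for all $t\ge T$. 2. Combined with the Chernoff stopping rule and the decision rule above, the algorithm is universally efficient: for every $\delta\in(0,1)$ it is $\delta$-correct, i.e. $\mathbb P_{\bm\theta}(\tau_\delta<\infty,\ \mathcal I(\bm\theta_{\tau_\delta})=\mathcal I(\bm\theta))\ge1-\delta$ for all $\bm\theta\in\Theta$; and for every policy $\pi$ that is $\delta$-correct for all $\delta\in(0,1)$, with stopping times $\tau^\pi_\delta$, $$\limsup_{\delta\to0}\frac{\mathbb E_{\bm\theta}[\tau_\delta]}{\mathbb E^{\pi}_{\bm\theta}[\tau^\pi_\delta]}\le1\qquad\text{for all }\bm\theta\in\Theta.$$ In particular $\lim_{\delta\to0}\mathbb E_{\bm\theta}[\tau_\delta]/\log(1/\delta)=1/\Gamma^*_{\bm\theta}$ for all $\bm\theta\in\Theta$. -/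

import Mathlib

open MeasureTheory ProbabilityTheory Filter Topology
open scoped ENNReal

noncomputable section

/-! ### One-parameter exponential families on the real line -/

/-- A non-singular one-parameter natural exponential family: the densities
`exp (η y - A η)` with respect to a reference measure `base` on `ℝ`. Non-singular means that the
variance is positive at every interior natural parameter. -/
structure ExpFamily where
  base : Measure ℝ
  nonsingular : ∀ η ∈ interior (integrableExpSet id base),
    0 < Var[id; base.tilted (fun y => η * y)]

namespace ExpFamily

variable (E : ExpFamily)

/-- The natural parameter space `{η : ∫ exp (η y) d base < ∞}`. -/
def natSpace : Set ℝ := integrableExpSet id E.base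

/-- The log-partition function `A η = log ∫ exp (η y) d base`. -/
def logPart (η : ℝ) : ℝ := cgf id E.base η

/-- The member with natural parameter `η`, of density `exp (η y - A η)`. -/
def natLaw (η : ℝ) : Measure ℝ := E.base.tilted (fun y => η * y)

/-- The mean of the member with natural parameter `η`. -/
def meanOf (η : ℝ) : ℝ := ∫ y, y ∂(E.natLaw η)

/-- The set of means of the family, `η` ranging over the interior of the natural parameter
space. -/
def meanSpace : Set ℝ := E.meanOf '' interior E.natSpace

/-- The natural parameter of the member with mean `ϑ` (used for `ϑ` in `meanSpace`). -/
def natParam (ϑ : ℝ) : ℝ := Function.invFunOn E.meanOf (interior E.natSpace) ϑ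

/-- The member `F_ϑ` of the family with mean `ϑ` (used for `ϑ` in `meanSpace`). -/
def law (ϑ : ℝ) : Measure ℝ := E.natLaw (E.natParam ϑ)

/-- `d(θ, ϑ)`: the Kullback-Leibler divergence between the members of means `θ` and `ϑ`. -/
def kl (θ ϑ : ℝ) : ℝ≥0∞ := InformationTheory.klDiv (E.law θ) (E.law ϑ)

/-- `d(y, ϑ)` for an empirical mean `y`, which can be any real number: the log-likelihood ratio per
observation between the maximum likelihood member and the member of mean `ϑ`, for a sample with
mean `y`. It agrees with `kl y ϑ` when `y` is itself in `meanSpace` (see `glr_eq_kl`) and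
extends it to empirical means outside `meanSpace`, e.g. to `0` and `1` for Bernoulli rewards. -/
def glr (y ϑ : ℝ) : ℝ≥0∞ :=
  ⨆ η ∈ E.natSpace,
    ENNReal.ofReal ((η - E.natParam ϑ) * y - (E.logPart η - E.logPart (E.natParam ϑ)))

/-- On the means of the family the statistic `glr` is the Kullback-Leibler divergence. -/
theorem glr_eq_kl {θ ϑ : ℝ} (hθ : θ ∈ E.meanSpace) (hϑ : ϑ ∈ E.meanSpace) :
    E.glr θ ϑ = E.kl θ ϑ := by
  have h1 : E.natParam θ ∈ interior E.natSpace := Function.invFunOn_mem hθ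
  have h2 : E.natParam ϑ ∈ interior E.natSpace := Function.invFunOn_mem hϑ
  have e1 : E.meanOf (E.natParam θ) = θ := Function.invFunOn_eq hθ
  have hne : NeZero E.base := by
    refine ⟨fun h0 => ?_⟩
    have := E.nonsingular _ h1
    simp [h0] at this
  have hint : ∀ η ∈ E.natSpace, Integrable (fun y => Real.exp (η * y)) E.base := fun η h => h
  generalize hη1 : E.natParam θ = η1 at *
  generalize hη2 : E.natParam ϑ = η2 at *
  have i1 := hint _ (interior_subset h1)
  have i2 := hint _ (interior_subset h2)
  have P1 : IsProbabilityMeasure (E.natLaw η1) := isProbabilityMeasure_tilted i1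
  have P2 : IsProbabilityMeasure (E.natLaw η2) := isProbabilityMeasure_tilted i2
  have key : ∀ η ∈ E.natSpace, ∀ η' ∈ E.natSpace,
      Integrable (fun y => Real.exp ((η - η') * y)) (E.natLaw η') ∧
      Real.log (∫ y, Real.exp ((η - η') * y) ∂(E.natLaw η')) = E.logPart η - E.logPart η' := by
    intro η hη η' hη'
    constructor
    · rw [natLaw, integrable_tilted_iff (hint _ hη')]
      refine (hint _ hη).congr (Eventually.of_forall fun y => ?_)
      simp only [smul_eq_mul, ← Real.exp_add]; ring_nf
    · rw [natLaw, integral_exp_tilted]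
      have : (fun x : ℝ => Real.exp (((fun y => η' * y) + fun y => (η - η') * y) x))
          = fun x => Real.exp (η * x) := by
        funext x; simp only [Pi.add_apply]; ring_nf
      rw [this, Real.log_div (integral_exp_pos (hint _ hη)).ne'
        (integral_exp_pos (hint _ hη')).ne']
      rfl
  have m1 : Integrable (fun y : ℝ => y) (E.natLaw η1) := by
    have := memLp_tilted_mul (X := id) (μ := E.base) h1 1
    exact memLp_one_iff_integrable.1 (by exact_mod_cast this)
  -- the maximum of the log-likelihood
  have hmax : ∀ η ∈ E.natSpace, (η - η1) * θ ≤ E.logPart η - E.logPart η1 := by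
    intro η hη
    obtain ⟨a, b⟩ := key η hη η1 (interior_subset h1)
    rw [← b, ← e1, Real.le_log_iff_exp_le (integral_exp_pos a)]
    have hm : (η - η1) * E.meanOf η1 = ∫ y, (η - η1) * y ∂(E.natLaw η1) := by
      rw [integral_const_mul]; rfl
    set c := (η - η1) * E.meanOf η1
    have h3 : ∫ y, Real.exp c * (1 + ((η - η1) * y - c)) ∂(E.natLaw η1) = Real.exp c := by
      have h8 : Integrable (fun y => (η - η1) * y - c) (E.natLaw η1) :=
        (m1.const_mul _).sub (integrable_const _)
      rw [integral_const_mul, integral_add (integrable_const _) h8,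
        integral_sub (m1.const_mul _) (integrable_const _), ← hm]
      simp
    calc Real.exp c = _ := h3.symm
      _ ≤ _ := by
        refine integral_mono (((integrable_const _).add
          ((m1.const_mul _).sub (integrable_const _))).const_mul _) a fun y => ?_
        have h4 := Real.add_one_le_exp ((η - η1) * y - c)
        have : Real.exp ((η - η1) * y) = Real.exp c * Real.exp ((η - η1) * y - c) := by
          rw [← Real.exp_add]; ring_nf
        simp only [this]
        exact mul_le_mul_of_nonneg_left (by linarith) (Real.exp_pos _).le
  have hglr : E.glr θ ϑ =
      ENNReal.ofReal ((η1 - η2) * θ - (E.logPart η1 - E.logPart η2)) := by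
    unfold glr
    rw [hη2]
    refine le_antisymm (iSup₂_le fun η hη => ENNReal.ofReal_le_ofReal ?_)
      (le_iSup₂_of_le η1 (interior_subset h1) le_rfl)
    have := hmax η hη
    linarith
  -- the divergence
  obtain ⟨a, b⟩ := key η1 (interior_subset h1) η2 (interior_subset h2)
  have htl : E.natLaw η1 = (E.natLaw η2).tilted (fun y => (η1 - η2) * y) := by
    unfold natLaw
    rw [tilted_tilted i2]
    congr 1; funext y; simp only [Pi.add_apply]; ring
  have hac : E.natLaw η1 ≪ E.natLaw η2 := by
    rw [htl]; exact tilted_absolutelyContinuous _ _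
  have hllr : llr (E.natLaw η1) (E.natLaw η2) =ᵐ[E.natLaw η1]
      fun y => (η1 - η2) * y - (E.logPart η1 - E.logPart η2) := by
    have h5 := llr_tilted_left (μ := E.natLaw η2) (ν := E.natLaw η2)
      (f := fun y => (η1 - η2) * y) Measure.AbsolutelyContinuous.rfl a
      (measurable_const_mul _).aemeasurable
    rw [← htl, b] at h5
    refine hac.ae_le ?_
    filter_upwards [h5, llr_self (E.natLaw η2)] with y h6 h7
    rw [h6, h7]; simp
  have hkl : InformationTheory.klDiv (E.natLaw η1) (E.natLaw η2) =
      ENNReal.ofReal ((η1 - η2) * θ - (E.logPart η1 - E.logPart η2)) := by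
    rw [InformationTheory.klDiv_of_ac_of_integrable hac
      ((integrable_congr hllr).2 ((m1.const_mul _).sub (integrable_const _))),
      integral_congr_ae hllr, integral_sub (m1.const_mul _) (integrable_const _),
      integral_const_mul]
    have : ∫ y, y ∂(E.natLaw η1) = θ := e1
    simp [this]
  rw [hglr, kl, law, law, hη1, hη2, hkl]

end ExpFamily

/-! ### Threshold queries, generalized Chernoff information, optimal allocation -/

/-- The correct answer: the set of arms whose mean exceeds the threshold. -/
def answer {K : ℕ} (thr : ℝ) (θ : Fin K → ℝ) : Set (Fin K) := {i | thr < θ i}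

namespace ExpFamily

variable (E : ExpFamily) {K : ℕ}

/-- The set `Θ` of problem instances: means of the family, none of them equal to the
threshold. -/
def instances (K : ℕ) (thr : ℝ) : Set (Fin K → ℝ) := {θ | ∀ i, θ i ∈ E.meanSpace ∧ θ i ≠ thr}

/-- `Alt_x(θ)`: the instances in which arm `x` is on the other side of the threshold. -/
def alt (thr : ℝ) (x : Fin K) (θ : Fin K → ℝ) : Set (Fin K → ℝ) :=
  {ϑ | ϑ ∈ E.instances K thr ∧ (thr - ϑ x) * (thr - θ x) < 0}

/-- The generalized Chernoff information `C_x(p; θ)` of pitfall `x`. -/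
def chernoffInfo (thr : ℝ) (θ : Fin K → ℝ) (x : Fin K) (p : Fin K → ℝ) : ℝ≥0∞ :=
  ⨅ ϑ ∈ E.alt thr x θ, ∑ i, ENNReal.ofReal (p i) * E.kl (θ i) (ϑ i)

/-- `Γ_θ(p) = min_x C_x(p; θ)`. -/
def Gam (thr : ℝ) (θ : Fin K → ℝ) (p : Fin K → ℝ) : ℝ≥0∞ := ⨅ x, E.chernoffInfo thr θ x p

/-- `Γ*_θ = max_p Γ_θ(p)` over the probability simplex. -/
def GamStar (thr : ℝ) (θ : Fin K → ℝ) : ℝ≥0∞ := ⨆ p ∈ stdSimplex ℝ (Fin K), E.Gam thr θ p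

/-- `p` is the unique solution of the optimal allocation problem `max_p Γ_θ(p)`. -/
def IsUniqueOptimal (thr : ℝ) (θ : Fin K → ℝ) (p : Fin K → ℝ) : Prop :=
  p ∈ stdSimplex ℝ (Fin K) ∧ IsMaxOn (E.Gam thr θ) (stdSimplex ℝ (Fin K)) p ∧
    ∀ q ∈ stdSimplex ℝ (Fin K), IsMaxOn (E.Gam thr θ) (stdSimplex ℝ (Fin K)) q → q = p

end ExpFamily

/-! ### Policies and the bandit probability space -/

/-- The history `(I_0, Y_{1,I_0}, …, I_{t-1}, Y_{t,I_{t-1}})` at time `t`. -/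
abbrev Hist (K t : ℕ) : Type := Fin t → Fin K × ℝ

/-- A (possibly randomized) allocation rule: the arm chosen at time `t` from the history and an
independent uniform variable on `[0, 1]`. -/
abbrev Alloc (K : ℕ) : Type := (t : ℕ) → Hist K t → unitInterval → Fin K

/-- A policy: allocation rule, stopping rule (the histories at which it stops), decision rule. -/
structure Policy (K : ℕ) where
  alloc : Alloc K
  stopSet : (t : ℕ) → Set (Hist K t)
  decision : (t : ℕ) → Hist K t → Set (Fin K)

/-- Measurability of an allocation rule. -/
def Alloc.IsMeasurable {K : ℕ} (a : Alloc K) : Prop :=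
  ∀ t, Measurable (fun z : Hist K t × unitInterval => a t z.1 z.2)

/-- Measurability of a policy. -/
def Policy.IsMeasurable {K : ℕ} (π : Policy K) : Prop :=
  π.alloc.IsMeasurable ∧ (∀ t, MeasurableSet (π.stopSet t)) ∧
    ∀ t S, MeasurableSet {h | π.decision t h = S}

/-- Sample points: for every time `t`, the reward vector `(Y_{t+1,i})_i` and the uniform variable
used by the allocation rule at time `t`. -/
abbrev BanditSpace (K : ℕ) : Type := ℕ → (Fin K → ℝ) × unitInterval

/-- `ℙ_θ`: all rewards `Y_{t+1,i} ∼ F_{θ_i}` and all uniform variables are independent. -/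
def ExpFamily.prob (E : ExpFamily) {K : ℕ} (θ : Fin K → ℝ) : Measure (BanditSpace K) :=
  Measure.infinitePi (fun _ : ℕ => (Measure.pi (fun i => E.law (θ i))).prod volume)

/-- The history generated by an allocation rule. -/
def hist {K : ℕ} (a : Alloc K) (ω : BanditSpace K) : (t : ℕ) → Hist K t
  | 0 => Fin.elim0
  | t + 1 =>
    Fin.snoc (hist a ω t) (a t (hist a ω t) (ω t).2, (ω t).1 (a t (hist a ω t) (ω t).2))

/-- `N_{t,i}`: the number of samples of arm `i`. -/
def count {K t : ℕ} (h : Hist K t) (i : Fin K) : ℕ := ∑ s, if (h s).1 = i then 1 else 0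

/-- `p_{t,i} = N_{t,i} / t`. -/
def prop {K t : ℕ} (h : Hist K t) (i : Fin K) : ℝ := (count h i : ℝ) / t

/-- The sample mean `θ_{t,i}` (used when `N_{t,i} > 0`). -/
def sampleMean {K t : ℕ} (h : Hist K t) (i : Fin K) : ℝ :=
  (∑ s, if (h s).1 = i then (h s).2 else 0) / (count h i : ℝ)

/-- The stopping time `τ`, with value `⊤` if the policy never stops. -/
def Policy.tau {K : ℕ} (π : Policy K) (ω : BanditSpace K) : ℕ∞ :=
  ⨅ (t : ℕ) (_ : hist π.alloc ω t ∈ π.stopSet t), (t : ℕ∞)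

/-- The expected sample complexity `𝔼_θ[τ]`. -/
def ExpFamily.expTau (E : ExpFamily) {K : ℕ} (θ : Fin K → ℝ) (π : Policy K) : ℝ≥0∞ :=
  ∫⁻ ω, (π.tau ω : ℝ≥0∞) ∂(E.prob θ)

/-- The class `𝒜`: a measurable policy for every confidence parameter `δ`, which stops with the
correct answer with probability at least `1 - δ` in every instance. -/
def ExpFamily.IsCorrect (E : ExpFamily) {K : ℕ} (thr : ℝ) (π : ℝ → Policy K) : Prop :=
  ∀ δ ∈ Set.Ioo (0 : ℝ) 1, (π δ).IsMeasurable ∧ ∀ θ ∈ E.instances K thr,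
    ENNReal.ofReal (1 - δ) ≤ E.prob θ {ω | ∃ t : ℕ, (π δ).tau ω = t ∧
      (π δ).decision t (hist (π δ).alloc ω t) = answer thr θ}

/-- Universal efficiency in the fixed-confidence setting. -/
def ExpFamily.IsUniversallyEfficient (E : ExpFamily) {K : ℕ} (thr : ℝ) (π : ℝ → Policy K) :
    Prop :=
  E.IsCorrect thr π ∧ ∀ π' : ℝ → Policy K, E.IsCorrect thr π' → ∀ θ ∈ E.instances K thr,
    limsup (fun δ : ℝ => E.expTau θ (π δ) / E.expTau θ (π' δ)) (𝓝[>] 0) ≤ 1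

/-- `𝓛`-convergence of real random variables. -/
def LConv {Ω : Type*} [MeasurableSpace Ω] (P : Measure Ω) (X : ℕ → Ω → ℝ) (x : ℝ) : Prop :=
  ∀ ε > 0, ∃ T : Ω → ℝ, Integrable T P ∧ ∀ᵐ ω ∂P, ∀ t : ℕ, T ω ≤ t → |X t ω - x| ≤ ε

/-! ### The EB-KKT-IDS allocation rule and the Chernoff stopping rule -/

/-- `C_i(p_t; θ_t) = p_{t,i} d(θ_{t,i}, thr)`, which is `0` for an arm not yet sampled. -/
def ExpFamily.empInfo (E : ExpFamily) (thr : ℝ) {K t : ℕ} (h : Hist K t) (i : Fin K) : ℝ≥0∞ :=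
  ENNReal.ofReal (prop h i) * E.glr (sampleMean h i) thr

/-- The selection vector `h^x` of information-directed selection: for a threshold query the pitfall
`x` concerns arm `x` only, so `h^x_x = 1` and `h^x_i = 0` for `i ≠ x`. -/
def selProb {K : ℕ} (x i : Fin K) : ℝ≥0∞ := if i = x then 1 else 0

/-- `a` is an EB-KKT-IDS allocation rule: from the empirical means (EB), a pitfall with the smallest
`C_x(p_t; θ_t)` is detected (KKT), ties being broken in any way, possibly at random (`det t h x` is
the probability of detecting `x`), and then an arm is drawn from the selection vector of the
detected pitfall (IDS). -/
def ExpFamily.IsEBKKTIDS (E : ExpFamily) (thr : ℝ) {K : ℕ} (a : Alloc K) : Prop :=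
  ∃ det : (t : ℕ) → Hist K t → Fin K → ℝ≥0∞,
    (∀ t h, ∑ x, det t h x = 1) ∧
    (∀ t h x, det t h x ≠ 0 → ∀ y, E.empInfo thr h x ≤ E.empInfo thr h y) ∧
    ∀ t h i, volume {u | a t h u = i} = ∑ x, det t h x * selProb x i

/-- `h(u) = u - log u`. -/
def hFun (u : ℝ) : ℝ := u - Real.log u

/-- The inverse of `h` on `[1, ∞)`. -/
def hInv (x : ℝ) : ℝ := Function.invFunOn hFun (Set.Ici 1) x

/-- The function `h̃_z`. -/
def hTilde (z x : ℝ) : ℝ :=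
  if hFun (1 / Real.log z) ≤ x then Real.exp (1 / hInv x) * hInv x
  else z * (x - Real.log (Real.log z))

/-- The function `𝒞_exp`, where `ζ(2) = ∑ 1 / n ^ 2`. -/
def Cexp (x : ℝ) : ℝ :=
  2 * hTilde (3 / 2) ((hInv (1 + x) + Real.log (2 * ∑' n : ℕ, 1 / ((n : ℝ) + 1) ^ 2)) / 2)

/-- The stopping threshold `γ(t, δ)`. The values `N_{t,i} = 0` play no role, because the statistic
`Γ_{θ_t}(p_t)` is then `0`. -/
def stopThreshold {K t : ℕ} (h : Hist K t) (δ : ℝ) : ℝ :=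
  3 * ∑ i, Real.log (1 + Real.log (count h i)) + K * Cexp (Real.log (1 / δ) / K)

/-- The policy with confidence parameter `δ` made of an allocation rule, the Chernoff stopping rule
`t Γ_{θ_t}(p_t) > γ(t, δ)` and the decision `𝓘(θ_τ)`. -/
def ExpFamily.chernoffPolicy (E : ExpFamily) (thr : ℝ) {K : ℕ} (a : Alloc K) (δ : ℝ) :
    Policy K where
  alloc := a
  stopSet t := {h | ENNReal.ofReal (stopThreshold h δ) < t * ⨅ i, E.empInfo thr h i}
  decision _ h := answer thr (sampleMean h)

end

/-! ### The bandit probability space -/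

/-! Write $d_i = d(\theta_i,\mathfrak T)$. To realise pitfall $x$ it is enough to move arm $x$ just
past the threshold, and $d(\theta_x,\cdot)$ grows away from $\theta_x$, so $C_x(p;\theta) = p_x d_x$
(`Gam_eq`). The max-min problem is solved by equalising: $p^*_i = V/d_i$ with $V = (\sum_i
1/d_i)^{-1}$. An allocation of value at least $V$ dominates $p^*$ in every coordinate and has the
same sum, hence equals it.

The rule always samples the arm with the smallest $N_i\,d(\theta_{t,i},\mathfrak T)$, so it tries to
equalise these numbers. By Ville's inequality, $n$ times the deviation $d(\theta_{t,i},\theta_i)$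
after $n$ samples has tail $2e^{-x}$; hence the sum over $n$ of those values that exceed $cn$ is
integrable (`lintegral_totalDeviation_lt_top`). Outside these large deviations the statistic is
within $e$ of $d_i$. Inside them $N_i$ and $N_i\,d(\theta_{t,i},\mathfrak T)$ are at most a constant
times the sum. An induction on time then gives, on almost every path, $N_i(d_i-e)\le N_j(d_j+e)+R$
with $R$ integrable (`count_balanced`). This forces the proportions towards $p^*$ after an
integrable time, without forced exploration (`exists_integrable_time`).

A wrong answer needs an arm whose sample mean lies on the wrong side of the threshold while its
statistic crosses $\gamma$. Some likelihood ratio against the true parameter is then large. Peeling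
the sample size into geometric slices and applying Ville's inequality in each slice gives
probability at most $\delta/K$ per arm (`measure_wrong_side_le`).

For the lower bound, Wald's identity and a change of measure at the truncated stopping time give
$(1-\delta)\log(1/\delta)-2\le V\,\mathbb E\tau$ for every correct policy (`le_expTau_of_correct`).
For the upper bound, once proportions and statistics are near their limits the rule stops as soon as
$tV$ slightly exceeds $\gamma$. Since $\mathcal C_{\exp}(x)\sim x$, this costs $\log(1/\delta)/V$ to
first order (`exists_tau_le`, `tendsto_Cexp_div`). -/

/-- The joint law of the rewards and of the uniform variable at one time, arm `i` having reward
law `μ i`. -/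
noncomputable def stepMeasure {K : ℕ} (μ : Fin K → Measure ℝ) :
    Measure ((Fin K → ℝ) × unitInterval) :=
  (Measure.pi μ).prod volume

/-- The law of all rewards and uniform variables, arm `i` having reward law `μ i`. -/
noncomputable def banditMeasure {K : ℕ} (μ : Fin K → Measure ℝ) : Measure (BanditSpace K) :=
  Measure.infinitePi (fun _ : ℕ => stepMeasure μ)

instance {K : ℕ} (μ : Fin K → Measure ℝ) [∀ i, IsProbabilityMeasure (μ i)] :
    IsProbabilityMeasure (stepMeasure μ) := by
  unfold stepMeasure; infer_instance

instance {K : ℕ} (μ : Fin K → Measure ℝ) [∀ i, IsProbabilityMeasure (μ i)] :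
    IsProbabilityMeasure (banditMeasure μ) := by
  unfold banditMeasure; infer_instance

/-- One step of the interaction: the history is extended by the chosen arm and its reward. -/
def histStep {K : ℕ} (a : Alloc K) (t : ℕ) (p : Hist K t × ((Fin K → ℝ) × unitInterval)) :
    Hist K (t + 1) :=
  Fin.snoc (α := fun _ => Fin K × ℝ) p.1 (a t p.1 p.2.2, p.2.1 (a t p.1 p.2.2))

theorem hist_succ {K : ℕ} (a : Alloc K) (ω : BanditSpace K) (t : ℕ) :
    hist a ω (t + 1) = histStep a t (hist a ω t, ω t) := rfl

theorem measurable_apply_arm {K : ℕ} :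
    Measurable (fun p : (Fin K → ℝ) × Fin K => p.1 p.2) :=
  measurable_from_prod_countable_left fun i => measurable_pi_apply i

theorem Alloc.IsMeasurable.arm {K : ℕ} {a : Alloc K} (ha : a.IsMeasurable) (t : ℕ) :
    Measurable (fun p : Hist K t × ((Fin K → ℝ) × unitInterval) => a t p.1 p.2.2) :=
  (ha t).comp (measurable_fst.prodMk (measurable_snd.comp measurable_snd))

theorem measurable_histStep {K : ℕ} {a : Alloc K} (ha : a.IsMeasurable) (t : ℕ) :
    Measurable (histStep a t) := by
  refine measurable_pi_iff.2 fun j => ?_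
  refine Fin.lastCases ?_ (fun j => ?_) j
  · simp only [histStep, Fin.snoc_last]
    refine (ha.arm t).prodMk ?_
    exact measurable_apply_arm.comp
      ((measurable_fst.comp measurable_snd).prodMk (ha.arm t))
  · simp only [histStep, Fin.snoc_castSucc]
    exact (measurable_pi_apply j).comp measurable_fst

/-- The σ-algebra of the rewards and uniform variables of the times before `t`. -/
abbrev pastAlg (K t : ℕ) : MeasurableSpace (BanditSpace K) :=
  ⨆ s ∈ Set.Iio t, MeasurableSpace.comap (fun ω : BanditSpace K => ω s) inferInstance

theorem pastAlg_mono (K : ℕ) {s t : ℕ} (h : s ≤ t) : pastAlg K s ≤ pastAlg K t :=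
  biSup_mono fun _ hr => lt_of_lt_of_le hr h

theorem pastAlg_le (K t : ℕ) : pastAlg K t ≤ (inferInstance : MeasurableSpace (BanditSpace K)) :=
  iSup₂_le fun s _ => (measurable_pi_apply s).comap_le

theorem measurable_hist_pastAlg {K : ℕ} {a : Alloc K} (ha : a.IsMeasurable) (t : ℕ) :
    Measurable[pastAlg K t] (fun ω => hist a ω t) := by
  induction t with
  | zero => exact @measurable_const' _ _ _ (pastAlg K 0) _ (fun _ _ => Subsingleton.elim _ _)
  | succ t ih =>
    have h1 : Measurable[pastAlg K (t + 1)] (fun ω => hist a ω t) :=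
      ih.mono (pastAlg_mono K t.le_succ) le_rfl
    have h2 : Measurable[pastAlg K (t + 1)] (fun ω : BanditSpace K => ω t) := by
      refine Measurable.mono (comap_measurable _) ?_ le_rfl
      exact le_iSup₂_of_le t (Nat.lt_succ_self t) le_rfl
    have h3 : Measurable[pastAlg K (t + 1)] (fun ω : BanditSpace K => (hist a ω t, ω t)) :=
      h1.prodMk h2
    exact (measurable_histStep ha t).comp h3

theorem measurable_hist {K : ℕ} {a : Alloc K} (ha : a.IsMeasurable) (t : ℕ) :
    Measurable (fun ω => hist a ω t) :=
  (measurable_hist_pastAlg ha t).mono (pastAlg_le K t) le_rfl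

/-- The σ-algebra of the history at time `t`. -/
abbrev histAlg {K : ℕ} (a : Alloc K) (t : ℕ) : MeasurableSpace (BanditSpace K) :=
  MeasurableSpace.comap (fun ω => hist a ω t) inferInstance

theorem histAlg_mono {K : ℕ} (a : Alloc K) : Monotone (histAlg a) := by
  refine monotone_nat_of_le_succ fun t => ?_
  have h : (fun ω => hist a ω t) =
      (fun h : Hist K (t + 1) => (fun j => h j.castSucc : Hist K t)) ∘ fun ω => hist a ω (t + 1) := by
    funext ω j
    simp [hist_succ, histStep]
  rw [histAlg, h, ← MeasurableSpace.comap_comp]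
  refine MeasurableSpace.comap_mono ?_
  exact Measurable.comap_le (measurable_pi_iff.2 fun j => measurable_pi_apply _)

theorem histAlg_le {K : ℕ} {a : Alloc K} (ha : a.IsMeasurable) (t : ℕ) :
    histAlg a t ≤ (inferInstance : MeasurableSpace (BanditSpace K)) :=
  (measurable_hist ha t).comap_le

theorem measurableSet_hist_preimage {K : ℕ} (a : Alloc K) {s t : ℕ} (hst : s ≤ t)
    {B : Set (Hist K s)} (hB : MeasurableSet B) :
    MeasurableSet[histAlg a t] {ω | hist a ω s ∈ B} :=
  histAlg_mono a hst _ ⟨B, hB, rfl⟩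

/-- The history at time $t$ is a function of the coordinates before $t$, which are independent of
coordinate $t$ under the product measure. -/
theorem indepFun_hist {K : ℕ} {a : Alloc K} (ha : a.IsMeasurable) (μ : Fin K → Measure ℝ)
    [∀ i, IsProbabilityMeasure (μ i)] (t : ℕ) :
    IndepFun (fun ω => hist a ω t) (fun ω => ω t) (banditMeasure μ) := by
  have h1 : iIndepFun (fun (s : ℕ) (ω : BanditSpace K) => ω s) (banditMeasure μ) :=
    iIndepFun_infinitePi (P := fun _ : ℕ => stepMeasure μ) (X := fun _ z => z)
      (fun _ => measurable_id)
  have h2 := indep_iSup_of_disjoint (fun s => (measurable_pi_apply s).comap_le)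
    ((iIndepFun_iff_iIndep ..).1 h1) (S := Set.Iio t) (T := {t}) (by simp)
  rw [IndepFun_iff_Indep]
  refine indep_of_indep_of_le_right (indep_of_indep_of_le_left h2 ?_) ?_
  · exact (measurable_hist_pastAlg ha t).comap_le
  · exact le_iSup₂_of_le t rfl le_rfl

theorem map_hist_prod {K : ℕ} {a : Alloc K} (ha : a.IsMeasurable) (μ : Fin K → Measure ℝ)
    [∀ i, IsProbabilityMeasure (μ i)] (t : ℕ) :
    (banditMeasure μ).map (fun ω => (hist a ω t, ω t)) =
      ((banditMeasure μ).map (fun ω => hist a ω t)).prod (stepMeasure μ) := by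
  rw [(indepFun_iff_map_prod_eq_prod_map_map (measurable_hist ha t).aemeasurable
    (measurable_pi_apply t).aemeasurable).1 (indepFun_hist ha μ t)]
  congr 1
  exact Measure.infinitePi_map_eval (fun _ : ℕ => stepMeasure μ) t

theorem lintegral_hist_step {K : ℕ} {a : Alloc K} (ha : a.IsMeasurable) (μ : Fin K → Measure ℝ)
    [∀ i, IsProbabilityMeasure (μ i)] (t : ℕ)
    {F : Hist K t × ((Fin K → ℝ) × unitInterval) → ℝ≥0∞} (hF : Measurable F) :
    ∫⁻ ω, F (hist a ω t, ω t) ∂(banditMeasure μ) =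
      ∫⁻ ω, ∫⁻ z, F (hist a ω t, z) ∂(stepMeasure μ) ∂(banditMeasure μ) := by
  have h1 : Measurable (fun ω : BanditSpace K => (hist a ω t, ω t)) :=
    (measurable_hist ha t).prodMk (measurable_pi_apply t)
  rw [← lintegral_map (f := F) (g := fun ω => (hist a ω t, ω t)) hF h1, map_hist_prod ha,
    lintegral_prod _ hF.aemeasurable,
    lintegral_map hF.lintegral_prod_right' (measurable_hist ha t)]

/-- Once $u$ is fixed the arm is fixed, and only the marginal of that arm in the product law
matters. -/
theorem lintegral_stepMeasure_arm {K : ℕ} (μ : Fin K → Measure ℝ)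
    [∀ i, IsProbabilityMeasure (μ i)] {I : unitInterval → Fin K} (hI : Measurable I)
    {φ : Fin K × ℝ → ℝ≥0∞} (hφ : Measurable φ) :
    ∫⁻ z, φ (I z.2, z.1 (I z.2)) ∂(stepMeasure μ) =
      ∫⁻ u, ∫⁻ y, φ (I u, y) ∂(μ (I u)) ∂volume := by
  have hm : Measurable (fun z : (Fin K → ℝ) × unitInterval => φ (I z.2, z.1 (I z.2))) :=
    hφ.comp ((hI.comp measurable_snd).prodMk
      (measurable_apply_arm.comp (measurable_fst.prodMk (hI.comp measurable_snd))))
  rw [stepMeasure, lintegral_prod_symm _ hm.aemeasurable]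
  refine lintegral_congr fun u => ?_
  rw [← (measurePreserving_eval μ (I u)).map_eq, lintegral_map (by fun_prop) (by fun_prop)]

/-! ### Likelihood ratios of histories and Ville's inequality -/

/-- The sum of the functions `g i` over the rewards of the history: a log-likelihood ratio when the
`g i` are those of the arms. -/
noncomputable def logLik {K t : ℕ} (g : Fin K → ℝ → ℝ) (h : Hist K t) : ℝ :=
  ∑ s, g (h s).1 (h s).2

theorem measurable_logLik {K t : ℕ} {g : Fin K → ℝ → ℝ} (hg : ∀ i, Measurable (g i)) :
    Measurable (logLik g (t := t)) := by
  have h1 : Measurable (fun p : Fin K × ℝ => g p.1 p.2) :=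
    measurable_from_prod_countable_right fun i => hg i
  exact Finset.measurable_sum _ fun s _ => h1.comp (measurable_pi_apply s)

theorem logLik_snoc {K t : ℕ} (g : Fin K → ℝ → ℝ) (h : Hist K t) (p : Fin K × ℝ) :
    logLik g (Fin.snoc (α := fun _ => Fin K × ℝ) h p : Hist K (t + 1)) =
      logLik g h + g p.1 p.2 := by
  simp [logLik, Fin.sum_univ_castSucc]

/-- Change of measure on the histories. -/
theorem lintegral_change_of_measure {K : ℕ} {a : Alloc K} (ha : a.IsMeasurable)
    {μ μ' : Fin K → Measure ℝ} [∀ i, IsProbabilityMeasure (μ i)]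
    [∀ i, IsProbabilityMeasure (μ' i)] {g : Fin K → ℝ → ℝ} (hg : ∀ i, Measurable (g i))
    (hμ : ∀ i, μ' i = (μ i).withDensity (fun y => ENNReal.ofReal (Real.exp (g i y)))) (t : ℕ)
    {G : Hist K t → ℝ≥0∞} (hG : Measurable G) :
    ∫⁻ ω, G (hist a ω t) ∂(banditMeasure μ') =
      ∫⁻ ω, G (hist a ω t) * ENNReal.ofReal (Real.exp (logLik g (hist a ω t)))
        ∂(banditMeasure μ) := by
  induction t with
  | zero =>
    have h0 : ∀ ω, hist a ω 0 = Fin.elim0 := fun ω => rfl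
    simp [h0, logLik]
  | succ t ih =>
    have hS := measurable_histStep ha t
    have hL : Measurable (fun h : Hist K (t + 1) => ENNReal.ofReal (Real.exp (logLik g h))) :=
      (Real.measurable_exp.comp (measurable_logLik hg)).ennreal_ofReal
    have hg' : Measurable (fun p : Fin K × ℝ => g p.1 p.2) :=
      measurable_from_prod_countable_right fun i => hg i
    simp only [hist_succ]
    -- Both sides are integrated over the last step given the history. The induction hypothesis,
    -- applied to the `μ'`-average of `G` over that step, leaves a one-step identity for a fixed
    -- history.
    rw [lintegral_hist_step ha μ' t (F := fun p => G (histStep a t p)) (hG.comp hS),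
      lintegral_hist_step ha μ t
        (F := fun p => G (histStep a t p) * ENNReal.ofReal (Real.exp (logLik g (histStep a t p))))
        ((hG.comp hS).mul (hL.comp hS)),
      ih (G := fun h => ∫⁻ z, G (histStep a t (h, z)) ∂(stepMeasure μ'))
        (hG.comp hS).lintegral_prod_right']
    refine lintegral_congr fun ω => ?_
    generalize hist a ω t = h
    have hφ : Measurable (fun p : Fin K × ℝ =>
        (Fin.snoc (α := fun _ => Fin K × ℝ) h p : Hist K (t + 1))) := by
      refine measurable_pi_iff.2 fun j => ?_
      refine Fin.lastCases ?_ (fun j => ?_) j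
      · simpa using! measurable_id
      · simp
    have hI : Measurable (fun u => a t h u) := (ha t).comp measurable_prodMk_left
    simp only [histStep]
    rw [lintegral_stepMeasure_arm μ' hI (φ := fun p => G (Fin.snoc (α := fun _ => Fin K × ℝ) h p))
      (hG.comp hφ),
      lintegral_stepMeasure_arm μ hI (φ := fun p => G (Fin.snoc (α := fun _ => Fin K × ℝ) h p) *
        ENNReal.ofReal (Real.exp (logLik g (Fin.snoc (α := fun _ => Fin K × ℝ) h p))))
      ((hG.comp hφ).mul (hL.comp hφ)), ← lintegral_mul_const']
    swap
    · exact ENNReal.ofReal_ne_top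
    refine lintegral_congr fun u => ?_
    have hy : Measurable (fun y => G (Fin.snoc (α := fun _ => Fin K × ℝ) h (a t h u, y))) :=
      (hG.comp hφ).comp measurable_prodMk_left
    have hd : Measurable (fun y => ENNReal.ofReal (Real.exp (g (a t h u) y))) :=
      (Real.measurable_exp.comp (hg _)).ennreal_ofReal
    -- The uniform variable has the same law on both sides, so only the density of the sampled arm
    -- enters.
    rw [hμ, lintegral_withDensity_eq_lintegral_mul _ hd hy, ← lintegral_mul_const']
    swap
    · exact ENNReal.ofReal_ne_top
    refine lintegral_congr fun y => ?_
    rw [logLik_snoc, Real.exp_add, ENNReal.ofReal_mul (Real.exp_pos _).le, Pi.mul_apply]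
    ring

theorem setLIntegral_change_of_measure {K : ℕ} {a : Alloc K} (ha : a.IsMeasurable)
    {μ μ' : Fin K → Measure ℝ} [∀ i, IsProbabilityMeasure (μ i)]
    [∀ i, IsProbabilityMeasure (μ' i)] {g : Fin K → ℝ → ℝ} (hg : ∀ i, Measurable (g i))
    (hμ : ∀ i, μ' i = (μ i).withDensity (fun y => ENNReal.ofReal (Real.exp (g i y)))) (t : ℕ)
    {D : Set (BanditSpace K)} (hD : MeasurableSet[histAlg a t] D) :
    banditMeasure μ' D =
      ∫⁻ ω in D, ENNReal.ofReal (Real.exp (logLik g (hist a ω t))) ∂(banditMeasure μ) := by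
  have hD' := histAlg_le ha t D hD
  obtain ⟨B, hB, rfl⟩ := hD
  have h := lintegral_change_of_measure ha hg hμ t (G := B.indicator 1)
    (measurable_one.indicator hB)
  rw [← lintegral_indicator hD', ← lintegral_indicator_one hD']
  refine h.trans (lintegral_congr fun ω => ?_)
  by_cases hω : hist a ω t ∈ B <;> simp [hω]

/-- Ville's inequality for the likelihood ratio process. -/
theorem measure_exists_le_logLik {K : ℕ} {a : Alloc K} (ha : a.IsMeasurable)
    {μ μ' : Fin K → Measure ℝ} [∀ i, IsProbabilityMeasure (μ i)]
    [∀ i, IsProbabilityMeasure (μ' i)] {g : Fin K → ℝ → ℝ} (hg : ∀ i, Measurable (g i))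
    (hμ : ∀ i, μ' i = (μ i).withDensity (fun y => ENNReal.ofReal (Real.exp (g i y)))) (x : ℝ) :
    banditMeasure μ {ω | ∃ t, x ≤ logLik g (hist a ω t)} ≤ ENNReal.ofReal (Real.exp (-x)) := by
  set A : ℕ → Set (BanditSpace K) := fun t => {ω | x ≤ logLik g (hist a ω t)} with hA
  have hmA : ∀ s t, s ≤ t → MeasurableSet[histAlg a t] (A s) := fun s t hst =>
    measurableSet_hist_preimage a hst (measurableSet_le measurable_const (measurable_logLik hg))
  -- `D t` is the event that the level is first reached at time `t`. It is determined by the history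
  -- at `t`, and there the density is at least `exp x`.
  set D := disjointed A with hDdef
  have hmD : ∀ t, MeasurableSet[histAlg a t] (D t) := by
    intro t
    rw [hDdef, disjointed_eq_inter_compl]
    refine MeasurableSet.inter (hmA t t le_rfl) ?_
    refine MeasurableSet.biInter (Set.to_countable _) fun s hs => ?_
    exact MeasurableSet.compl (hmA s t (le_of_lt hs))
  have hmD' : ∀ t, MeasurableSet (D t) := fun t => histAlg_le ha t _ (hmD t)
  have hdisj : Pairwise (Function.onFun Disjoint D) := disjoint_disjointed A
  have hU : {ω | ∃ t, x ≤ logLik g (hist a ω t)} = ⋃ t, D t := by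
    rw [hDdef, iUnion_disjointed]; ext; simp [hA]
  have hle : ∀ t, banditMeasure μ (D t) ≤
      ENNReal.ofReal (Real.exp (-x)) * banditMeasure μ' (D t) := by
    intro t
    rw [setLIntegral_change_of_measure ha hg hμ t (hmD t),
      ← lintegral_const_mul' _ _ ENNReal.ofReal_ne_top, ← setLIntegral_one]
    refine setLIntegral_mono' (hmD' t) fun ω hω => ?_
    have h1 : x ≤ logLik g (hist a ω t) := disjointed_subset A t hω
    rw [← ENNReal.ofReal_mul (Real.exp_pos _).le, ← Real.exp_add, ← ENNReal.ofReal_one]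
    exact ENNReal.ofReal_le_ofReal (Real.one_le_exp (by linarith))
  rw [hU, measure_iUnion hdisj hmD']
  calc ∑' t, banditMeasure μ (D t) ≤ ∑' t, ENNReal.ofReal (Real.exp (-x)) * banditMeasure μ' (D t) :=
        ENNReal.tsum_le_tsum hle
    _ = ENNReal.ofReal (Real.exp (-x)) * banditMeasure μ' (⋃ t, D t) := by
        rw [ENNReal.tsum_mul_left, measure_iUnion hdisj hmD']
    _ ≤ _ := mul_le_of_le_one_right' prob_le_one

/-! ### Likelihood ratios, divergences and the statistic of the exponential family -/

namespace ExpFamily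

variable (E : ExpFamily)

/-- The log-likelihood ratio per observation `(η' - η) y - (A η' - A η)` of the members with natural
parameters `η'` and `η`. -/
noncomputable def logRatio (η' η y : ℝ) : ℝ := (η' - η) * y - (E.logPart η' - E.logPart η)

theorem logRatio_add (η₁ η₂ η₃ y : ℝ) :
    E.logRatio η₁ η₂ y + E.logRatio η₂ η₃ y = E.logRatio η₁ η₃ y := by
  simp only [logRatio]; ring

theorem logRatio_self (η y : ℝ) : E.logRatio η η y = 0 := by simp [logRatio]

theorem measurable_logRatio (η' η : ℝ) : Measurable (E.logRatio η' η) := by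
  unfold logRatio; fun_prop

theorem continuous_logRatio (η' η : ℝ) : Continuous (E.logRatio η' η) := by
  unfold logRatio; fun_prop

theorem glr_eq_iSup (y ϑ : ℝ) :
    E.glr y ϑ = ⨆ η ∈ E.natSpace, ENNReal.ofReal (E.logRatio η (E.natParam ϑ) y) := rfl

/-- The supremum runs over an uncountable set, but a supremum of continuous functions is lower
semicontinuous. -/
theorem measurable_glr (ϑ : ℝ) : Measurable (fun y => E.glr y ϑ) := by
  simp only [glr_eq_iSup]
  refine LowerSemicontinuous.measurable ?_
  refine lowerSemicontinuous_iSup fun η => lowerSemicontinuous_iSup fun _ => ?_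
  exact (ENNReal.continuous_ofReal.comp (E.continuous_logRatio _ _)).lowerSemicontinuous

variable {E}

theorem natParam_mem {θ : ℝ} (hθ : θ ∈ E.meanSpace) : E.natParam θ ∈ interior E.natSpace :=
  Function.invFunOn_mem hθ

theorem natParam_mem_natSpace {θ : ℝ} (hθ : θ ∈ E.meanSpace) : E.natParam θ ∈ E.natSpace :=
  interior_subset (natParam_mem hθ)

theorem meanOf_natParam {θ : ℝ} (hθ : θ ∈ E.meanSpace) : E.meanOf (E.natParam θ) = θ :=
  Function.invFunOn_eq hθ

theorem base_ne_zero {θ : ℝ} (hθ : θ ∈ E.meanSpace) : NeZero E.base := by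
  refine ⟨fun h0 => ?_⟩
  have := E.nonsingular _ (natParam_mem hθ)
  simp [h0] at this

theorem integrable_exp_of_mem {η : ℝ} (h : η ∈ E.natSpace) :
    Integrable (fun y => Real.exp (η * y)) E.base := h

theorem isProbabilityMeasure_natLaw [NeZero E.base] {η : ℝ} (h : η ∈ E.natSpace) :
    IsProbabilityMeasure (E.natLaw η) :=
  isProbabilityMeasure_tilted (integrable_exp_of_mem h)

theorem isProbabilityMeasure_law {θ : ℝ} (hθ : θ ∈ E.meanSpace) :
    IsProbabilityMeasure (E.law θ) :=
  have := base_ne_zero hθ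
  isProbabilityMeasure_natLaw (natParam_mem_natSpace hθ)

/-- Makes `logRatio` a log-density, also for boundary points of the natural parameter set. The
supremum in `glr` runs over these too, so the change of measure must reach them. -/
theorem natLaw_eq_withDensity [NeZero E.base] {η' η : ℝ} (h' : η' ∈ E.natSpace)
    (h : η ∈ E.natSpace) :
    E.natLaw η' = (E.natLaw η).withDensity
      (fun y => ENNReal.ofReal (Real.exp (E.logRatio η' η y))) := by
  have htl : E.natLaw η' = (E.natLaw η).tilted (fun y => (η' - η) * y) := by
    unfold natLaw
    rw [tilted_tilted (integrable_exp_of_mem h)]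
    congr 1; funext y; simp only [Pi.add_apply]; ring
  have hint : ∫ y, Real.exp ((η' - η) * y) ∂(E.natLaw η) =
      Real.exp (E.logPart η' - E.logPart η) := by
    rw [natLaw, integral_exp_tilted]
    have : (fun x : ℝ => Real.exp (((fun y => η * y) + fun y => (η' - η) * y) x))
        = fun x => Real.exp (η' * x) := by
      funext x; simp only [Pi.add_apply]; ring_nf
    rw [this, Real.exp_sub]
    congr 1
    · exact (Real.exp_log (integral_exp_pos (integrable_exp_of_mem h'))).symm
    · exact (Real.exp_log (integral_exp_pos (integrable_exp_of_mem h))).symm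
  rw [htl, Measure.tilted, hint]
  congr 1; funext y
  rw [← Real.exp_sub]; rfl

theorem integrable_id_law {θ : ℝ} (hθ : θ ∈ E.meanSpace) :
    Integrable (fun y : ℝ => y) (E.law θ) := by
  have := memLp_tilted_mul (X := id) (μ := E.base) (natParam_mem hθ) 1
  exact memLp_one_iff_integrable.1 (by exact_mod_cast this)

theorem integral_id_law {θ : ℝ} (hθ : θ ∈ E.meanSpace) : ∫ y, y ∂(E.law θ) = θ :=
  meanOf_natParam hθ

theorem integrable_logRatio {θ : ℝ} (hθ : θ ∈ E.meanSpace) (η' η : ℝ) :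
    Integrable (E.logRatio η' η) (E.law θ) := by
  have := isProbabilityMeasure_law hθ
  exact ((integrable_id_law hθ).const_mul _).sub (integrable_const _)

theorem integral_logRatio {θ : ℝ} (hθ : θ ∈ E.meanSpace) (η' η : ℝ) :
    ∫ y, E.logRatio η' η y ∂(E.law θ) = E.logRatio η' η θ := by
  have := isProbabilityMeasure_law hθ
  simp only [logRatio]
  rw [integral_sub ((integrable_id_law hθ).const_mul _) (integrable_const _), integral_const_mul,
    integral_id_law hθ]
  simp

/-- The log-likelihood at the mean of a member is largest at that member. -/
theorem logRatio_natParam_nonpos {θ η : ℝ} (hθ : θ ∈ E.meanSpace) (hη : η ∈ E.natSpace) :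
    E.logRatio η (E.natParam θ) θ ≤ 0 := by
  have := base_ne_zero hθ
  have hP := isProbabilityMeasure_law hθ
  have hP' := isProbabilityMeasure_natLaw hη
  have hd := natLaw_eq_withDensity hη (natParam_mem_natSpace hθ)
  have h1 : ∫⁻ y, ENNReal.ofReal (Real.exp (E.logRatio η (E.natParam θ) y)) ∂(E.law θ) = 1 := by
    have := congrArg (fun m => m Set.univ) hd
    simp only [measure_univ, withDensity_apply _ MeasurableSet.univ,
      Measure.restrict_univ] at this
    exact this.symm
  have hm : Measurable (fun y => Real.exp (E.logRatio η (E.natParam θ) y)) :=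
    Real.measurable_exp.comp (E.measurable_logRatio _ _)
  have hi : Integrable (fun y => Real.exp (E.logRatio η (E.natParam θ) y)) (E.law θ) := by
    refine ⟨hm.aestronglyMeasurable, ?_⟩
    rw [hasFiniteIntegral_iff_ofReal (Eventually.of_forall fun y => (Real.exp_pos _).le), h1]
    exact ENNReal.one_lt_top
  have h2 : ∫ y, Real.exp (E.logRatio η (E.natParam θ) y) ∂(E.law θ) = 1 := by
    rw [integral_eq_lintegral_of_nonneg_ae (Eventually.of_forall fun y => (Real.exp_pos _).le)
      hm.aestronglyMeasurable, h1]
    simp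
  -- The density integrates to one, so $1+x\le e^x$ integrated against the law of mean `θ` makes the
  -- mean log ratio nonpositive.
  have h3 := integral_mono ((integrable_logRatio hθ η (E.natParam θ)).add (integrable_const 1)) hi
    fun y => Real.add_one_le_exp _
  simp only [Pi.add_apply] at h3
  rw [integral_add (integrable_logRatio hθ η (E.natParam θ)) (integrable_const 1),
    integral_logRatio hθ, h2] at h3
  simpa using h3

theorem glr_eq_ofReal {θ ϑ : ℝ} (hθ : θ ∈ E.meanSpace) :
    E.glr θ ϑ = ENNReal.ofReal (E.logRatio (E.natParam θ) (E.natParam ϑ) θ) := by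
  rw [glr_eq_iSup]
  refine le_antisymm (iSup₂_le fun η hη => ENNReal.ofReal_le_ofReal ?_)
    (le_iSup₂_of_le _ (natParam_mem_natSpace hθ) le_rfl)
  rw [← E.logRatio_add η (E.natParam θ)]
  linarith [logRatio_natParam_nonpos hθ hη]

theorem kl_eq_ofReal {θ ϑ : ℝ} (hθ : θ ∈ E.meanSpace) (hϑ : ϑ ∈ E.meanSpace) :
    E.kl θ ϑ = ENNReal.ofReal (E.logRatio (E.natParam θ) (E.natParam ϑ) θ) := by
  rw [← glr_eq_kl E hθ hϑ, glr_eq_ofReal hθ]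

theorem hasDerivAt_logPart {η : ℝ} (hη : η ∈ interior E.natSpace) :
    HasDerivAt E.logPart (E.meanOf η) η := by
  have h1 := (analyticAt_cgf hη).differentiableAt.hasDerivAt
  have h2 : deriv (cgf id E.base) η = E.meanOf η := by
    exact (integral_tilted_mul_self hη).symm
  rw [h2] at h1
  exact h1

theorem convex_natSpace : Convex ℝ E.natSpace := convex_integrableExpSet

/-- The derivative of the mean map is the second derivative of the log-partition function, i.e. the
variance, which is positive by `nonsingular`. -/
theorem strictMonoOn_meanOf : StrictMonoOn E.meanOf (interior E.natSpace) := by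
  have hd : Set.EqOn (deriv (cgf id E.base)) E.meanOf (interior E.natSpace) := by
    intro η hη
    exact (hasDerivAt_logPart hη).deriv
  refine StrictMonoOn.congr ?_ hd
  refine strictMonoOn_of_deriv_pos convex_natSpace.interior ?_ ?_
  · exact (analyticOnNhd_cgf (X := id) (μ := E.base)).deriv.continuousOn
  · intro η hη
    rw [interior_interior] at hη
    have h := variance_tilted_mul (X := id) (μ := E.base) hη
    rw [iteratedDeriv_succ, iteratedDeriv_one] at h
    rw [← h]
    exact E.nonsingular η hη

theorem natParam_meanOf {η : ℝ} (hη : η ∈ interior E.natSpace) :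
    E.natParam (E.meanOf η) = η :=
  strictMonoOn_meanOf.injOn (natParam_mem ⟨η, hη, rfl⟩) hη (meanOf_natParam ⟨η, hη, rfl⟩)

theorem natParam_lt_natParam {θ ϑ : ℝ} (hθ : θ ∈ E.meanSpace) (hϑ : ϑ ∈ E.meanSpace)
    (h : θ < ϑ) : E.natParam θ < E.natParam ϑ := by
  rw [← strictMonoOn_meanOf.lt_iff_lt (natParam_mem hθ) (natParam_mem hϑ), meanOf_natParam hθ,
    meanOf_natParam hϑ]
  exact h

variable (E) in
/-- The divergence `d(θ, ϑ)` between members of means `θ` and `ϑ`, as a real number. -/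
noncomputable def dist (θ ϑ : ℝ) : ℝ := E.logRatio (E.natParam θ) (E.natParam ϑ) θ

theorem dist_pos {θ ϑ : ℝ} (hθ : θ ∈ E.meanSpace) (hϑ : ϑ ∈ E.meanSpace) (h : θ ≠ ϑ) :
    0 < E.dist θ ϑ := by
  have h1 := kl_eq_ofReal hθ hϑ
  rw [← ENNReal.ofReal_pos, dist, ← h1, pos_iff_ne_zero]
  have := isProbabilityMeasure_law hθ
  have := isProbabilityMeasure_law hϑ
  intro h2
  rw [kl, InformationTheory.klDiv_eq_zero_iff] at h2
  apply h
  rw [← integral_id_law hθ, h2, integral_id_law hϑ]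

theorem dist_nonneg {θ ϑ : ℝ} (hθ : θ ∈ E.meanSpace) (hϑ : ϑ ∈ E.meanSpace) :
    0 ≤ E.dist θ ϑ := by
  have h1 := logRatio_natParam_nonpos hθ (natParam_mem_natSpace hϑ)
  have h2 := E.logRatio_add (E.natParam θ) (E.natParam ϑ) (E.natParam θ) θ
  rw [logRatio_self] at h2
  rw [dist]; linarith

/-- The divergence grows as its second argument moves away from the first. -/
theorem dist_mono {θ ϑ thr : ℝ} (hϑ : ϑ ∈ E.meanSpace)
    (ht : thr ∈ E.meanSpace) (h : (thr - ϑ) * (thr - θ) ≤ 0) : E.dist θ thr ≤ E.dist θ ϑ := by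
  have h1 : E.dist θ ϑ = E.dist θ thr + E.logRatio (E.natParam thr) (E.natParam ϑ) θ := by
    simp only [dist, logRatio_add]
  have h2 := logRatio_natParam_nonpos ht (natParam_mem_natSpace hϑ)
  -- Three-point identity: $d(\theta,\vartheta)=d(\theta,\mathfrak T)+d(\mathfrak
  -- T,\vartheta)+(\eta_{\mathfrak T}-\eta_\vartheta)(\theta-\mathfrak T)$. The last term is
  -- nonnegative because $\mathfrak T$ lies between the two means or equals one of them.
  have h3 : E.logRatio (E.natParam thr) (E.natParam ϑ) θ =
      -E.logRatio (E.natParam ϑ) (E.natParam thr) thr +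
        (E.natParam thr - E.natParam ϑ) * (θ - thr) := by
    simp only [logRatio]; ring
  have h4 : 0 ≤ (E.natParam thr - E.natParam ϑ) * (θ - thr) := by
    rcases lt_trichotomy ϑ thr with h5 | rfl | h5
    · have := natParam_lt_natParam hϑ ht h5
      have : 0 ≤ θ - thr := by
        by_contra! h6
        nlinarith [mul_pos (sub_pos.2 h5) (by linarith : 0 < thr - θ)]
      nlinarith
    · simp
    · have := natParam_lt_natParam ht hϑ h5
      have : θ - thr ≤ 0 := by
        by_contra! h6
        nlinarith [mul_pos (sub_pos.2 h5) h6]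
      nlinarith
  linarith

/-- On the side of the threshold opposite to the mean, the statistic for the threshold is bounded by
the likelihood ratios of the parameters beyond the threshold. -/
theorem exists_logRatio_gt_of_lt_glr {y θ thr c : ℝ} (hθ : θ ∈ E.meanSpace)
    (ht : thr ∈ E.meanSpace) (hc : 0 ≤ c) (h : ENNReal.ofReal c < E.glr y thr) :
    (y ≤ thr → thr < θ → ∃ η ∈ E.natSpace, η < E.natParam θ ∧ c < E.logRatio η (E.natParam θ) y) ∧
    (thr ≤ y → θ < thr → ∃ η ∈ E.natSpace, E.natParam θ < η ∧ c < E.logRatio η (E.natParam θ) y) := by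
  rw [glr_eq_iSup] at h
  obtain ⟨η, h⟩ := lt_iSup_iff.1 h
  obtain ⟨hη, h⟩ := lt_iSup_iff.1 h
  have hlt : c < E.logRatio η (E.natParam thr) y := (ENNReal.ofReal_lt_ofReal_iff'.1 h).1
  have h1 := logRatio_natParam_nonpos ht hη
  -- The log ratio at `thr` itself is nonpositive, so a value above `c ≥ 0` at `y` forces `η` to lie
  -- on the same side of the threshold parameter as `y` of `thr`. Replacing the reference `thr` by
  -- `θ` on the opposite side can only increase the ratio.
  have h2 : E.logRatio η (E.natParam thr) y =
      E.logRatio η (E.natParam thr) thr + (η - E.natParam thr) * (y - thr) := by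
    simp only [logRatio]; ring
  have h3 := E.logRatio_add η (E.natParam thr) (E.natParam θ) y
  have h4 := logRatio_natParam_nonpos ht (natParam_mem_natSpace hθ)
  have h5 : E.logRatio (E.natParam thr) (E.natParam θ) y =
      -E.logRatio (E.natParam θ) (E.natParam thr) thr
        + (E.natParam thr - E.natParam θ) * (y - thr) := by
    simp only [logRatio]; ring
  refine ⟨fun hy hlt' => ⟨η, hη, ?_, ?_⟩, fun hy hlt' => ⟨η, hη, ?_, ?_⟩⟩
  · have h6 := natParam_lt_natParam ht hθ hlt'
    by_contra! h7
    nlinarith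
  · have h6 := natParam_lt_natParam ht hθ hlt'
    nlinarith
  · have h6 := natParam_lt_natParam hθ ht hlt'
    by_contra! h7
    nlinarith
  · have h6 := natParam_lt_natParam hθ ht hlt'
    nlinarith

/-- The chain rule for log ratios survives the supremum, since the second term does not depend on
`η`. -/
theorem glr_le_add (y θ thr : ℝ) :
    E.glr y thr ≤ E.glr y θ + ENNReal.ofReal (E.logRatio (E.natParam θ) (E.natParam thr) y) := by
  rw [glr_eq_iSup]
  refine iSup₂_le fun η hη => ?_
  rw [← E.logRatio_add η (E.natParam θ)]
  refine ENNReal.ofReal_add_le.trans ?_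
  gcongr
  rw [glr_eq_iSup]
  exact le_iSup₂_of_le η hη le_rfl

theorem ofReal_logRatio_le_glr {η y θ : ℝ} (hη : η ∈ E.natSpace) :
    ENNReal.ofReal (E.logRatio η (E.natParam θ) y) ≤ E.glr y θ := by
  rw [glr_eq_iSup]
  exact le_iSup₂_of_le η hη le_rfl

/-- The empirical means with small statistic are close to the mean. -/
theorem exists_abs_sub_le_of_glr_le {θ ε : ℝ} (hθ : θ ∈ E.meanSpace) (hε : 0 < ε) :
    ∃ c > 0, ∀ y, E.glr y θ ≤ ENNReal.ofReal c → |y - θ| ≤ ε := by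
  have hd := hasDerivAt_logPart (natParam_mem hθ)
  rw [meanOf_natParam hθ] at hd
  have h1 := (hasDerivAt_iff_isLittleO.1 hd).def (half_pos hε)
  have h2 : ∀ᶠ η in 𝓝 (E.natParam θ), η ∈ E.natSpace :=
    mem_interior_iff_mem_nhds.1 (natParam_mem hθ)
  obtain ⟨r, hr, hball⟩ := Metric.eventually_nhds_iff.1 (h1.and h2)
  -- Testing the supremum at $\eta_\theta+s$ bounds $s(y-\theta)$ by the statistic plus the
  -- first-order remainder of $A$ at $\eta_\theta$. Each of these gets half of $\tfrac
  -- r2\varepsilon$, and both signs of $s$ are used.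
  have key : ∀ s, |s| = r / 2 → ∀ y, E.glr y θ ≤ ENNReal.ofReal (r / 2 * (ε / 2)) →
      s * (y - θ) ≤ r / 2 * ε := by
    intro s hs y hy
    obtain ⟨h3, h4⟩ := hball (y := E.natParam θ + s) (by
      rw [Real.dist_eq, add_sub_cancel_left, hs]; linarith)
    have h5 := (ofReal_logRatio_le_glr h4).trans hy
    rw [ENNReal.ofReal_le_ofReal_iff (by positivity)] at h5
    simp only [logRatio, add_sub_cancel_left, smul_eq_mul, Real.norm_eq_abs, hs] at h3 h5
    have h6 := (abs_le.1 h3).2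
    nlinarith
  refine ⟨r / 2 * (ε / 2), by positivity, fun y hy => ?_⟩
  have h3 := key (r / 2) (abs_of_pos (by linarith)) y hy
  have h4 := key (-(r / 2)) (by rw [abs_neg, abs_of_pos (by linarith)]) y hy
  rw [abs_le]
  constructor <;> nlinarith

/-- The statistic for the threshold is close to the divergence where the statistic for the true mean
is small. -/
theorem exists_glr_near {θ thr ε : ℝ} (hθ : θ ∈ E.meanSpace) (ht : thr ∈ E.meanSpace) (hε : 0 < ε) :
    ∃ c > 0, ∀ y, E.glr y θ ≤ ENNReal.ofReal c →
      ENNReal.ofReal (E.dist θ thr - ε) ≤ E.glr y thr ∧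
      E.glr y thr ≤ ENNReal.ofReal (E.dist θ thr + ε) := by
  -- A bound for the slope of the affine map `y ↦ logRatio`; the `+ 1` keeps it positive as a
  -- divisor.
  set D := |E.natParam θ - E.natParam thr| + 1 with hD
  have hD0 : 0 < D := by positivity
  obtain ⟨c, hc, h⟩ := exists_abs_sub_le_of_glr_le (ε := ε / 2 / D) hθ (by positivity)
  refine ⟨min c (ε / 2), by positivity, fun y hy => ?_⟩
  have h1 := h y (hy.trans (ENNReal.ofReal_le_ofReal (min_le_left _ _)))
  have h2 : |E.logRatio (E.natParam θ) (E.natParam thr) y - E.dist θ thr| ≤ ε / 2 := by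
    have : E.logRatio (E.natParam θ) (E.natParam thr) y - E.dist θ thr =
        (E.natParam θ - E.natParam thr) * (y - θ) := by simp only [dist, logRatio]; ring
    rw [this, abs_mul]
    calc _ ≤ D * (ε / 2 / D) := by gcongr; linarith
      _ = _ := by field_simp
  have h3 := abs_le.1 h2
  constructor
  · refine le_trans (ENNReal.ofReal_le_ofReal ?_) (ofReal_logRatio_le_glr (natParam_mem_natSpace hθ))
    linarith
  · refine (glr_le_add y θ thr).trans ?_
    calc _ ≤ ENNReal.ofReal (ε / 2) + ENNReal.ofReal (E.logRatio (E.natParam θ) (E.natParam thr) y) := by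
          gcongr
          exact hy.trans (ENNReal.ofReal_le_ofReal (min_le_right _ _))
      _ ≤ ENNReal.ofReal (ε / 2) + ENNReal.ofReal (E.dist θ thr + ε / 2) := by
          gcongr; linarith
      _ = _ := by
          rw [← ENNReal.ofReal_add (by positivity) (by linarith [dist_nonneg hθ ht])]
          congr 1; ring

/-- Where the statistic for the true mean is not small it dominates the one for the threshold. -/
theorem exists_glr_le_mul {θ thr c : ℝ} (hθ : θ ∈ E.meanSpace) (hc : 0 < c) :
    ∃ C > 0, ∀ y, ENNReal.ofReal c < E.glr y θ →
      E.glr y thr ≤ ENNReal.ofReal C * E.glr y θ := by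
  have h2 : ∀ᶠ η in 𝓝 (E.natParam θ), η ∈ E.natSpace :=
    mem_interior_iff_mem_nhds.1 (natParam_mem hθ)
  obtain ⟨r, hr, hball⟩ := Metric.eventually_nhds_iff.1 h2
  have hp : E.natParam θ + r / 2 ∈ E.natSpace := hball (by
    rw [Real.dist_eq, add_sub_cancel_left, abs_of_pos (by linarith)]; linarith)
  have hm : E.natParam θ - r / 2 ∈ E.natSpace := hball (by
    rw [Real.dist_eq, sub_sub_cancel_left, abs_neg, abs_of_pos (by linarith)]; linarith)
  set M := |E.logPart (E.natParam θ + r / 2) - E.logPart (E.natParam θ)| +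
    |E.logPart (E.natParam θ - r / 2) - E.logPart (E.natParam θ)| with hM
  have hM0 : 0 ≤ M := by positivity
  set B := |E.natParam θ - E.natParam thr| with hB
  have hB0 : 0 ≤ B := abs_nonneg _
  set A := |E.logPart (E.natParam θ) - E.logPart (E.natParam thr)| with hA
  have hA0 : 0 ≤ A := abs_nonneg _
  -- Testing at $\eta_\theta\pm r/2$ bounds $|y|$ by $\tfrac2r(G+M)$, where $G$ is the statistic for
  -- `θ`. By `glr_le_add` the statistic for `thr` is then at most an affine function of $G$, and its
  -- constant term is absorbed because $G>c$.
  refine ⟨1 + B * (2 / r) + (B * (2 / r) * M + A) / c, by positivity, fun y hy => ?_⟩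
  by_cases htop : E.glr y θ = ⊤
  · rw [htop, ENNReal.mul_top (by simp; positivity)]; exact le_top
  set G := (E.glr y θ).toReal with hG
  have hGe : E.glr y θ = ENNReal.ofReal G := (ENNReal.ofReal_toReal htop).symm
  have hG0 : 0 ≤ G := ENNReal.toReal_nonneg
  rw [hGe] at hy
  have hcG : c < G := (ENNReal.ofReal_lt_ofReal_iff'.1 hy).1
  have h3 := ofReal_logRatio_le_glr (θ := θ) (y := y) hp
  have h4 := ofReal_logRatio_le_glr (θ := θ) (y := y) hm
  rw [hGe, ENNReal.ofReal_le_ofReal_iff hG0] at h3 h4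
  simp only [logRatio, add_sub_cancel_left, sub_sub_cancel_left] at h3 h4
  have h5 : |y| ≤ 2 / r * (G + M) := by
    have e1 := le_abs_self (E.logPart (E.natParam θ + r / 2) - E.logPart (E.natParam θ))
    have e2 := le_abs_self (E.logPart (E.natParam θ - r / 2) - E.logPart (E.natParam θ))
    have e3 := abs_nonneg (E.logPart (E.natParam θ + r / 2) - E.logPart (E.natParam θ))
    have e4 := abs_nonneg (E.logPart (E.natParam θ - r / 2) - E.logPart (E.natParam θ))
    rw [div_mul_eq_mul_div, le_div_iff₀ hr]
    rcases abs_cases y with ⟨h, -⟩ | ⟨h, -⟩ <;> rw [h] <;> nlinarith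
  have h6 : E.logRatio (E.natParam θ) (E.natParam thr) y ≤ B * (2 / r * (G + M)) + A := by
    have e1 := le_abs_self ((E.natParam θ - E.natParam thr) * y)
    have e2 := neg_abs_le (E.logPart (E.natParam θ) - E.logPart (E.natParam thr))
    rw [abs_mul] at e1
    have e3 : B * |y| ≤ B * (2 / r * (G + M)) := by gcongr
    rw [logRatio]; linarith
  refine (glr_le_add y θ thr).trans ?_
  rw [hGe, ← ENNReal.ofReal_mul (by positivity)]
  refine (add_le_add_right (ENNReal.ofReal_le_ofReal h6) _).trans ?_
  rw [← ENNReal.ofReal_add hG0 (by positivity)]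
  refine ENNReal.ofReal_le_ofReal ?_
  have h7 : B * (2 / r) * M + A ≤ (B * (2 / r) * M + A) / c * G := by
    rw [div_mul_eq_mul_div, le_div_iff₀ hc]
    gcongr
  nlinarith

/-! ### The optimal allocation -/

variable {K : ℕ} {thr : ℝ} {θ : Fin K → ℝ}

/-- Only the term of arm `x` is kept, and it is smallest at the threshold by `dist_mono`. -/
theorem le_chernoffInfo (ht : thr ∈ E.meanSpace) (hθ : θ ∈ E.instances K thr) (x : Fin K)
    (p : Fin K → ℝ) :
    ENNReal.ofReal (p x) * ENNReal.ofReal (E.dist (θ x) thr) ≤ E.chernoffInfo thr θ x p := by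
  refine le_iInf₂ fun ϑ hϑ => ?_
  refine le_trans ?_ (Finset.single_le_sum
    (f := fun i => ENNReal.ofReal (p i) * E.kl (θ i) (ϑ i)) (fun _ _ => zero_le)
    (Finset.mem_univ x))
  rw [kl_eq_ofReal (hθ x).1 (hϑ.1 x).1]
  gcongr
  exact dist_mono (hϑ.1 x).1 ht hϑ.2.le

/-- Alternatives that change arm `x` alone cost $p_x\,d(\theta_x,\vartheta_x)$. The threshold is not
an admissible mean, so the bound is a limit as the natural parameter of arm `x` tends to that of
`thr` from the far side. -/
theorem chernoffInfo_le (ht : thr ∈ E.meanSpace) (hθ : θ ∈ E.instances K thr) (x : Fin K)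
    (p : Fin K → ℝ) :
    E.chernoffInfo thr θ x p ≤ ENNReal.ofReal (p x) * ENNReal.ofReal (E.dist (θ x) thr) := by
  have hI := natParam_mem ht
  have key : ∀ η ∈ interior E.natSpace, (thr - E.meanOf η) * (thr - θ x) < 0 →
      E.chernoffInfo thr θ x p ≤
        ENNReal.ofReal (p x) * ENNReal.ofReal (E.logRatio (E.natParam (θ x)) η (θ x)) := by
    intro η hη hlt
    have hmem : E.meanOf η ∈ E.meanSpace := ⟨η, hη, rfl⟩
    refine iInf₂_le_of_le (Function.update θ x (E.meanOf η)) ⟨fun i => ?_, by simpa using hlt⟩ ?_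
    · by_cases hi : i = x
      · subst hi
        rw [Function.update_self]
        exact ⟨hmem, fun h => by simp [h] at hlt⟩
      · rw [Function.update_of_ne hi]
        exact hθ i
    · rw [Finset.sum_eq_single x, Function.update_self, kl_eq_ofReal (hθ x).1 hmem,
        natParam_meanOf hη]
      · intro i _ hi
        rw [Function.update_of_ne hi, kl_eq_ofReal (hθ i).1 (hθ i).1, logRatio_self]
        simp
      · simp
  have hcont : Tendsto (fun η => ENNReal.ofReal (p x) *
      ENNReal.ofReal (E.logRatio (E.natParam (θ x)) η (θ x))) (𝓝 (E.natParam thr))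
      (𝓝 (ENNReal.ofReal (p x) * ENNReal.ofReal (E.dist (θ x) thr))) := by
    refine ENNReal.Tendsto.const_mul (ENNReal.tendsto_ofReal ?_) (Or.inr ENNReal.ofReal_ne_top)
    have hc : ContinuousAt E.logPart (E.natParam thr) := (hasDerivAt_logPart hI).continuousAt
    have : ContinuousAt (fun η => E.logRatio (E.natParam (θ x)) η (θ x)) (E.natParam thr) := by
      unfold logRatio; fun_prop
    exact this
  have hev : ∀ᶠ η in 𝓝 (E.natParam thr), η ∈ interior E.natSpace :=
    isOpen_interior.mem_nhds hI
  rcases lt_or_gt_of_ne (hθ x).2 with h | h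
  · refine ge_of_tendsto (hcont.mono_left (nhdsWithin_le_nhds (s := Set.Ioi (E.natParam thr)))) ?_
    filter_upwards [hev.filter_mono nhdsWithin_le_nhds, self_mem_nhdsWithin] with η h1 h2
    refine key η h1 ?_
    have := strictMonoOn_meanOf hI h1 h2
    rw [meanOf_natParam ht] at this
    nlinarith
  · refine ge_of_tendsto (hcont.mono_left (nhdsWithin_le_nhds (s := Set.Iio (E.natParam thr)))) ?_
    filter_upwards [hev.filter_mono nhdsWithin_le_nhds, self_mem_nhdsWithin] with η h1 h2
    refine key η h1 ?_
    have := strictMonoOn_meanOf h1 hI h2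
    rw [meanOf_natParam ht] at this
    nlinarith

theorem Gam_eq (ht : thr ∈ E.meanSpace) (hθ : θ ∈ E.instances K thr) (p : Fin K → ℝ) :
    E.Gam thr θ p = ⨅ x, ENNReal.ofReal (p x) * ENNReal.ofReal (E.dist (θ x) thr) :=
  iInf_congr fun x => le_antisymm (chernoffInfo_le ht hθ x p) (le_chernoffInfo ht hθ x p)

variable (E thr θ) in
/-- The value of the optimal allocation problem, as a real number. -/
noncomputable def optValue : ℝ := (∑ i, (E.dist (θ i) thr)⁻¹)⁻¹

variable (E thr θ) in
/-- The optimal allocation: inversely proportional to the divergences from the threshold. -/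
noncomputable def optAlloc (i : Fin K) : ℝ := E.optValue thr θ / E.dist (θ i) thr

theorem dist_thr_pos (ht : thr ∈ E.meanSpace) (hθ : θ ∈ E.instances K thr) (i : Fin K) :
    0 < E.dist (θ i) thr := dist_pos (hθ i).1 ht (hθ i).2

theorem optValue_pos (ht : thr ∈ E.meanSpace) (hK : 0 < K) (hθ : θ ∈ E.instances K thr) :
    0 < E.optValue thr θ := by
  have : Nonempty (Fin K) := ⟨⟨0, hK⟩⟩
  exact inv_pos.2 (Finset.sum_pos (fun i _ => inv_pos.2 (dist_thr_pos ht hθ i))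
    Finset.univ_nonempty)

theorem optAlloc_pos (ht : thr ∈ E.meanSpace) (hK : 0 < K) (hθ : θ ∈ E.instances K thr)
    (i : Fin K) : 0 < E.optAlloc thr θ i :=
  div_pos (optValue_pos ht hK hθ) (dist_thr_pos ht hθ i)

theorem sum_optAlloc (ht : thr ∈ E.meanSpace) (hK : 0 < K) (hθ : θ ∈ E.instances K thr) :
    ∑ i, E.optAlloc thr θ i = 1 := by
  have h := optValue_pos ht hK hθ
  simp only [optAlloc, div_eq_mul_inv, ← Finset.mul_sum]
  rw [optValue, inv_mul_cancel₀]
  exact (inv_pos.1 h).ne'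

theorem optAlloc_mul_dist (ht : thr ∈ E.meanSpace) (hθ : θ ∈ E.instances K thr) (i : Fin K) :
    E.optAlloc thr θ i * E.dist (θ i) thr = E.optValue thr θ :=
  div_mul_cancel₀ _ (dist_thr_pos ht hθ i).ne'

theorem Gam_optAlloc (ht : thr ∈ E.meanSpace) (hK : 0 < K) (hθ : θ ∈ E.instances K thr) :
    E.Gam thr θ (E.optAlloc thr θ) = ENNReal.ofReal (E.optValue thr θ) := by
  have : Nonempty (Fin K) := ⟨⟨0, hK⟩⟩
  rw [Gam_eq ht hθ]
  simp only [← ENNReal.ofReal_mul (optAlloc_pos ht hK hθ _).le, optAlloc_mul_dist ht hθ]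
  exact ciInf_const

/-- Each arm must satisfy $p_i d_i\ge V=p^*_i d_i$. -/
theorem optAlloc_le_of_optValue_le (ht : thr ∈ E.meanSpace) (hK : 0 < K)
    (hθ : θ ∈ E.instances K thr) {p : Fin K → ℝ}
    (h : ENNReal.ofReal (E.optValue thr θ) ≤ E.Gam thr θ p) (i : Fin K) :
    E.optAlloc thr θ i ≤ p i := by
  rw [Gam_eq ht hθ] at h
  have h1 := h.trans (iInf_le _ i)
  have hd := dist_thr_pos ht hθ i
  rw [← ENNReal.ofReal_mul' hd.le, ENNReal.ofReal_le_ofReal_iff'] at h1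
  rcases h1 with h1 | h1
  · rwa [optAlloc, div_le_iff₀ hd]
  · exact absurd h1 (optValue_pos ht hK hθ).not_ge

/-- Coordinatewise domination together with equal sums forces equality. -/
theorem optAlloc_unique (ht : thr ∈ E.meanSpace) (hK : 0 < K)
    (hθ : θ ∈ E.instances K thr) {p : Fin K → ℝ} (hp : p ∈ stdSimplex ℝ (Fin K))
    (h : ENNReal.ofReal (E.optValue thr θ) ≤ E.Gam thr θ p) : p = E.optAlloc thr θ := by
  have h1 := optAlloc_le_of_optValue_le ht hK hθ h
  have h2 : ∑ i, E.optAlloc thr θ i = ∑ i, p i := by rw [sum_optAlloc ht hK hθ, hp.2]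
  funext i
  exact ((Finset.sum_eq_sum_iff_of_le fun i _ => h1 i).1 h2 i (Finset.mem_univ i)).symm

theorem Gam_le_optValue (ht : thr ∈ E.meanSpace) (hK : 0 < K)
    (hθ : θ ∈ E.instances K thr) {p : Fin K → ℝ} (hp : p ∈ stdSimplex ℝ (Fin K)) :
    E.Gam thr θ p ≤ ENNReal.ofReal (E.optValue thr θ) := by
  by_contra! h
  have h1 := optAlloc_unique ht hK hθ hp h.le
  rw [h1, Gam_optAlloc ht hK hθ] at h
  exact lt_irrefl _ h

theorem optAlloc_mem (ht : thr ∈ E.meanSpace) (hK : 0 < K) (hθ : θ ∈ E.instances K thr) :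
    E.optAlloc thr θ ∈ stdSimplex ℝ (Fin K) :=
  ⟨fun i => (optAlloc_pos ht hK hθ i).le, sum_optAlloc ht hK hθ⟩

theorem isUniqueOptimal_optAlloc (ht : thr ∈ E.meanSpace) (hK : 0 < K)
    (hθ : θ ∈ E.instances K thr) : E.IsUniqueOptimal thr θ (E.optAlloc thr θ) := by
  refine ⟨optAlloc_mem ht hK hθ, fun p hp => ?_, fun q hq hmax => ?_⟩
  · show E.Gam thr θ p ≤ E.Gam thr θ (E.optAlloc thr θ)
    rw [Gam_optAlloc ht hK hθ]
    exact Gam_le_optValue ht hK hθ hp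
  · refine optAlloc_unique ht hK hθ hq ?_
    rw [← Gam_optAlloc ht hK hθ]
    exact hmax (optAlloc_mem ht hK hθ)

theorem GamStar_eq (ht : thr ∈ E.meanSpace) (hK : 0 < K) (hθ : θ ∈ E.instances K thr) :
    E.GamStar thr θ = ENNReal.ofReal (E.optValue thr θ) :=
  le_antisymm (iSup₂_le fun _ hp => Gam_le_optValue ht hK hθ hp)
    (le_iSup₂_of_le _ (optAlloc_mem ht hK hθ) (Gam_optAlloc ht hK hθ).ge)

end ExpFamily

/-! ### Deviations of the sample means -/

theorem measurableSet_arm_eq {K t : ℕ} (s : Fin t) (i : Fin K) :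
    MeasurableSet {h : Hist K t | (h s).1 = i} :=
  (measurable_fst.comp (measurable_pi_apply s)) (measurableSet_singleton i)

theorem measurable_count {K t : ℕ} (i : Fin K) :
    Measurable (fun h : Hist K t => count h i) :=
  Finset.measurable_sum _ fun s _ =>
    Measurable.ite (measurableSet_arm_eq s i) measurable_const measurable_const

theorem measurable_count_real {K t : ℕ} (i : Fin K) :
    Measurable (fun h : Hist K t => (count h i : ℝ)) :=
  (measurable_of_countable (fun n : ℕ => (n : ℝ))).comp (measurable_count i)

theorem measurable_sampleMean {K t : ℕ} (i : Fin K) :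
    Measurable (fun h : Hist K t => sampleMean h i) := by
  refine Measurable.div (Finset.measurable_sum _ fun s _ =>
    Measurable.ite (measurableSet_arm_eq s i) ?_ measurable_const) (measurable_count_real i)
  exact measurable_snd.comp (measurable_pi_apply s)

/-- Also holds for an unsampled arm, where the mean is a division by zero and the sum is empty. -/
theorem count_mul_sampleMean {K t : ℕ} (h : Hist K t) (i : Fin K) :
    (count h i : ℝ) * sampleMean h i = ∑ s, if (h s).1 = i then (h s).2 else 0 := by
  by_cases h0 : count h i = 0
  · have h1 : ∀ s, (h s).1 ≠ i := by
      intro s hs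
      have := Finset.sum_eq_zero_iff.1 h0 s (Finset.mem_univ s)
      simp [hs] at this
    simp [h0, h1]
  · rw [sampleMean, mul_div_cancel₀]
    exact_mod_cast h0

namespace ExpFamily

variable {E : ExpFamily} {K : ℕ}

/-- The log ratio is affine in the reward, so the sample mean is a sufficient statistic. -/
theorem logLik_single {t : ℕ} (h : Hist K t) (i : Fin K) (η' η : ℝ) :
    logLik (fun j y => if j = i then E.logRatio η' η y else 0) h =
      count h i * E.logRatio η' η (sampleMean h i) := by
  have h1 : (count h i : ℝ) * E.logRatio η' η (sampleMean h i) =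
      (η' - η) * (count h i * sampleMean h i) - count h i * (E.logPart η' - E.logPart η) := by
    rw [logRatio]; ring
  rw [h1, count_mul_sampleMean, logLik, count, Nat.cast_sum, Finset.mul_sum, Finset.sum_mul,
    ← Finset.sum_sub_distrib]
  refine Finset.sum_congr rfl fun s _ => ?_
  split_ifs <;> simp [logRatio]

theorem isProbabilityMeasure_prob {θ : Fin K → ℝ} (hθ : ∀ i, θ i ∈ E.meanSpace) :
    IsProbabilityMeasure (E.prob θ) := by
  have := fun i => isProbabilityMeasure_law (hθ i)
  exact inferInstanceAs (IsProbabilityMeasure (banditMeasure fun i => E.law (θ i)))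

/-- Ville's inequality for the alternative in which the law of arm `i` alone is replaced by that of
parameter `η`. -/
theorem measure_exists_le_logRatio {a : Alloc K} (ha : a.IsMeasurable) {θ : Fin K → ℝ}
    (hθ : ∀ i, θ i ∈ E.meanSpace) (i : Fin K) {η : ℝ} (hη : η ∈ E.natSpace) (x : ℝ) :
    E.prob θ {ω | ∃ t, x ≤ count (hist a ω t) i *
      E.logRatio η (E.natParam (θ i)) (sampleMean (hist a ω t) i)} ≤
      ENNReal.ofReal (Real.exp (-x)) := by
  have := base_ne_zero (hθ i)
  have hP := fun i => isProbabilityMeasure_law (hθ i)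
  have hP' : ∀ j, IsProbabilityMeasure (if j = i then E.natLaw η else E.law (θ j)) := by
    intro j
    split_ifs
    · exact isProbabilityMeasure_natLaw hη
    · exact hP j
  have h := measure_exists_le_logLik ha (μ := fun i => E.law (θ i))
    (μ' := fun j => if j = i then E.natLaw η else E.law (θ j))
    (g := fun j y => if j = i then E.logRatio η (E.natParam (θ i)) y else 0) ?_ ?_ x
  · simp only [logLik_single] at h
    exact h
  · intro j
    by_cases hj : j = i
    · simpa [hj] using E.measurable_logRatio _ _
    · simp [hj]
  · intro j
    by_cases hj : j = i
    · subst hj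
      simpa only [if_true] using! natLaw_eq_withDensity hη (natParam_mem_natSpace (hθ j))
    · simp only [hj, if_false, Real.exp_zero, ENNReal.ofReal_one]
      exact withDensity_one.symm

/-- Superlevel sets of affine functions with slopes of the same sign are nested. -/
theorem logRatio_superlevel_total {η₁ η₂ η c : ℝ} (h : 0 < (η₁ - η) * (η₂ - η)) :
    {y | c < E.logRatio η₁ η y} ⊆ {y | c < E.logRatio η₂ η y} ∨
      {y | c < E.logRatio η₂ η y} ⊆ {y | c < E.logRatio η₁ η y} := by
  have ht : ∀ η', {y | c < E.logRatio η' η y} =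
      {y | c + (E.logPart η' - E.logPart η) < (η' - η) * y} := by
    intro η'; ext y; simp only [logRatio, Set.mem_ofPred_eq]; constructor <;> intro h <;> linarith
  simp only [ht]
  generalize c + (E.logPart η₁ - E.logPart η) = b₁
  generalize c + (E.logPart η₂ - E.logPart η) = b₂
  generalize η₁ - η = a₁ at *
  generalize η₂ - η = a₂ at *
  have h1 : a₁ ≠ 0 := by rintro rfl; simp at h
  have h2 : a₂ ≠ 0 := by rintro rfl; simp at h
  rcases le_total (b₁ / a₁) (b₂ / a₂) with hle | hle
  · rcases mul_pos_iff.1 h with ⟨p1, p2⟩ | ⟨p1, p2⟩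
    · right; intro y hy
      rw [Set.mem_ofPred_eq] at hy ⊢
      rw [mul_comm, ← div_lt_iff₀ p2] at hy
      rw [mul_comm, ← div_lt_iff₀ p1]; linarith
    · left; intro y hy
      rw [Set.mem_ofPred_eq] at hy ⊢
      rw [mul_comm, ← lt_div_iff_of_neg p1] at hy
      rw [mul_comm, ← lt_div_iff_of_neg p2]; linarith
  · rcases mul_pos_iff.1 h with ⟨p1, p2⟩ | ⟨p1, p2⟩
    · left; intro y hy
      rw [Set.mem_ofPred_eq] at hy ⊢
      rw [mul_comm, ← div_lt_iff₀ p1] at hy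
      rw [mul_comm, ← div_lt_iff₀ p2]; linarith
    · right; intro y hy
      rw [Set.mem_ofPred_eq] at hy ⊢
      rw [mul_comm, ← lt_div_iff_of_neg p2] at hy
      rw [mul_comm, ← lt_div_iff_of_neg p1]; linarith

/-- One-sided deviation inequality, uniform over the sample sizes larger than `p`. -/
theorem measure_oneSided_le {a : Alloc K} (ha : a.IsMeasurable) {θ : Fin K → ℝ}
    (hθ : ∀ i, θ i ∈ E.meanSpace) (i : Fin K) {side : Set ℝ} (hs : side ⊆ E.natSpace)
    (hside : ∀ η ∈ side, ∀ η' ∈ side, 0 < (η - E.natParam (θ i)) * (η' - E.natParam (θ i)))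
    {p w : ℝ} (hp : 0 < p) (hw : 0 ≤ w) :
    E.prob θ {ω | ∃ t, p ≤ count (hist a ω t) i ∧ ∃ η ∈ side,
      w / p < E.logRatio η (E.natParam (θ i)) (sampleMean (hist a ω t) i)} ≤
      ENNReal.ofReal (Real.exp (-w)) := by
  set B : ℝ → Set ℝ := fun η => {y | w / p < E.logRatio η (E.natParam (θ i)) y} with hB
  have hBo : ∀ η ∈ side, IsOpen (B η) := fun η _ =>
    isOpen_lt continuous_const (E.continuous_logRatio _ _)
  -- Each `B η` is an open half-line, so countably many parameters suffice. Slopes of one sign make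
  -- the half-lines nested, and the union is directed: its measure is the supremum over single
  -- parameters, so the maximisation over `η` costs nothing beyond Ville's bound.
  obtain ⟨T, hTs, hTc, hTU⟩ := TopologicalSpace.isOpen_biUnion_countable side B hBo
  set Ev : T → Set (BanditSpace K) := fun η =>
    {ω | ∃ t, p ≤ count (hist a ω t) i ∧ sampleMean (hist a ω t) i ∈ B η} with hEv
  have hsub : {ω | ∃ t, p ≤ count (hist a ω t) i ∧ ∃ η ∈ side,
      w / p < E.logRatio η (E.natParam (θ i)) (sampleMean (hist a ω t) i)} ⊆ ⋃ η, Ev η := by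
    rintro ω ⟨t, h1, η, h2, h3⟩
    have h4 : sampleMean (hist a ω t) i ∈ ⋃ η ∈ side, B η := Set.mem_biUnion h2 h3
    rw [← hTU] at h4
    obtain ⟨η', h5, h6⟩ := Set.mem_iUnion₂.1 h4
    exact Set.mem_iUnion.2 ⟨⟨η', h5⟩, t, h1, h6⟩
  have : Countable T := hTc.to_subtype
  refine (measure_mono hsub).trans ?_
  have hdir : Directed (· ⊆ ·) Ev := by
    intro η η'
    rcases logRatio_superlevel_total (E := E) (c := w / p)
      (hside η (hTs η.2) η' (hTs η'.2)) with h | h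
    · exact ⟨η', fun ω ⟨t, h1, h2⟩ => ⟨t, h1, h h2⟩, le_rfl⟩
    · exact ⟨η, le_rfl, fun ω ⟨t, h1, h2⟩ => ⟨t, h1, h h2⟩⟩
  rw [hdir.measure_iUnion]
  refine iSup_le fun η => ?_
  refine (measure_mono ?_).trans (measure_exists_le_logRatio ha hθ i (hs (hTs η.2)) w)
  rintro ω ⟨t, h1, h2⟩
  refine ⟨t, ?_⟩
  have h3 : w / p < E.logRatio η (E.natParam (θ i)) (sampleMean (hist a ω t) i) := h2
  have h4 : 0 ≤ w / p := by positivity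
  calc w = p * (w / p) := by field_simp
    _ ≤ _ := mul_le_mul h1 h3.le h4 (Nat.cast_nonneg _)

/-- The factor 2 counts the parameters above and below the true one; the true parameter itself gives
log ratio zero. -/
theorem measure_glr_gt_le {a : Alloc K} (ha : a.IsMeasurable) {θ : Fin K → ℝ}
    (hθ : ∀ i, θ i ∈ E.meanSpace) (i : Fin K) {n : ℕ} (hn : 0 < n) {x : ℝ} (hx : 0 ≤ x) :
    E.prob θ {ω | ∃ t, count (hist a ω t) i = n ∧
      ENNReal.ofReal (x / n) < E.glr (sampleMean (hist a ω t) i) (θ i)} ≤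
      2 * ENNReal.ofReal (Real.exp (-x)) := by
  have hn' : (0 : ℝ) < n := by exact_mod_cast hn
  set η₀ := E.natParam (θ i) with hη₀
  have h1 := measure_oneSided_le ha hθ i (side := E.natSpace ∩ Set.Ioi η₀) Set.inter_subset_left
    (fun η h η' h' => mul_pos (sub_pos.2 h.2) (sub_pos.2 h'.2)) hn' hx
  have h2 := measure_oneSided_le ha hθ i (side := E.natSpace ∩ Set.Iio η₀) Set.inter_subset_left
    (fun η h η' h' => mul_pos_of_neg_of_neg (sub_neg.2 h.2) (sub_neg.2 h'.2)) hn' hx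
  rw [two_mul]
  refine le_trans ?_ (add_le_add h1 h2)
  refine le_trans (measure_mono ?_) (measure_union_le _ _)
  rintro ω ⟨t, h3, h4⟩
  rw [glr_eq_iSup] at h4
  obtain ⟨η, h4⟩ := lt_iSup_iff.1 h4
  obtain ⟨hη, h4⟩ := lt_iSup_iff.1 h4
  have h5 : x / n < E.logRatio η η₀ (sampleMean (hist a ω t) i) :=
    (ENNReal.ofReal_lt_ofReal_iff'.1 h4).1
  have h6 : 0 ≤ x / n := by positivity
  rcases lt_trichotomy η η₀ with h | h | h
  · exact Or.inr ⟨t, by rw [h3], η, ⟨hη, h⟩, h5⟩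
  · rw [h, logRatio_self] at h5; linarith
  · exact Or.inl ⟨t, by rw [h3], η, ⟨hη, h⟩, h5⟩

end ExpFamily

/-! ### Integrability of the large deviations -/

/-- A number above the level `m` is at most the sum of the unit steps it has passed, weighted by their
ends. -/
theorem ENNReal.le_tsum_unit_steps (X : ℝ≥0∞) (m : ℝ) (hX : ENNReal.ofReal m < X) (hm : 0 ≤ m) :
    X ≤ ∑' k : ℕ, ENNReal.ofReal (m + k + 1) * (if ENNReal.ofReal (m + k) < X then 1 else 0) := by
  by_cases htop : X = ⊤
  · subst htop
    simp only [ENNReal.ofReal_lt_top, if_true, mul_one]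
    rw [top_le_iff, eq_top_iff, ← ENNReal.tsum_const_eq_top_of_ne_zero (α := ℕ) one_ne_zero]
    refine ENNReal.tsum_le_tsum fun k => ?_
    rw [← ENNReal.ofReal_one]
    exact ENNReal.ofReal_le_ofReal (by linarith [(Nat.cast_nonneg k : (0 : ℝ) ≤ k)])
  · have hx : X = ENNReal.ofReal X.toReal := (ENNReal.ofReal_toReal htop).symm
    set x := X.toReal
    rw [hx] at hX ⊢
    have hmx : m < x := (ENNReal.ofReal_lt_ofReal_iff'.1 hX).1
    have hx0 : 0 < x := by linarith
    -- The last step passed: $m+k<x\le m+k+1$, and its weight alone already bounds $x$.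
    obtain ⟨k, hk⟩ : ∃ k : ℕ, ⌈x - m⌉₊ = k + 1 :=
      ⟨⌈x - m⌉₊ - 1, by have := Nat.ceil_pos.2 (sub_pos.2 hmx); omega⟩
    have h1 : x - m ≤ k + 1 := by
      have := Nat.le_ceil (x - m)
      rw [hk] at this; exact_mod_cast this
    have h2 : (k : ℝ) < x - m := Nat.lt_ceil.1 (by omega)
    refine le_trans ?_ (ENNReal.le_tsum k)
    rw [if_pos, mul_one]
    · exact ENNReal.ofReal_le_ofReal (by linarith)
    · exact (ENNReal.ofReal_lt_ofReal_iff hx0).2 (by linarith)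

/-- The linear weight of a unit step is paid for by half of the exponential rate; with $x=m+k$ the
remaining exponential factorises in $m$ and $k$. -/
theorem add_one_mul_exp_neg_le (x : ℝ) :
    (x + 1) * (2 * Real.exp (-x)) ≤ 4 * Real.exp (-x / 2) := by
  have h1 : x + 1 ≤ 2 * Real.exp (x / 2) := by
    have := Real.add_one_le_exp (x / 2)
    have := Real.exp_pos (x / 2)
    linarith
  have h2 : Real.exp (-x / 2) = Real.exp (x / 2) * Real.exp (-x) := by
    rw [← Real.exp_add]; ring_nf
  rw [h2]
  nlinarith [Real.exp_pos (-x)]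

theorem tsum_exp_neg_mul_lt_top {c : ℝ} (hc : 0 < c) :
    ∑' n : ℕ, ENNReal.ofReal (Real.exp (-(c * n))) < ⊤ := by
  have h : ∀ n : ℕ, ENNReal.ofReal (Real.exp (-(c * n))) = ENNReal.ofReal (Real.exp (-c)) ^ n := by
    intro n
    rw [← ENNReal.ofReal_pow (Real.exp_pos _).le, ← Real.exp_nat_mul]
    ring_nf
  simp only [h, ENNReal.tsum_geometric]
  rw [ENNReal.inv_lt_top, tsub_pos_iff_lt]
  rw [← ENNReal.ofReal_one, ENNReal.ofReal_lt_ofReal_iff one_pos]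
  rw [← Real.exp_zero]
  exact Real.exp_lt_exp.2 (by linarith)

/-- The part of a random variable with exponential tail above the level `m` has a mean which is
exponentially small in `m`. -/
theorem lintegral_tail_le {Ω : Type*} [MeasurableSpace Ω] {P : Measure Ω} {X : Ω → ℝ≥0∞}
    (hX : Measurable X)
    (htail : ∀ x : ℝ, 0 ≤ x → P {ω | ENNReal.ofReal x < X ω} ≤ 2 * ENNReal.ofReal (Real.exp (-x)))
    {m : ℝ} (hm : 0 ≤ m) :
    ∫⁻ ω, (if ENNReal.ofReal m < X ω then X ω else 0) ∂P ≤
      4 * ENNReal.ofReal (Real.exp (-(1 / 2 * m))) *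
        ∑' k : ℕ, ENNReal.ofReal (Real.exp (-(1 / 2 * k))) := by
  have hs : ∀ x : ℝ, MeasurableSet {ω | ENNReal.ofReal x < X ω} := fun x =>
    measurableSet_lt measurable_const hX
  calc _ ≤ ∫⁻ ω, ∑' k : ℕ, ENNReal.ofReal (m + k + 1) *
        (if ENNReal.ofReal (m + k) < X ω then 1 else 0) ∂P := by
        refine lintegral_mono fun ω => ?_
        dsimp only
        split_ifs with h
        · exact ENNReal.le_tsum_unit_steps _ _ h hm
        · exact zero_le
    _ = ∑' k : ℕ, ENNReal.ofReal (m + k + 1) * P {ω | ENNReal.ofReal (m + k) < X ω} := by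
        rw [lintegral_tsum]
        · refine tsum_congr fun k => ?_
          rw [lintegral_const_mul']
          swap
          · exact ENNReal.ofReal_ne_top
          congr 1
          rw [← lintegral_indicator_one (hs _)]
          refine lintegral_congr fun ω => ?_
          simp [Set.indicator]
        · intro k
          exact ((Measurable.ite (hs _) measurable_const measurable_const).const_mul _).aemeasurable
    _ ≤ ∑' k : ℕ, 4 * ENNReal.ofReal (Real.exp (-(1 / 2 * m))) *
          ENNReal.ofReal (Real.exp (-(1 / 2 * k))) := by
        refine ENNReal.tsum_le_tsum fun k => ?_
        have hk : (0 : ℝ) ≤ k := Nat.cast_nonneg k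
        refine (mul_le_mul_right (htail _ (by positivity)) _).trans ?_
        have e2 : (2 : ℝ≥0∞) = ENNReal.ofReal 2 := by simp
        have e4 : (4 : ℝ≥0∞) = ENNReal.ofReal 4 := by simp
        rw [e2, e4, ← ENNReal.ofReal_mul (by norm_num), ← ENNReal.ofReal_mul (by positivity),
          ← ENNReal.ofReal_mul (by norm_num), ← ENNReal.ofReal_mul (by positivity)]
        refine ENNReal.ofReal_le_ofReal ((add_one_mul_exp_neg_le (m + k)).trans_eq ?_)
        rw [mul_assoc, ← Real.exp_add]
        ring_nf
    _ = _ := ENNReal.tsum_mul_left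

namespace ExpFamily

variable {E : ExpFamily} {K : ℕ}

variable (E) in
/-- The deviation `d(θ_{t,i}, θ_i)` of the sample mean of arm `i` after `n` samples (`0` if there are
never `n` samples). -/
noncomputable def deviation (a : Alloc K) (θ : Fin K → ℝ) (i : Fin K) (n : ℕ)
    (ω : BanditSpace K) : ℝ≥0∞ :=
  ⨆ t, if count (hist a ω t) i = n then E.glr (sampleMean (hist a ω t) i) (θ i) else 0

theorem measurable_deviation {a : Alloc K} (ha : a.IsMeasurable) (θ : Fin K → ℝ) (i : Fin K)
    (n : ℕ) : Measurable (E.deviation a θ i n) := by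
  refine Measurable.iSup fun t => Measurable.ite ?_ ?_ measurable_const
  · exact ((measurable_count i).comp (measurable_hist ha t)) (measurableSet_singleton n)
  · exact (E.measurable_glr _).comp ((measurable_sampleMean i).comp (measurable_hist ha t))

theorem glr_le_deviation (a : Alloc K) (θ : Fin K → ℝ) (i : Fin K) (ω : BanditSpace K) (t : ℕ) :
    E.glr (sampleMean (hist a ω t) i) (θ i) ≤ E.deviation a θ i (count (hist a ω t) i) ω :=
  le_iSup_of_le t (by simp)

theorem measure_mul_deviation_gt_le {a : Alloc K} (ha : a.IsMeasurable) {θ : Fin K → ℝ}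
    (hθ : ∀ i, θ i ∈ E.meanSpace) (i : Fin K) (n : ℕ) {x : ℝ} (hx : 0 ≤ x) :
    E.prob θ {ω | ENNReal.ofReal x < n * E.deviation a θ i n ω} ≤
      2 * ENNReal.ofReal (Real.exp (-x)) := by
  rcases Nat.eq_zero_or_pos n with rfl | hn
  · simp
  refine (measure_mono ?_).trans (measure_glr_gt_le ha hθ i hn hx)
  intro ω hω
  have hn' : (0 : ℝ) < n := by exact_mod_cast hn
  have h1 : ENNReal.ofReal (x / n) < E.deviation a θ i n ω := by
    rw [ENNReal.ofReal_div_of_pos hn', ENNReal.ofReal_natCast]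
    refine ENNReal.div_lt_of_lt_mul' hω
  obtain ⟨t, ht⟩ := lt_iSup_iff.1 h1
  split_ifs at ht with h
  · exact ⟨t, h, ht⟩
  · exact absurd ht not_lt_zero

variable (E) in
/-- The total size of the large deviations of the sample means of arm `i`: those after `n` samples
which exceed the level `c` contribute `n` times the deviation. -/
noncomputable def totalDeviation (a : Alloc K) (θ : Fin K → ℝ) (c : ℝ) (i : Fin K)
    (ω : BanditSpace K) : ℝ≥0∞ :=
  ∑' n : ℕ, if ENNReal.ofReal (c * n) < n * E.deviation a θ i n ω then
    n * E.deviation a θ i n ω else 0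

theorem measurable_totalDeviation {a : Alloc K} (ha : a.IsMeasurable) (θ : Fin K → ℝ) (c : ℝ)
    (i : Fin K) : Measurable (E.totalDeviation a θ c i) := by
  refine Measurable.tsum fun n => ?_
  have := (measurable_deviation (E := E) ha θ i n).const_mul (n : ℝ≥0∞)
  exact Measurable.ite (measurableSet_lt measurable_const this) this measurable_const

/-- The level of the $n$-th term is $cn$, so by `lintegral_tail_le` its mean is of order
$e^{-cn/2}$, which is summable. -/
theorem lintegral_totalDeviation_lt_top {a : Alloc K} (ha : a.IsMeasurable) {θ : Fin K → ℝ}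
    (hθ : ∀ i, θ i ∈ E.meanSpace) {c : ℝ} (hc : 0 < c) (i : Fin K) :
    ∫⁻ ω, E.totalDeviation a θ c i ω ∂(E.prob θ) < ⊤ := by
  have hm := fun n : ℕ => (measurable_deviation (E := E) ha θ i n).const_mul (n : ℝ≥0∞)
  unfold totalDeviation
  rw [lintegral_tsum fun n =>
    (Measurable.ite (measurableSet_lt measurable_const (hm n)) (hm n) measurable_const).aemeasurable]
  refine (ENNReal.tsum_le_tsum fun n => lintegral_tail_le (hm n)
    (fun x hx => measure_mul_deviation_gt_le ha hθ i n hx) (by positivity : 0 ≤ c * n)).trans_lt ?_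
  rw [ENNReal.tsum_mul_right, ENNReal.tsum_mul_left]
  have e : ∀ n : ℕ, 1 / 2 * (c * n) = c / 2 * n := fun n => by ring
  simp only [e]
  exact ENNReal.mul_lt_top (ENNReal.mul_lt_top (by simp) (tsum_exp_neg_mul_lt_top (by positivity)))
    (tsum_exp_neg_mul_lt_top (by norm_num))

/-- A large deviation is part of the total. -/
theorem count_mul_glr_le_totalDeviation (a : Alloc K) (θ : Fin K → ℝ) (c : ℝ) (i : Fin K)
    (ω : BanditSpace K) (t : ℕ) (hn : 0 < count (hist a ω t) i)
    (h : ENNReal.ofReal c < E.glr (sampleMean (hist a ω t) i) (θ i)) :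
    count (hist a ω t) i * E.glr (sampleMean (hist a ω t) i) (θ i) ≤
      E.totalDeviation a θ c i ω := by
  have h1 := glr_le_deviation (E := E) a θ i ω t
  set n := count (hist a ω t) i
  have h2 : ENNReal.ofReal (c * n) < n * E.deviation a θ i n ω := by
    rw [ENNReal.ofReal_mul' (Nat.cast_nonneg _), ENNReal.ofReal_natCast, mul_comm]
    exact (ENNReal.mul_lt_mul_iff_right (by exact_mod_cast hn.ne') (ENNReal.natCast_ne_top n)).2
      (h.trans_le h1)
  refine le_trans ?_ (ENNReal.le_tsum n)
  rw [if_pos h2]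
  gcongr

end ExpFamily

/-! ### The allocation rule -/

theorem count_histStep {K t : ℕ} (a : Alloc K) (p : Hist K t × ((Fin K → ℝ) × unitInterval))
    (i : Fin K) :
    count (histStep a t p) i = count p.1 i + if a t p.1 p.2.2 = i then 1 else 0 := by
  simp [histStep, count, Fin.sum_univ_castSucc]

theorem sum_count {K t : ℕ} (h : Hist K t) : ∑ i, count h i = t := by
  simp only [count]
  rw [Finset.sum_comm]
  simp

theorem measurable_prop {K t : ℕ} (i : Fin K) : Measurable (fun h : Hist K t => prop h i) :=
  (measurable_count_real i).div_const _

theorem measurable_comp_arm {K : ℕ} {a : Alloc K} (ha : a.IsMeasurable) (t : ℕ)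
    {f : Hist K t → Fin K → ℝ≥0∞} (hf : ∀ i, Measurable fun h => f h i) :
    Measurable (fun p : Hist K t × ((Fin K → ℝ) × unitInterval) => f p.1 (a t p.1 p.2.2)) := by
  have h1 : Measurable (fun q : Hist K t × Fin K => f q.1 q.2) :=
    measurable_from_prod_countable_left hf
  have h3 : Measurable (fun p : Hist K t × ((Fin K → ℝ) × unitInterval) =>
      (p.1, a t p.1 p.2.2)) := measurable_fst.prodMk (ha.arm t)
  exact h1.comp h3

namespace ExpFamily

variable {E : ExpFamily} {K : ℕ} {thr : ℝ}

theorem measurable_empInfo (thr : ℝ) {t : ℕ} (i : Fin K) :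
    Measurable (fun h : Hist K t => E.empInfo thr h i) :=
  (measurable_prop i).ennreal_ofReal.mul
    ((E.measurable_glr thr).comp (measurable_sampleMean i))

/-- The rule therefore compares $N_i\,d(\theta_{t,i},\mathfrak T)$. At $t=0$ both sides vanish. -/
theorem mul_empInfo {t : ℕ} (h : Hist K t) (i : Fin K) :
    t * E.empInfo thr h i = count h i * E.glr (sampleMean h i) thr := by
  rw [empInfo, ← mul_assoc, prop]
  congr 1
  rcases Nat.eq_zero_or_pos t with rfl | ht
  · simp [count]
  · have ht' : (0 : ℝ) < t := by exact_mod_cast ht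
    rw [← ENNReal.ofReal_natCast t, ← ENNReal.ofReal_mul ht'.le, mul_div_cancel₀ _ ht'.ne',
      ENNReal.ofReal_natCast]

/-- Almost surely the sampled arm always has the smallest empirical information. -/
theorem ae_empInfo_le {a : Alloc K} (ha : a.IsMeasurable) (hEB : E.IsEBKKTIDS thr a)
    {θ : Fin K → ℝ} (hθ : ∀ i, θ i ∈ E.meanSpace) :
    ∀ᵐ ω ∂(E.prob θ), ∀ t j, E.empInfo thr (hist a ω t) (a t (hist a ω t) (ω t).2) ≤
      E.empInfo thr (hist a ω t) j := by
  have := fun i => isProbabilityMeasure_law (hθ i)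
  obtain ⟨det, -, hdet, hvol⟩ := hEB
  rw [ae_all_iff]
  intro t
  -- The bad event is written through `a`, because `det` carries no measurability.
  have hB : MeasurableSet {p : Hist K t × ((Fin K → ℝ) × unitInterval) |
      ¬ ∀ j, E.empInfo thr p.1 (a t p.1 p.2.2) ≤ E.empInfo thr p.1 j} := by
    have h2 : {p : Hist K t × ((Fin K → ℝ) × unitInterval) |
        ¬ ∀ j, E.empInfo thr p.1 (a t p.1 p.2.2) ≤ E.empInfo thr p.1 j} =
        ⋃ j, {p | E.empInfo thr p.1 j < E.empInfo thr p.1 (a t p.1 p.2.2)} := by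
      ext; simp
    rw [h2]
    refine MeasurableSet.iUnion fun j => measurableSet_lt ?_ ?_
    · exact (measurable_empInfo thr j).comp measurable_fst
    · exact measurable_comp_arm ha t (f := fun h i => E.empInfo thr h i)
        fun i => measurable_empInfo thr i
  set B := {p : Hist K t × ((Fin K → ℝ) × unitInterval) |
      ¬ ∀ j, E.empInfo thr p.1 (a t p.1 p.2.2) ≤ E.empInfo thr p.1 j} with hBdef
  have hm : MeasurableSet {ω : BanditSpace K | (hist a ω t, ω t) ∈ B} :=
    ((measurable_hist ha t).prodMk (measurable_pi_apply t)) hB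
  show banditMeasure (fun i => E.law (θ i)) {ω | (hist a ω t, ω t) ∈ B} = 0
  rw [← lintegral_indicator_one hm]
  have h2 := lintegral_hist_step ha (fun i => E.law (θ i)) t (F := B.indicator 1)
    (measurable_one.indicator hB)
  refine Eq.trans ?_ (h2.trans ?_)
  · rfl
  · rw [lintegral_eq_zero_iff' ]
    swap
    · exact ((measurable_one.indicator hB).lintegral_prod_right'.comp
        (measurable_hist ha t)).aemeasurable
    refine Eventually.of_forall fun ω => ?_
    show ∫⁻ z, B.indicator 1 (hist a ω t, z) ∂(stepMeasure fun i => E.law (θ i)) = 0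
    generalize hist a ω t = h
    have hB' : MeasurableSet {z | (h, z) ∈ B} := measurable_prodMk_left hB
    have h3 : ∫⁻ z, B.indicator 1 (h, z) ∂(stepMeasure fun i => E.law (θ i)) =
        stepMeasure (fun i => E.law (θ i)) {z | (h, z) ∈ B} := by
      rw [← lintegral_indicator_one hB']; rfl
    rw [h3]
    -- For a fixed history an arm that is not a minimiser has detection probability zero, and
    -- `selProb` passes exactly this probability to the arm.
    have h4 : volume {u : unitInterval | ¬ ∀ j, E.empInfo thr h (a t h u) ≤ E.empInfo thr h j}
        = 0 := by
      have h5 : {u : unitInterval | ¬ ∀ j, E.empInfo thr h (a t h u) ≤ E.empInfo thr h j} ⊆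
          ⋃ i ∈ {i | ¬ ∀ j, E.empInfo thr h i ≤ E.empInfo thr h j}, {u | a t h u = i} := by
        intro u hu
        exact Set.mem_biUnion (x := a t h u) hu rfl
      refine measure_mono_null h5 ((measure_biUnion_null_iff (Set.to_countable _)).2 ?_)
      intro i hi
      rw [hvol, Finset.sum_eq_zero]
      intro x _
      by_cases hx : i = x
      · subst hx
        by_contra h6
        exact hi (hdet t h i fun h7 => h6 (by simp [h7]))
      · simp [selProb, hx]
    have h6 : {z | (h, z) ∈ B} ⊆ Set.univ ×ˢ
        {u : unitInterval | ¬ ∀ j, E.empInfo thr h (a t h u) ≤ E.empInfo thr h j} :=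
      fun z hz => ⟨trivial, hz⟩
    refine measure_mono_null h6 ?_
    rw [stepMeasure, Measure.prod_prod, h4, mul_zero]

/-- Along the histories of the rule the informations of the arms stay balanced, up to a remainder
made of the total deviations. -/
theorem count_balanced {a : Alloc K} {θ : Fin K → ℝ}
    {ω : BanditSpace K} {e : ℝ} {c C Q : Fin K → ℝ} (he : 0 < e)
    (hd : ∀ i, e < E.dist (θ i) thr) (hc : ∀ i, 0 < c i) (hC : ∀ i, 0 ≤ C i) (hQ : ∀ i, 0 ≤ Q i)
    (hnear : ∀ i y, E.glr y (θ i) ≤ ENNReal.ofReal (c i) →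
      ENNReal.ofReal (E.dist (θ i) thr - e) ≤ E.glr y thr ∧
      E.glr y thr ≤ ENNReal.ofReal (E.dist (θ i) thr + e))
    (hfar : ∀ i y, ENNReal.ofReal (c i) < E.glr y (θ i) →
      E.glr y thr ≤ ENNReal.ofReal (C i) * E.glr y (θ i))
    (hdev : ∀ i, E.totalDeviation a θ (c i) i ω = ENNReal.ofReal (Q i))
    (hmin : ∀ t j, E.empInfo thr (hist a ω t) (a t (hist a ω t) (ω t).2) ≤
      E.empInfo thr (hist a ω t) j) (t : ℕ) (i j : Fin K) :
    (count (hist a ω t) i : ℝ) * (E.dist (θ i) thr - e) ≤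
      count (hist a ω t) j * (E.dist (θ j) thr + e) +
        ∑ k, (E.dist (θ k) thr + (C k + E.dist (θ k) thr / c k) * Q k) := by
  have hterm : ∀ k, 0 ≤ C k * Q k ∧ 0 ≤ E.dist (θ k) thr / c k * Q k ∧ 0 < E.dist (θ k) thr := by
    intro k
    have h1 := hd k
    have h2 : 0 < E.dist (θ k) thr := by linarith
    exact ⟨mul_nonneg (hC k) (hQ k), mul_nonneg (div_nonneg h2.le (hc k).le) (hQ k), h2⟩
  have hR0 : ∀ k, 0 ≤ E.dist (θ k) thr + (C k + E.dist (θ k) thr / c k) * Q k := by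
    intro k; obtain ⟨h1, h2, h3⟩ := hterm k; nlinarith
  rcases eq_or_ne i j with rfl | hij
  · have h1 : 0 ≤ ∑ k, (E.dist (θ k) thr + (C k + E.dist (θ k) thr / c k) * Q k) :=
      Finset.sum_nonneg fun k _ => hR0 k
    have h2 : (0 : ℝ) ≤ count (hist a ω t) i := Nat.cast_nonneg _
    nlinarith
  -- The remainder has room for a bad estimate of `j`, a bad estimate of `i` and one additional
  -- sample of `i`.
  have hsum : C j * Q j + E.dist (θ i) thr / c i * Q i + E.dist (θ i) thr ≤
      ∑ k, (E.dist (θ k) thr + (C k + E.dist (θ k) thr / c k) * Q k) := by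
    have h1 : ∑ k ∈ {i, j}, (E.dist (θ k) thr + (C k + E.dist (θ k) thr / c k) * Q k) ≤ _ :=
      Finset.sum_le_sum_of_subset_of_nonneg (Finset.subset_univ {i, j}) fun k _ _ => hR0 k
    rw [Finset.sum_pair hij] at h1
    obtain ⟨h2, h3, h4⟩ := hterm i
    obtain ⟨h5, h6, h7⟩ := hterm j
    nlinarith
  -- A large deviation is a term of the total `Q k`. Hence it can only occur while arm `k` has few
  -- samples, and even then its information is at most a multiple of `Q k`.
  have hbad : ∀ k t, ENNReal.ofReal (c k) < E.glr (sampleMean (hist a ω t) k) (θ k) →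
      (count (hist a ω t) k : ℝ) ≤ Q k / c k ∧
      count (hist a ω t) k * E.glr (sampleMean (hist a ω t) k) thr ≤
        ENNReal.ofReal (C k * Q k) := by
    intro k t hlt
    rcases Nat.eq_zero_or_pos (count (hist a ω t) k) with h0 | hpos
    · rw [h0]
      simpa using div_nonneg (hQ k) (hc k).le
    have h1 := count_mul_glr_le_totalDeviation (E := E) a θ (c k) k ω t hpos hlt
    rw [hdev] at h1
    constructor
    · have h2 : (count (hist a ω t) k : ℝ≥0∞) * ENNReal.ofReal (c k) ≤ ENNReal.ofReal (Q k) :=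
        le_trans (by gcongr) h1
      rw [← ENNReal.ofReal_natCast, ← ENNReal.ofReal_mul (Nat.cast_nonneg _),
        ENNReal.ofReal_le_ofReal_iff (hQ k)] at h2
      rwa [le_div_iff₀ (hc k)]
    · calc _ ≤ count (hist a ω t) k *
            (ENNReal.ofReal (C k) * E.glr (sampleMean (hist a ω t) k) (θ k)) := by
            gcongr; exact hfar k _ hlt
        _ = ENNReal.ofReal (C k) *
            (count (hist a ω t) k * E.glr (sampleMean (hist a ω t) k) (θ k)) := by ring
        _ ≤ _ := by
            rw [ENNReal.ofReal_mul (hC k)]; gcongr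
  induction t with
  | zero =>
    have h0 : ∀ k, count (hist a ω 0) k = 0 := fun k => by simp [count]
    simp only [h0, Nat.cast_zero, zero_mul, zero_add]
    exact Finset.sum_nonneg fun k _ => hR0 k
  | succ t ih =>
    rw [hist_succ, count_histStep, count_histStep]
    simp only
    set N := fun k => count (hist a ω t) k with hN
    have hj : (0 : ℝ) ≤ (E.dist (θ j) thr + e) := by linarith [(hterm j).2.2]
    by_cases hi : a t (hist a ω t) (ω t).2 = i
    -- The only step that can break the inequality is one that samples `i`. Just before it the
    -- information of `i` was at most that of `j`, so the bound holds afresh without the induction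
    -- hypothesis, up to the one new sample.
    · rw [if_pos hi, if_neg (by rw [hi]; exact hij), add_zero]
      have h1 := hmin t j
      rw [hi] at h1
      have h2 : (t : ℝ≥0∞) * E.empInfo thr (hist a ω t) i ≤ t * E.empInfo thr (hist a ω t) j := by
        gcongr
      rw [mul_empInfo, mul_empInfo] at h2
      have h3 : (count (hist a ω t) j : ℝ≥0∞) * E.glr (sampleMean (hist a ω t) j) thr ≤
          ENNReal.ofReal (count (hist a ω t) j * (E.dist (θ j) thr + e) + C j * Q j) := by
        rw [ENNReal.ofReal_add (mul_nonneg (Nat.cast_nonneg _) hj) (hterm j).1]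
        rcases le_or_gt (E.glr (sampleMean (hist a ω t) j) (θ j)) (ENNReal.ofReal (c j)) with h | h
        · refine le_add_of_le_of_nonneg ?_ zero_le
          rw [ENNReal.ofReal_mul (Nat.cast_nonneg _), ENNReal.ofReal_natCast]
          gcongr
          exact (hnear j _ h).2
        · exact le_add_of_nonneg_of_le zero_le (hbad j t h).2
      have h4 : (count (hist a ω t) i : ℝ) * (E.dist (θ i) thr - e) ≤
          count (hist a ω t) j * (E.dist (θ j) thr + e) + C j * Q j +
            E.dist (θ i) thr / c i * Q i := by
        have hj0 : 0 ≤ (count (hist a ω t) j : ℝ) * (E.dist (θ j) thr + e) :=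
          mul_nonneg (Nat.cast_nonneg _) hj
        rcases le_or_gt (E.glr (sampleMean (hist a ω t) i) (θ i)) (ENNReal.ofReal (c i)) with h | h
        · have h5 : (count (hist a ω t) i : ℝ≥0∞) * ENNReal.ofReal (E.dist (θ i) thr - e) ≤
              ENNReal.ofReal (count (hist a ω t) j * (E.dist (θ j) thr + e) + C j * Q j) := by
            refine le_trans ?_ (h2.trans h3)
            gcongr
            exact (hnear i _ h).1
          rw [← ENNReal.ofReal_natCast, ← ENNReal.ofReal_mul (Nat.cast_nonneg _),
            ENNReal.ofReal_le_ofReal_iff (by linarith [(hterm j).1])] at h5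
          linarith [(hterm i).2.1]
        · have h5 := (hbad i t h).1
          have h6 : (count (hist a ω t) i : ℝ) * (E.dist (θ i) thr - e) ≤
              Q i / c i * E.dist (θ i) thr := by
            have := hd i
            gcongr
            · linarith
            · linarith
          have h7 : Q i / c i * E.dist (θ i) thr = E.dist (θ i) thr / c i * Q i := by ring
          linarith [(hterm j).1]
      push_cast
      linarith
    · rw [if_neg hi, add_zero]
      push_cast
      refine ih.trans ?_
      gcongr
      have : (0 : ℝ) ≤ if a t (hist a ω t) (ω t).2 = j then 1 else 0 := by split_ifs <;> norm_num
      linarith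

end ExpFamily

/-- Balanced informations force the proportions to be close to the optimal ones. -/
theorem le_div_of_balanced {K : ℕ} {N d : Fin K → ℝ} {e R t : ℝ} (he : 0 < e)
    (hd : ∀ i, e < d i) (ht : 0 < t) (hsum : ∑ i, N i = t)
    (h : ∀ i j, N i * (d i - e) ≤ N j * (d j + e) + R) (j : Fin K) :
    ((∑ i, (d i - e)⁻¹)⁻¹ - R / t) / (d j + e) ≤ N j / t := by
  have hS : 0 < ∑ i, (d i - e)⁻¹ :=
    Finset.sum_pos (fun i _ => inv_pos.2 (sub_pos.2 (hd i))) ⟨j, Finset.mem_univ j⟩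
  -- Each $N_i$ is bounded through $N_j$, and the bounds are summed over $i$.
  have h1 : t ≤ (N j * (d j + e) + R) * ∑ i, (d i - e)⁻¹ := by
    rw [← hsum, Finset.mul_sum]
    refine Finset.sum_le_sum fun i _ => ?_
    rw [← div_eq_mul_inv, le_div_iff₀ (sub_pos.2 (hd i))]
    exact h i j
  rw [div_le_iff₀ (by linarith [hd j] : 0 < d j + e), sub_le_iff_le_add]
  have h2 : t * (∑ i, (d i - e)⁻¹)⁻¹ ≤ N j * (d j + e) + R := by
    rw [← div_eq_mul_inv, div_le_iff₀ hS]; exact h1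
  have h3 : N j / t * (d j + e) + R / t = (N j * (d j + e) + R) / t := by ring
  rw [h3, le_div_iff₀ ht, mul_comm]
  exact h2

/-! ### Convergence of the proportions -/

namespace ExpFamily

variable {E : ExpFamily} {K : ℕ} {thr : ℝ}

/-- Continuity at $e=0$, where the right side of the last inequality is $p^*_j$. -/
theorem exists_small_slack {θ : Fin K → ℝ} (ht : thr ∈ E.meanSpace) (hK : 0 < K)
    (hθ : θ ∈ E.instances K thr) {ε : ℝ} (hε : 0 < ε) :
    ∃ e > 0, e < ε ∧ (∀ i, e < E.dist (θ i) thr) ∧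
      ∀ j, E.optAlloc thr θ j - ε ≤ (∑ i, (E.dist (θ i) thr - e)⁻¹)⁻¹ / (E.dist (θ j) thr + e) := by
  have hdp := dist_thr_pos ht hθ
  have hS := inv_pos.1 (optValue_pos ht hK hθ)
  have hev : ∀ᶠ e in 𝓝 (0 : ℝ), e < ε ∧ (∀ i, e < E.dist (θ i) thr) ∧
      ∀ j, E.optAlloc thr θ j - ε ≤
        (∑ i, (E.dist (θ i) thr - e)⁻¹)⁻¹ / (E.dist (θ j) thr + e) := by
    refine (gt_mem_nhds hε).and ((eventually_all.2 fun i => gt_mem_nhds (hdp i)).and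
      (eventually_all.2 fun j => ?_))
    have hc : ContinuousAt (fun e : ℝ => (∑ i, (E.dist (θ i) thr - e)⁻¹)⁻¹ / (E.dist (θ j) thr + e)) 0 := by
      refine ContinuousAt.div (ContinuousAt.inv₀ ?_ ?_) (by fun_prop) ?_
      · refine tendsto_finsetSum _ fun i _ => ?_
        refine ContinuousAt.inv₀ (by fun_prop) ?_
        simpa using (hdp i).ne'
      · simpa using hS.ne'
      · simpa using (hdp j).ne'
    have h0 : E.optAlloc thr θ j - ε <
        (∑ i, (E.dist (θ i) thr - 0)⁻¹)⁻¹ / (E.dist (θ j) thr + 0) := by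
      simp only [sub_zero, add_zero]
      show E.optAlloc thr θ j - ε < E.optAlloc thr θ j
      linarith
    filter_upwards [hc.eventually (lt_mem_nhds h0)] with e he using he.le
  obtain ⟨e, he, he0⟩ := ((hev.filter_mono nhdsWithin_le_nhds).and
    (self_mem_nhdsWithin (s := Set.Ioi (0 : ℝ)))).exists
  exact ⟨e, he0, he⟩

/-- After an integrable random time, all proportions and all statistics are close to their limits. -/
theorem exists_integrable_time {a : Alloc K} (ha : a.IsMeasurable) (hEB : E.IsEBKKTIDS thr a)
    (ht : thr ∈ E.meanSpace) (hK : 0 < K) {θ : Fin K → ℝ} (hθ : θ ∈ E.instances K thr)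
    {ε : ℝ} (hε : 0 < ε) :
    ∃ T : BanditSpace K → ℝ, Integrable T (E.prob θ) ∧ ∀ᵐ ω ∂(E.prob θ), ∀ t : ℕ, T ω ≤ t →
      ∀ i, E.optAlloc thr θ i - ε ≤ prop (hist a ω t) i ∧
        ENNReal.ofReal (E.dist (θ i) thr - ε) ≤ E.glr (sampleMean (hist a ω t) i) thr := by
  have hθm : ∀ i, θ i ∈ E.meanSpace := fun i => (hθ i).1
  have hP := isProbabilityMeasure_prob hθm
  have : Nonempty (Fin K) := ⟨⟨0, hK⟩⟩
  have hdp := dist_thr_pos ht hθ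
  have hpp := optAlloc_pos ht hK hθ
  -- The proportions will lose $2\varepsilon'$, once from the slack $e$ and once from the remainder.
  -- The bound $p^*_i/4$ keeps them above $p^*_i/2$.
  obtain ⟨ε', hε', hε'1, hε'2⟩ : ∃ ε' > 0, ε' ≤ ε / 2 ∧ ∀ i, ε' ≤ E.optAlloc thr θ i / 4 := by
    obtain ⟨m, hm⟩ := Finite.exists_min (E.optAlloc thr θ)
    refine ⟨min (ε / 2) (E.optAlloc thr θ m / 4), lt_min (by linarith) (by linarith [hpp m]),
      min_le_left _ _, fun i => (min_le_right _ _).trans (by linarith [hm i])⟩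
  obtain ⟨e, he, heε, hed, heopt⟩ := exists_small_slack ht hK hθ hε'
  choose c hc hnear using fun i => exists_glr_near (hθm i) ht he
  choose C hC hfar using fun i => exists_glr_le_mul (thr := thr) (hθm i) (hc i)
  set Q : Fin K → BanditSpace K → ℝ := fun i ω => (E.totalDeviation a θ (c i) i ω).toReal with hQ
  have hfin := fun i => lintegral_totalDeviation_lt_top (E := E) ha hθm (hc i) i
  have hmeas := fun i => measurable_totalDeviation (E := E) ha θ (c i) i
  set M := ∑ k, (E.dist (θ k) thr + (C k + E.dist (θ k) thr / c k)) with hM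
  have hterm : ∀ k, 0 ≤ E.dist (θ k) thr + (C k + E.dist (θ k) thr / c k) := fun k => by
    have := hdp k; have := hC k; have := hc k; positivity
  have hM0 : 0 ≤ M := Finset.sum_nonneg fun k _ => hterm k
  -- With $S=1+\sum_i Q_i$ and $t\ge AS$, the first summands make the remainder $MS$ cost at most
  -- $\varepsilon'$ in every proportion. The second make $\tfrac12p^*_j t\ge S/c_j$, more samples
  -- than a large deviation permits.
  set A := 1 + ∑ j, (M / (E.dist (θ j) thr * ε') + 2 / (E.optAlloc thr θ j * c j)) with hA
  have hAterm : ∀ j, 0 ≤ M / (E.dist (θ j) thr * ε') ∧ 0 ≤ 2 / (E.optAlloc thr θ j * c j) :=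
    fun j => by
      have := hdp j; have := hpp j; have := hc j
      constructor <;> positivity
  have hAj : ∀ j, M / (E.dist (θ j) thr * ε') ≤ A ∧ 2 / (E.optAlloc thr θ j * c j) ≤ A ∧ 1 ≤ A := by
    intro j
    have h1 := Finset.single_le_sum (f := fun j => M / (E.dist (θ j) thr * ε') +
      2 / (E.optAlloc thr θ j * c j)) (fun j _ => add_nonneg (hAterm j).1 (hAterm j).2)
      (Finset.mem_univ j)
    have h2 := hAterm j
    refine ⟨by linarith, by linarith, by linarith⟩
  refine ⟨fun ω => A * (1 + ∑ i, Q i ω), ?_, ?_⟩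
  · refine Integrable.const_mul ((integrable_const 1).add (integrable_finsetSum _ fun i _ => ?_)) _
    exact integrable_toReal_of_lintegral_ne_top (hmeas i).aemeasurable (hfin i).ne
  have hae : ∀ᵐ ω ∂(E.prob θ), ∀ i, E.totalDeviation a θ (c i) i ω < ⊤ :=
    ae_all_iff.2 fun i => ae_lt_top (hmeas i) (hfin i).ne
  filter_upwards [hae, ae_empInfo_le ha hEB hθm] with ω h1 hmin t hTt
  have hQ0 : ∀ i, 0 ≤ Q i ω := fun i => ENNReal.toReal_nonneg
  have hdev : ∀ i, E.totalDeviation a θ (c i) i ω = ENNReal.ofReal (Q i ω) :=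
    fun i => (ENNReal.ofReal_toReal (h1 i).ne).symm
  have hbal := count_balanced he hed hc (fun i => (hC i).le) hQ0 hnear hfar hdev hmin t
  set S := 1 + ∑ i, Q i ω with hS
  have hSQ : ∀ i, Q i ω ≤ S ∧ Q i ω < S := by
    intro i
    have := Finset.single_le_sum (f := fun i => Q i ω) (fun i _ => hQ0 i) (Finset.mem_univ i)
    constructor <;> linarith
  have hS1 : 1 ≤ S := by
    have := Finset.sum_nonneg (s := Finset.univ) (f := fun i => Q i ω) (fun i _ => hQ0 i)
    linarith
  have hR : ∑ k, (E.dist (θ k) thr + (C k + E.dist (θ k) thr / c k) * Q k ω) ≤ M * S := by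
    rw [hM, Finset.sum_mul]
    refine Finset.sum_le_sum fun k _ => ?_
    have h2 : 0 ≤ C k + E.dist (θ k) thr / c k := by
      have := hdp k; have := hC k; have := hc k; positivity
    rw [add_mul (E.dist (θ k) thr)]
    refine add_le_add (le_mul_of_one_le_right (hdp k).le hS1) ?_
    exact mul_le_mul_of_nonneg_left (hSQ k).1 h2
  have htpos : (0 : ℝ) < t := by
    have := (hAj (Classical.arbitrary _)).2.2
    refine lt_of_lt_of_le ?_ hTt
    positivity
  have hlow : ∀ j, E.optAlloc thr θ j - 2 * ε' ≤ prop (hist a ω t) j := by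
    intro j
    have h2 := le_div_of_balanced he hed htpos
      (by exact_mod_cast sum_count (hist a ω t)) (R := M * S)
      (fun i j => (hbal i j).trans (by linarith)) j
    refine le_trans ?_ h2
    rw [sub_div]
    have h3 := heopt j
    have h4 : M * S / t / (E.dist (θ j) thr + e) ≤ ε' := by
      have hdj := hdp j
      rw [div_div, div_le_iff₀ (by positivity)]
      have h5 := (hAj j).1
      rw [div_le_iff₀ (by positivity)] at h5
      calc M * S ≤ (A * (E.dist (θ j) thr * ε')) * S := by gcongr
        _ = ε' * ((A * S) * E.dist (θ j) thr) := by ring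
        _ ≤ ε' * (t * (E.dist (θ j) thr + e)) := by
            have : E.dist (θ j) thr ≤ E.dist (θ j) thr + e := by linarith
            gcongr
    linarith
  intro i
  refine ⟨by linarith [hlow i], ?_⟩
  -- A large deviation would give $N_i\le Q_i/c_i<S/c_i\le\tfrac12p^*_i t\le N_i$. The `1` in $S$
  -- makes the middle inequality strict.
  have hgood : E.glr (sampleMean (hist a ω t) i) (θ i) ≤ ENNReal.ofReal (c i) := by
    by_contra! hbad
    have hci := hc i
    have hpi := hpp i
    have h2 : E.optAlloc thr θ i / 2 * t ≤ count (hist a ω t) i := by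
      have h3 := hlow i
      have h4 := hε'2 i
      have h5 : E.optAlloc thr θ i / 2 ≤ prop (hist a ω t) i := by linarith
      rwa [prop, le_div_iff₀ htpos] at h5
    have h3 : S / c i ≤ E.optAlloc thr θ i / 2 * t := by
      have h4 := (hAj i).2.1
      rw [div_le_iff₀ (by positivity)] at h4
      rw [div_le_iff₀ hci]
      calc S = 2 * S / 2 := by ring
        _ ≤ (A * (E.optAlloc thr θ i * c i)) * S / 2 := by gcongr
        _ = E.optAlloc thr θ i / 2 * (A * S) * c i := by ring
        _ ≤ _ := by gcongr
    have hpos : 0 < count (hist a ω t) i := by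
      have h5 : 0 < S / c i := by positivity
      have : (0 : ℝ) < count (hist a ω t) i := by linarith
      exact_mod_cast this
    have h4 := count_mul_glr_le_totalDeviation (E := E) a θ (c i) i ω t hpos hbad
    rw [hdev] at h4
    have h5 : (count (hist a ω t) i : ℝ≥0∞) * ENNReal.ofReal (c i) ≤ ENNReal.ofReal (Q i ω) :=
      le_trans (by gcongr) h4
    rw [← ENNReal.ofReal_natCast, ← ENNReal.ofReal_mul (Nat.cast_nonneg _),
      ENNReal.ofReal_le_ofReal_iff (hQ0 i), ← le_div_iff₀ hci] at h5
    have h6 : Q i ω / c i < S / c i := by gcongr; exact (hSQ i).2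
    linarith
  refine le_trans (ENNReal.ofReal_le_ofReal ?_) (hnear i _ hgood).1
  linarith

/-- Lower bounds suffice: the excesses $p_j-p^*_j+\varepsilon/K$ are nonnegative and sum to
$\varepsilon$, so each is at most $\varepsilon$. -/
theorem abs_sub_optAlloc_le (ht : thr ∈ E.meanSpace) (hK : 0 < K) {θ : Fin K → ℝ}
    (hθ : θ ∈ E.instances K thr) {ε : ℝ} {p : Fin K → ℝ} (hp : ∑ i, p i = 1)
    (h : ∀ i, E.optAlloc thr θ i - ε / K ≤ p i) (hε : 0 ≤ ε) (i : Fin K) :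
    |p i - E.optAlloc thr θ i| ≤ ε := by
  have hK' : (1 : ℝ) ≤ K := by exact_mod_cast hK
  have h0 : ε / K ≤ ε := div_le_self hε hK'
  have h1 : p i - E.optAlloc thr θ i + ε / K ≤ ∑ j, (p j - E.optAlloc thr θ j + ε / K) :=
    Finset.single_le_sum (f := fun j => p j - E.optAlloc thr θ j + ε / K)
      (fun j _ => by linarith [h j]) (Finset.mem_univ i)
  rw [Finset.sum_add_distrib, Finset.sum_sub_distrib, hp, sum_optAlloc ht hK hθ] at h1
  have h2 : ∑ _j : Fin K, ε / K = ε := by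
    simp; field_simp
  rw [h2] at h1
  have h3 : 0 ≤ ε / K := by positivity
  rw [abs_le]
  constructor
  · linarith [h i]
  · linarith

theorem lconv_prop {a : Alloc K} (ha : a.IsMeasurable) (hEB : E.IsEBKKTIDS thr a)
    (ht : thr ∈ E.meanSpace) (hK : 0 < K) {θ : Fin K → ℝ} (hθ : θ ∈ E.instances K thr)
    (i : Fin K) :
    LConv (E.prob θ) (fun t ω => prop (hist a ω t) i) (E.optAlloc thr θ i) := by
  intro ε hε
  have hP := isProbabilityMeasure_prob fun i => (hθ i).1
  have hK' : (0 : ℝ) < K := by exact_mod_cast hK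
  obtain ⟨T, hT, hae⟩ := exists_integrable_time ha hEB ht hK hθ (ε := ε / K) (by positivity)
  -- At $t=0$ all proportions are `0 / 0 = 0` and do not sum to one.
  refine ⟨fun ω => T ω ⊔ 1, hT.sup (integrable_const 1), ?_⟩
  filter_upwards [hae] with ω h t hTt
  have ht0 : (0 : ℝ) < t := lt_of_lt_of_le one_pos ((le_max_right _ _).trans hTt)
  refine abs_sub_optAlloc_le ht hK hθ ?_
    (fun j => (h t ((le_max_left _ _).trans hTt) j).1) hε.le i
  simp only [prop]
  rw [← Finset.sum_div, ← Nat.cast_sum, sum_count, div_self ht0.ne']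

end ExpFamily

/-! ### The calibration functions of the stopping threshold -/

theorem one_le_hFun {u : ℝ} (hu : 0 < u) : 1 ≤ hFun u := by
  have := Real.log_le_sub_one_of_pos hu
  rw [hFun]; linarith

/-- Provides the upper endpoint $2x$ when $h(u)=x$ is solved by the intermediate value theorem. -/
theorem half_le_hFun {u : ℝ} (hu : 0 < u) : u / 2 ≤ hFun u := by
  have h1 := Real.log_le_sub_one_of_pos (half_pos hu)
  rw [Real.log_div hu.ne' two_ne_zero] at h1
  have h2 := Real.log_two_lt_d9
  rw [hFun]; linarith

theorem strictMonoOn_hFun : StrictMonoOn hFun (Set.Ici 1) := by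
  intro u hu v hv huv
  have hu0 : 0 < u := lt_of_lt_of_le one_pos hu
  have h1 := Real.log_lt_sub_one_of_pos (div_pos (hu0.trans huv) hu0)
    (by rw [Ne, div_eq_one_iff_eq hu0.ne']; exact huv.ne')
  rw [Real.log_div (hu0.trans huv).ne' hu0.ne'] at h1
  have h2 : v / u - 1 ≤ v - u := by
    have hu1 : 1 ≤ u := hu
    rw [div_sub_one hu0.ne', div_le_iff₀ hu0]
    nlinarith
  simp only [hFun]; linarith

theorem exists_hFun_eq {x : ℝ} (hx : 1 ≤ x) : ∃ u ∈ Set.Ici (1 : ℝ), hFun u = x := by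
  have hc : ContinuousOn hFun (Set.Icc 1 (2 * x)) := by
    intro u hu
    have : u ≠ 0 := by linarith [hu.1]
    unfold hFun
    exact (continuousAt_id.sub (Real.continuousAt_log this)).continuousWithinAt
  have h := intermediate_value_Icc (by linarith : 1 ≤ 2 * x) hc
  obtain ⟨u, hu, hux⟩ := h (⟨by simpa [hFun] using hx, by
    have := half_le_hFun (by linarith : 0 < 2 * x); linarith⟩ : x ∈ Set.Icc (hFun 1) (hFun (2 * x)))
  exact ⟨u, hu.1, hux⟩

theorem one_le_hInv {x : ℝ} (hx : 1 ≤ x) : 1 ≤ hInv x :=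
  Function.invFunOn_mem (exists_hFun_eq hx)

theorem hFun_hInv {x : ℝ} (hx : 1 ≤ x) : hFun (hInv x) = x :=
  Function.invFunOn_eq (exists_hFun_eq hx)

theorem le_hInv {x : ℝ} (hx : 1 ≤ x) : x ≤ hInv x := by
  have h1 := hFun_hInv hx
  have h2 := Real.log_nonneg (one_le_hInv hx)
  rw [hFun] at h1; linarith

/-- The function `h̃_z` is a value of the affine functions `x ↦ u (x - log log u)`. -/
theorem exists_hTilde_eq (x : ℝ) :
    ∃ u : ℝ, 1 < u ∧ u ≤ 3 / 2 ∧ hTilde (3 / 2) x = u * (x - Real.log (Real.log u)) := by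
  have hl0 : 0 < Real.log (3 / 2) := Real.log_pos (by norm_num)
  by_cases h : hFun (1 / Real.log (3 / 2)) ≤ x
  · have hl1 : Real.log (3 / 2) ≤ 1 := by
      have := Real.log_le_sub_one_of_pos (by norm_num : (0 : ℝ) < 3 / 2)
      linarith
    have hx : 1 ≤ x := (one_le_hFun (by positivity)).trans h
    have hv1 := one_le_hInv hx
    have hv := hFun_hInv hx
    have hv2 : 1 / Real.log (3 / 2) ≤ hInv x := by
      rw [← strictMonoOn_hFun.le_iff_le _ hv1, hv]
      · exact h
      · show 1 ≤ 1 / Real.log (3 / 2)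
        rw [le_div_iff₀ hl0]; linarith
    have hv0 : 0 < hInv x := by linarith
    -- With $v=h^{-1}(x)$ and $u=e^{1/v}$ one has $-\log\log u=\log v$ and $x+\log v=v$, so
    -- $u(x-\log\log u)=e^{1/v}v$. The branch condition says exactly that $u\le 3/2$.
    refine ⟨Real.exp (1 / hInv x), Real.one_lt_exp_iff.2 (by positivity), ?_, ?_⟩
    · rw [← Real.le_log_iff_exp_le (by norm_num)]
      rw [div_le_iff₀ hl0] at hv2
      rw [div_le_iff₀ hv0]; linarith
    · rw [hTilde, if_pos h, Real.log_exp, one_div, Real.log_inv]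
      congr 1
      rw [hFun] at hv; linarith
  · exact ⟨3 / 2, by norm_num, le_rfl, by rw [hTilde, if_neg h]⟩

theorem summable_one_div_succ_sq : Summable (fun n : ℕ => 1 / ((n : ℝ) + 1) ^ 2) := by
  have := (summable_nat_add_iff 1).2 (Real.summable_one_div_nat_pow.2 (one_lt_two))
  simpa using! this

theorem one_le_tsum_one_div_succ_sq : 1 ≤ ∑' n : ℕ, 1 / ((n : ℝ) + 1) ^ 2 := by
  have := summable_one_div_succ_sq.le_tsum 0 fun n _ => by positivity
  simpa using this

/-- Reveals the ratio $u$ of the geometric grid of sample sizes for which the threshold is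
calibrated; correctness uses nothing else about $\mathcal C_{\exp}$. -/
theorem exists_Cexp_eq (x : ℝ) :
    ∃ u : ℝ, 1 < u ∧ u ≤ 3 / 2 ∧ Cexp x = u * (hInv (1 + x) +
      Real.log (2 * ∑' n : ℕ, 1 / ((n : ℝ) + 1) ^ 2) - 2 * Real.log (Real.log u)) := by
  obtain ⟨u, h1, h2, h3⟩ := exists_hTilde_eq
    ((hInv (1 + x) + Real.log (2 * ∑' n : ℕ, 1 / ((n : ℝ) + 1) ^ 2)) / 2)
  exact ⟨u, h1, h2, by rw [Cexp, h3]; ring⟩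

theorem tendsto_hInv_atTop : Tendsto hInv atTop atTop :=
  tendsto_atTop_mono' _ ((eventually_ge_atTop 1).mono fun _ hx => le_hInv hx) tendsto_id

theorem tendsto_hInv_div : Tendsto (fun x => hInv x / x) atTop (𝓝 1) := by
  have h1 : Tendsto (fun v => hFun v / v) atTop (𝓝 1) := by
    have h2 : Tendsto (fun v : ℝ => 1 - Real.log v / v) atTop (𝓝 (1 - 0)) :=
      tendsto_const_nhds.sub Real.isLittleO_log_id_atTop.tendsto_div_nhds_zero
    rw [sub_zero] at h2
    refine h2.congr' ?_
    filter_upwards [eventually_gt_atTop 0] with v hv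
    rw [hFun, sub_div, div_self hv.ne']
  have h2 := ((h1.comp tendsto_hInv_atTop).inv₀ one_ne_zero)
  rw [inv_one] at h2
  refine h2.congr' ?_
  filter_upwards [eventually_ge_atTop 1] with x hx
  simp only [Function.comp_apply]
  rw [hFun_hInv hx, inv_div]

theorem tendsto_hTilde_div : Tendsto (fun x => hTilde (3 / 2) x / x) atTop (𝓝 1) := by
  have h1 : Tendsto (fun x => Real.exp (1 / hInv x) * (hInv x / x)) atTop (𝓝 (Real.exp 0 * 1)) := by
    refine Tendsto.mul ((Real.continuous_exp.tendsto 0).comp ?_) tendsto_hInv_div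
    simpa using! tendsto_hInv_atTop.inv_tendsto_atTop
  rw [Real.exp_zero, one_mul] at h1
  refine h1.congr' ?_
  filter_upwards [eventually_ge_atTop (hFun (1 / Real.log (3 / 2)))] with x hx
  rw [hTilde, if_pos hx, mul_div_assoc]

/-- The outer factor 2 and the inner factor 1/2 cancel, since $h^{-1}(x)\sim x$ and $\widetilde
h_{3/2}(x)\sim x$. Hence the calibration costs nothing to first order. -/
theorem tendsto_Cexp_div : Tendsto (fun x => Cexp x / x) atTop (𝓝 1) := by
  set L := Real.log (2 * ∑' n : ℕ, 1 / ((n : ℝ) + 1) ^ 2) with hL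
  set s : ℝ → ℝ := fun x => (hInv (1 + x) + L) / 2 with hs
  have h1x : Tendsto (fun x : ℝ => 1 + x) atTop atTop :=
    tendsto_atTop_add_const_left _ _ tendsto_id
  have hinv : Tendsto (fun x : ℝ => x⁻¹) atTop (𝓝 0) := tendsto_inv_atTop_zero
  have hsx : Tendsto (fun x => s x / x) atTop (𝓝 (1 / 2)) := by
    have h2 : Tendsto (fun x : ℝ => (hInv (1 + x) / (1 + x) * (x⁻¹ + 1) + L * x⁻¹) / 2) atTop
        (𝓝 ((1 * (0 + 1) + L * 0) / 2)) :=
      (((tendsto_hInv_div.comp h1x).mul (hinv.add_const 1)).add (hinv.const_mul L)).div_const 2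
    have e : (1 * (0 + 1) + L * 0) / 2 = 1 / 2 := by norm_num
    rw [e] at h2
    refine h2.congr' ?_
    filter_upwards [eventually_gt_atTop 0] with x hx
    have : 1 + x ≠ 0 := by positivity
    simp only [hs]
    field_simp
  have hst : Tendsto s atTop atTop :=
    (tendsto_atTop_add_const_right _ _ (tendsto_hInv_atTop.comp h1x)).atTop_div_const two_pos
  have h3 := ((tendsto_hTilde_div.comp hst).mul hsx).const_mul 2
  have e : (2 : ℝ) * (1 * (1 / 2)) = 1 := by norm_num
  rw [e] at h3
  refine h3.congr' ?_
  filter_upwards [hst.eventually (eventually_gt_atTop 0), eventually_gt_atTop 0] with x h4 h5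
  simp only [Function.comp_apply]
  have h6 : Cexp x = 2 * hTilde (3 / 2) (s x) := rfl
  rw [h6]
  field_simp

theorem log_one_add_log_natCast_nonneg (n : ℕ) : 0 ≤ Real.log (1 + Real.log n) :=
  Real.log_nonneg (by linarith [Real.log_natCast_nonneg n])

/-- The stopping threshold dominates the deviation level of the slice of the sample size. -/
theorem slice_le_stopThreshold {K t : ℕ} (h : Hist K t) {δ u y L : ℝ} (x : Fin K)
    (hu : 1 < u) (hu' : u ≤ 3 / 2) (hL : 0 ≤ L)
    (hC : Cexp (Real.log (1 / δ) / K) = u * (y + L - 2 * Real.log (Real.log u)))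
    (hx : 0 < count h x) :
    ∃ k : ℕ, u ^ k ≤ count h x ∧ (count h x : ℝ) ≤ u * u ^ k ∧
      u * (K * y + 2 * Real.log (k + 1) + L) ≤ stopThreshold h δ := by
  have hK : (1 : ℝ) ≤ K := by
    have := x.pos
    exact_mod_cast this
  have hn : (1 : ℝ) ≤ count h x := by exact_mod_cast hx
  obtain ⟨k, hk1, hk2⟩ := exists_nat_pow_near hn hu
  refine ⟨k, hk1, by rw [← pow_succ']; exact hk2.le, ?_⟩
  have hu0 : 0 < u := by linarith
  have hlu : 0 < Real.log u := Real.log_pos hu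
  have hlu1 : Real.log u ≤ 1 := by linarith [Real.log_le_sub_one_of_pos hu0]
  have hll : Real.log (Real.log u) ≤ 0 := Real.log_nonpos hlu.le hlu1
  set n : ℝ := (count h x : ℝ) with hndef
  have hln : 0 ≤ Real.log n := Real.log_nonneg hn
  have h1 : (k : ℝ) * Real.log u ≤ Real.log n := by
    rw [← Real.log_pow]
    exact Real.log_le_log (by positivity) hk1
  -- From $u^k\le n$ and $\log u\le 1$: $(k+1)\log u\le 1+\log n$. The union over slices thus costs
  -- only an iterated logarithm.
  have h2 : Real.log (k + 1) + Real.log (Real.log u) ≤ Real.log (1 + Real.log n) := by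
    rw [← Real.log_mul (by positivity) hlu.ne']
    exact Real.log_le_log (by positivity) (by linarith)
  have h3 : Real.log (1 + Real.log n) ≤ ∑ i, Real.log (1 + Real.log (count h i)) :=
    Finset.single_le_sum (f := fun i => Real.log (1 + Real.log (count h i)))
      (fun i _ => log_one_add_log_natCast_nonneg _) (Finset.mem_univ x)
  have h4 := log_one_add_log_natCast_nonneg (count h x)
  rw [stopThreshold, hC]
  -- The factor $K$ is needed only on $y$; one copy of the nonnegative rest is kept.
  have h5 : u * (y + L - 2 * Real.log (Real.log u)) * K ≥
      u * (K * y) + u * (L - 2 * Real.log (Real.log u)) := by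
    have : u * (L - 2 * Real.log (Real.log u)) ≤ K * (u * (L - 2 * Real.log (Real.log u))) :=
      le_mul_of_one_le_left (mul_nonneg hu0.le (by linarith)) hK
    linarith
  -- The coefficient 3 of the threshold enters here, through $2u\le 3$.
  have h6 : 2 * u * Real.log (1 + Real.log n) ≤ 3 * Real.log (1 + Real.log n) := by
    refine mul_le_mul_of_nonneg_right (by linarith) ?_
    rw [hndef]; exact h4
  have h7 : 2 * u * (Real.log (k + 1) + Real.log (Real.log u)) ≤
      2 * u * Real.log (1 + Real.log n) := by gcongr
  nlinarith

/-! ### Correctness of the stopping rule -/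

/-- Slice $k$ receives the weight $(k+1)^{-2}/(2\zeta(2))$, and these weights sum to $1/2$. -/
theorem tsum_slice_weights {v : ℝ} :
    ∑' k : ℕ, ENNReal.ofReal (Real.exp (-(v + 2 * Real.log ((k : ℝ) + 1) +
      Real.log (2 * ∑' n : ℕ, 1 / ((n : ℝ) + 1) ^ 2)))) = ENNReal.ofReal (Real.exp (-v) / 2) := by
  set Z := ∑' n : ℕ, 1 / ((n : ℝ) + 1) ^ 2 with hZ
  have hZ1 : 1 ≤ Z := one_le_tsum_one_div_succ_sq
  have h1 : ∀ k : ℕ, Real.exp (-(v + 2 * Real.log ((k : ℝ) + 1) + Real.log (2 * Z))) =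
      Real.exp (-v) / (2 * Z) * (1 / ((k : ℝ) + 1) ^ 2) := by
    intro k
    have hk : (0 : ℝ) < k + 1 := by positivity
    have : 2 * Real.log ((k : ℝ) + 1) = Real.log (((k : ℝ) + 1) ^ 2) := by
      rw [Real.log_pow]; norm_num
    rw [this, neg_add, neg_add, Real.exp_add, Real.exp_add, Real.exp_neg (Real.log _),
      Real.exp_neg (Real.log _), Real.exp_log (by positivity), Real.exp_log (by positivity)]
    field_simp
  simp only [h1]
  rw [← ENNReal.ofReal_tsum_of_nonneg (fun k => by positivity)
    (summable_one_div_succ_sq.mul_left _), tsum_mul_left, ← hZ]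
  congr 1
  field_simp

namespace ExpFamily

variable {E : ExpFamily} {K : ℕ} {thr : ℝ}

/-- The probability that the statistic of an arm crosses the stopping threshold while its sample mean
is on the wrong side. -/
theorem measure_wrong_side_le {a : Alloc K} (ha : a.IsMeasurable) (ht : thr ∈ E.meanSpace)
    {θ : Fin K → ℝ} (hθ : ∀ i, θ i ∈ E.meanSpace) {δ : ℝ} (hδ : 0 < δ) (hδ1 : δ < 1) (x : Fin K) :
    E.prob θ {ω | ∃ t, (thr < θ x ∧ sampleMean (hist a ω t) x ≤ thr ∨
        θ x < thr ∧ thr ≤ sampleMean (hist a ω t) x) ∧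
        ENNReal.ofReal (stopThreshold (hist a ω t) δ) <
          count (hist a ω t) x * E.glr (sampleMean (hist a ω t) x) thr} ≤
      ENNReal.ofReal (δ / K) := by
  have hK : (1 : ℝ) ≤ K := by
    have := x.pos
    exact_mod_cast this
  have hlog : 0 < Real.log (1 / δ) := Real.log_pos (by rw [lt_div_iff₀ hδ]; linarith)
  have hx1 : (1 : ℝ) ≤ 1 + Real.log (1 / δ) / K := by
    have : 0 ≤ Real.log (1 / δ) / K := by positivity
    linarith
  obtain ⟨u, hu, hu', hC⟩ := exists_Cexp_eq (Real.log (1 / δ) / K)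
  set y := hInv (1 + Real.log (1 / δ) / K) with hy
  have hy1 : 1 ≤ y := one_le_hInv hx1
  have hye : hFun y = 1 + Real.log (1 / δ) / K := hFun_hInv hx1
  set L := Real.log (2 * ∑' n : ℕ, 1 / ((n : ℝ) + 1) ^ 2) with hL
  have hL0 : 0 ≤ L := Real.log_nonneg (by linarith [one_le_tsum_one_div_succ_sq])
  have hu0 : 0 < u := by linarith
  -- The parameters beyond $\theta_x$ in the direction of the threshold. All slopes have one sign,
  -- so the one-sided inequality applies without a factor 2.
  set side : Set ℝ := E.natSpace ∩
    {η | (thr < θ x ∧ η < E.natParam (θ x)) ∨ (θ x < thr ∧ E.natParam (θ x) < η)} with hside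
  have hsideprod : ∀ η ∈ side, ∀ η' ∈ side,
      0 < (η - E.natParam (θ x)) * (η' - E.natParam (θ x)) := by
    rintro η ⟨-, h1⟩ η' ⟨-, h2⟩
    rcases h1 with ⟨h1, h3⟩ | ⟨h1, h3⟩ <;> rcases h2 with ⟨h2, h4⟩ | ⟨h2, h4⟩
    · exact mul_pos_of_neg_of_neg (by linarith) (by linarith)
    · exact absurd h1 h2.not_gt
    · exact absurd h1 h2.not_gt
    · exact mul_pos (by linarith) (by linarith)
  set w : ℕ → ℝ := fun k => K * y + 2 * Real.log ((k : ℝ) + 1) + L with hw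
  have hw0 : ∀ k, 0 ≤ w k := by
    intro k
    have : 0 ≤ Real.log ((k : ℝ) + 1) := Real.log_nonneg (by linarith [(Nat.cast_nonneg k : (0:ℝ) ≤ k)])
    simp only [hw]; positivity
  have hslice := fun k => measure_oneSided_le ha hθ x (side := side) Set.inter_subset_left
    hsideprod (p := u ^ k) (w := w k) (by positivity) (hw0 k)
  have hbound : E.prob θ _ ≤ ∑' k, ENNReal.ofReal (Real.exp (-(w k))) :=
    (measure_iUnion_le _).trans (ENNReal.tsum_le_tsum hslice)
  -- Since $h(y)=1+\log(1/\delta)/K$, $Ky=K\log y+K+\log(1/\delta)$. Thus $e^{-Ky}\le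
  -- e^{-K}\delta\le\delta/K$, where $y\ge 1$ and $Ke^{-K}\le 1$.
  have hle : ENNReal.ofReal (Real.exp (-(K * y)) / 2) ≤ ENNReal.ofReal (δ / K) := by
    refine ENNReal.ofReal_le_ofReal ?_
    have h1 : K * y = K * Real.log y + K + Real.log (1 / δ) := by
      rw [hFun] at hye
      have h2 : y = Real.log y + (1 + Real.log (1 / δ) / K) := by linarith
      calc K * y = K * (Real.log y + (1 + Real.log (1 / δ) / K)) := by rw [← h2]
        _ = _ := by field_simp; ring
    have h2 : Real.exp (-(K * y)) ≤ Real.exp (-K) * δ := by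
      have h3 : Real.exp (-K) * δ = Real.exp (-K - Real.log (1 / δ)) := by
        rw [Real.exp_sub, Real.exp_log (by positivity)]; field_simp
      rw [h3, h1]
      refine Real.exp_le_exp.2 ?_
      have : 0 ≤ K * Real.log y := mul_nonneg (by linarith) (Real.log_nonneg hy1)
      linarith
    have h3 : K * Real.exp (-K) ≤ 1 := by
      rw [Real.exp_neg, ← div_eq_mul_inv, div_le_one (Real.exp_pos _)]
      linarith [Real.add_one_le_exp (K : ℝ)]
    rw [le_div_iff₀ (by linarith)]
    nlinarith [Real.exp_pos (-(K * y))]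
  refine le_trans ?_ hle
  rw [← tsum_slice_weights (v := K * y)]
  refine le_trans (measure_mono ?_) hbound
  rintro ω ⟨t, hwrong, hcross⟩
  set h := hist a ω t
  have hpos : 0 < count h x := by
    by_contra h0
    rw [Nat.eq_zero_of_not_pos h0] at hcross
    simp at hcross
  have hpos' : (0 : ℝ) < count h x := by exact_mod_cast hpos
  obtain ⟨k, hk1, hk2, hk3⟩ := slice_le_stopThreshold h (δ := δ) x hu hu' hL0 hC hpos
  -- Inside a slice the sample size is at most $u\cdot u^k$ and the threshold at least $u\,w_k$, so
  -- crossing at size $N$ passes the level $w_k/u^k$ of the slice.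
  have h1 : ENNReal.ofReal (w k / u ^ k) < E.glr (sampleMean h x) thr := by
    have h2 : ENNReal.ofReal (stopThreshold h δ / count h x) < E.glr (sampleMean h x) thr := by
      rw [ENNReal.ofReal_div_of_pos hpos', ENNReal.ofReal_natCast]
      exact ENNReal.div_lt_of_lt_mul' hcross
    refine lt_of_le_of_lt (ENNReal.ofReal_le_ofReal ?_) h2
    rw [div_le_div_iff₀ (by positivity) hpos']
    calc w k * count h x ≤ w k * (u * u ^ k) := mul_le_mul_of_nonneg_left hk2 (hw0 k)
      _ = u * w k * u ^ k := by ring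
      _ ≤ stopThreshold h δ * u ^ k := by gcongr
  have h2 := exists_logRatio_gt_of_lt_glr (hθ x) ht
    (div_nonneg (hw0 k) (by positivity)) h1
  refine Set.mem_iUnion.2 ⟨k, t, hk1, ?_⟩
  rcases hwrong with ⟨h3, h4⟩ | ⟨h3, h4⟩
  · obtain ⟨η, h5, h6, h7⟩ := h2.1 h4 h3
    exact ⟨η, ⟨h5, Or.inl ⟨h3, h6⟩⟩, h7⟩
  · obtain ⟨η, h5, h6, h7⟩ := h2.2 h4 h3
    exact ⟨η, ⟨h5, Or.inr ⟨h3, h6⟩⟩, h7⟩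

/-- A wrong answer misclassifies some arm. The minimum statistic has crossed, so that arm's has too,
and the $K$ arms contribute $\delta/K$ each. -/
theorem measure_wrong_answer_le {a : Alloc K} (ha : a.IsMeasurable) (ht : thr ∈ E.meanSpace)
    (hK : 0 < K) {θ : Fin K → ℝ} (hθ : θ ∈ E.instances K thr) {δ : ℝ} (hδ : 0 < δ) (hδ1 : δ < 1) :
    E.prob θ {ω | ∃ t, hist a ω t ∈ (E.chernoffPolicy thr a δ).stopSet t ∧
      answer thr (sampleMean (hist a ω t)) ≠ answer thr θ} ≤ ENNReal.ofReal δ := by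
  have hK' : (0 : ℝ) < K := by exact_mod_cast hK
  refine le_trans (measure_mono ?_) ((measure_iUnion_fintype_le _ _).trans
    (Finset.sum_le_sum fun x _ => measure_wrong_side_le ha ht (fun i => (hθ i).1) hδ hδ1 x)) |>.trans ?_
  · rintro ω ⟨t, hcross, hne⟩
    obtain ⟨x, hx⟩ : ∃ x, ¬ (thr < sampleMean (hist a ω t) x ↔ thr < θ x) := by
      by_contra! h
      exact hne (Set.ext h)
    refine Set.mem_iUnion.2 ⟨x, t, ?_, ?_⟩
    · have := (hθ x).2
      by_cases h1 : thr < θ x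
      · left
        exact ⟨h1, not_lt.1 fun h2 => hx ⟨fun _ => h1, fun _ => h2⟩⟩
      · right
        refine ⟨lt_of_le_of_ne (not_lt.1 h1) this, ?_⟩
        by_contra! h2
        exact hx ⟨fun h3 => absurd h3 h2.not_gt, fun h3 => absurd h3 h1⟩
    · rw [← mul_empInfo]
      refine lt_of_lt_of_le hcross ?_
      gcongr
      exact iInf_le _ x
  · rw [Finset.sum_const, Finset.card_univ, Fintype.card_fin, nsmul_eq_mul,
      ← ENNReal.ofReal_natCast, ← ENNReal.ofReal_mul hK'.le, mul_div_cancel₀ _ hK'.ne']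

theorem measurable_stopThreshold {t : ℕ} (δ : ℝ) :
    Measurable (fun h : Hist K t => stopThreshold h δ) := by
  refine Measurable.add_const (Measurable.const_mul (Finset.measurable_sum _ fun i _ => ?_) _) _
  exact Real.measurable_log.comp ((Real.measurable_log.comp (measurable_count_real i)).const_add 1)

theorem isMeasurable_chernoffPolicy {a : Alloc K} (ha : a.IsMeasurable) (δ : ℝ) :
    (E.chernoffPolicy thr a δ).IsMeasurable := by
  refine ⟨ha, fun t => ?_, fun t S => ?_⟩
  · exact measurableSet_lt (measurable_stopThreshold δ).ennreal_ofReal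
      ((Measurable.iInf fun i => measurable_empInfo thr i).const_mul _)
  · have h1 : {h : Hist K t | answer thr (sampleMean h) = S} =
        ⋂ i, {h : Hist K t | thr < sampleMean h i ↔ i ∈ S} := by
      ext h
      simp [Set.ext_iff, answer]
    show MeasurableSet {h : Hist K t | answer thr (sampleMean h) = S}
    rw [h1]
    refine MeasurableSet.iInter fun i => ?_
    have h2 : MeasurableSet {h : Hist K t | thr < sampleMean h i} :=
      measurableSet_lt measurable_const (measurable_sampleMean i)
    by_cases hi : i ∈ S
    · simpa [hi] using h2
    · simpa [hi] using measurableSet_le (measurable_sampleMean i) measurable_const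

end ExpFamily

/-! ### The lower bound on the sample complexity -/

namespace Policy

variable {K : ℕ}

/-- The event that the policy has not stopped before time `t`. -/
def running (π : Policy K) (t : ℕ) : Set (BanditSpace K) :=
  {ω | ∀ s < t, hist π.alloc ω s ∉ π.stopSet s}

/-- The event that the policy stops at time `t`. -/
def stopsAt (π : Policy K) (t : ℕ) : Set (BanditSpace K) :=
  {ω | hist π.alloc ω t ∈ π.stopSet t} ∩ π.running t

/-- Whether sampling continues after time $t$ is known from the history at $t$. This predictability
is what Wald's identity needs. -/
theorem measurableSet_running {π : Policy K} (hπ : π.IsMeasurable) (t : ℕ) :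
    MeasurableSet[histAlg π.alloc t] (π.running (t + 1)) := by
  have h : π.running (t + 1) = ⋂ s ∈ Set.Iio (t + 1), {ω | hist π.alloc ω s ∈ (π.stopSet s)ᶜ} := by
    ext ω; simp [running]
  rw [h]
  exact MeasurableSet.biInter (Set.to_countable _) fun s hs =>
    measurableSet_hist_preimage π.alloc (Nat.lt_succ_iff.1 hs) (hπ.2.1 s).compl

theorem running_antitone (π : Policy K) : Antitone π.running :=
  fun _ _ hst _ hω r hr => hω r (hr.trans_le hst)

theorem measurableSet_running' {π : Policy K} (hπ : π.IsMeasurable) (t : ℕ) :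
    MeasurableSet[histAlg π.alloc t] (π.running t) := by
  cases t with
  | zero =>
    have : π.running 0 = Set.univ := by ext; simp [running]
    rw [this]; exact MeasurableSet.univ
  | succ t => exact histAlg_mono π.alloc t.le_succ _ (measurableSet_running hπ t)

theorem measurableSet_stopsAt {π : Policy K} (hπ : π.IsMeasurable) (t : ℕ) :
    MeasurableSet[histAlg π.alloc t] (π.stopsAt t) :=
  (measurableSet_hist_preimage π.alloc le_rfl (hπ.2.1 t)).inter (measurableSet_running' hπ t)

theorem le_tau_of_running {π : Policy K} {ω : BanditSpace K} {t : ℕ} (h : ω ∈ π.running t) :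
    (t : ℕ∞) ≤ π.tau ω := by
  refine le_iInf₂ fun s hs => ?_
  by_contra! h1
  exact h s (by exact_mod_cast h1) hs

theorem tau_eq_of_stopsAt {π : Policy K} {ω : BanditSpace K} {t : ℕ} (h : ω ∈ π.stopsAt t) :
    π.tau ω = t :=
  le_antisymm (iInf₂_le t h.1) (le_tau_of_running h.2)

theorem tau_eq_iff {π : Policy K} {ω : BanditSpace K} {t : ℕ} :
    π.tau ω = t ↔ ω ∈ π.stopsAt t := by
  classical
  refine ⟨fun h => ?_, tau_eq_of_stopsAt⟩
  by_cases hex : ∃ s, hist π.alloc ω s ∈ π.stopSet s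
  · have h1 : ω ∈ π.stopsAt (Nat.find hex) :=
      ⟨Nat.find_spec hex, fun s hs => Nat.find_min hex hs⟩
    have h2 : (Nat.find hex : ℕ∞) = t := (tau_eq_of_stopsAt h1).symm.trans h
    rwa [Nat.cast_inj.1 h2] at h1
  · push Not at hex
    have : π.tau ω = ⊤ := iInf₂_eq_top.2 fun s hs => absurd hs (hex s)
    rw [this] at h
    exact absurd h (ENat.top_ne_natCast t)

theorem stopsAt_disjoint (π : Policy K) {s t : ℕ} (h : s ≠ t) :
    Disjoint (π.stopsAt s) (π.stopsAt t) := by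
  rw [Set.disjoint_left]
  intro ω h1 h2
  have := (tau_eq_of_stopsAt h1).symm.trans (tau_eq_of_stopsAt h2)
  exact h (Nat.cast_inj.1 this)

theorem stopsAt_disjoint_running (π : Policy K) {s t : ℕ} (h : s < t) :
    Disjoint (π.stopsAt s) (π.running t) := by
  rw [Set.disjoint_left]
  intro ω h1 h2
  exact h2 s h h1.1

theorem union_stopsAt (π : Policy K) (n : ℕ) :
    π.running n ∪ ⋃ t ∈ Finset.range n, π.stopsAt t = Set.univ := by
  classical
  refine Set.eq_univ_of_forall fun ω => ?_
  by_cases hex : ∃ s, s < n ∧ hist π.alloc ω s ∈ π.stopSet s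
  · right
    have h1 := Nat.find_spec hex
    refine Set.mem_biUnion (x := Nat.find hex) (by simpa using h1.1) ⟨h1.2, fun s hs h2 => ?_⟩
    exact Nat.find_min hex hs ⟨hs.trans h1.1, h2⟩
  · left
    intro s hs h
    exact hex ⟨s, hs, h⟩

/-- `running (s + 1)` is the event $\tau>s$, so the sum is $\min(\tau,n)$. -/
theorem sum_running_le_tau (π : Policy K) (ω : BanditSpace K) (n : ℕ) :
    ∑ s ∈ Finset.range n, (π.running (s + 1)).indicator (1 : BanditSpace K → ℝ≥0∞) ω ≤ π.tau ω := by
  induction n with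
  | zero => simp
  | succ n ih =>
    by_cases h : ω ∈ π.running (n + 1)
    · have h1 : (((n + 1 : ℕ) : ℕ∞) : ℝ≥0∞) ≤ π.tau ω := by
        exact_mod_cast le_tau_of_running h
      refine le_trans ?_ h1
      calc _ ≤ ∑ s ∈ Finset.range (n + 1), (1 : ℝ≥0∞) :=
            Finset.sum_le_sum fun s _ => Set.indicator_le_self' (by simp) ω
        _ = _ := by simp
    · rw [Finset.sum_range_succ, Set.indicator_of_notMem h, add_zero]
      exact ih

end Policy

/-- The increment at time `s` of the log-likelihood ratio. -/
noncomputable def logLikIncr {K : ℕ} (a : Alloc K) (g : Fin K → ℝ → ℝ) (s : ℕ)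
    (ω : BanditSpace K) : ℝ :=
  g (a s (hist a ω s) (ω s).2) ((ω s).1 (a s (hist a ω s) (ω s).2))

theorem logLik_hist {K : ℕ} (a : Alloc K) (g : Fin K → ℝ → ℝ) (ω : BanditSpace K) (t : ℕ) :
    logLik g (hist a ω t) = ∑ s ∈ Finset.range t, logLikIncr a g s ω := by
  induction t with
  | zero => simp [logLik]
  | succ t ih =>
    rw [hist_succ, histStep, logLik_snoc, Finset.sum_range_succ, ih]
    rfl

/-- The log-likelihood ratio at the stopping time, or at time `n` if it is earlier. -/
noncomputable def Policy.stoppedLogLik {K : ℕ} (π : Policy K) (g : Fin K → ℝ → ℝ) (n : ℕ)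
    (ω : BanditSpace K) : ℝ :=
  ∑ s ∈ Finset.range n, (π.running (s + 1)).indicator (logLikIncr π.alloc g s) ω

namespace Policy

variable {K : ℕ}

theorem stoppedLogLik_of_running {π : Policy K} (g : Fin K → ℝ → ℝ) {n : ℕ} {ω : BanditSpace K}
    (h : ω ∈ π.running n) : π.stoppedLogLik g n ω = logLik g (hist π.alloc ω n) := by
  rw [logLik_hist, stoppedLogLik]
  refine Finset.sum_congr rfl fun s hs => ?_
  exact Set.indicator_of_mem (π.running_antitone (Finset.mem_range.1 hs) h) _

theorem stoppedLogLik_of_stopsAt {π : Policy K} (g : Fin K → ℝ → ℝ) {n t : ℕ} (htn : t < n)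
    {ω : BanditSpace K} (h : ω ∈ π.stopsAt t) :
    π.stoppedLogLik g n ω = logLik g (hist π.alloc ω t) := by
  rw [← stoppedLogLik_of_running g h.2, stoppedLogLik, stoppedLogLik]
  refine (Finset.sum_subset (Finset.range_subset_range.2 htn.le) fun s _ hs => ?_).symm
  refine Set.indicator_of_notMem (fun hr => ?_) _
  exact hr t (by simpa using! hs) h.1

/-- Change of measure at the stopping time. -/
theorem setLIntegral_stoppedLogLik {π : Policy K} (hπ : π.IsMeasurable)
    {μ μ' : Fin K → Measure ℝ} [∀ i, IsProbabilityMeasure (μ i)]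
    [∀ i, IsProbabilityMeasure (μ' i)] {g : Fin K → ℝ → ℝ} (hg : ∀ i, Measurable (g i))
    (hμ : ∀ i, μ' i = (μ i).withDensity (fun y => ENNReal.ofReal (Real.exp (g i y)))) (n : ℕ)
    {B : Set (BanditSpace K)}
    (hB : ∀ t < n, MeasurableSet[histAlg π.alloc t] (B ∩ π.stopsAt t))
    (hBn : MeasurableSet[histAlg π.alloc n] (B ∩ π.running n)) :
    ∫⁻ ω in B, ENNReal.ofReal (Real.exp (π.stoppedLogLik g n ω)) ∂(banditMeasure μ) =
      banditMeasure μ' B := by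
  -- On each piece the stopped ratio equals the ratio at one deterministic time, at which the change
  -- of measure is already known.
  have hdec : B = (B ∩ π.running n) ∪ ⋃ t ∈ Finset.range n, B ∩ π.stopsAt t := by
    rw [← Set.inter_iUnion₂, ← Set.inter_union_distrib_left, π.union_stopsAt, Set.inter_univ]
  have hm : ∀ t ∈ Finset.range n, MeasurableSet (B ∩ π.stopsAt t) := fun t ht =>
    histAlg_le hπ.1 t _ (hB t (Finset.mem_range.1 ht))
  have hmU : MeasurableSet (⋃ t ∈ Finset.range n, B ∩ π.stopsAt t) :=
    Finset.measurableSet_biUnion _ hm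
  have hd1 : Disjoint (B ∩ π.running n) (⋃ t ∈ Finset.range n, B ∩ π.stopsAt t) := by
    rw [Set.disjoint_iUnion₂_right]
    intro t ht
    exact ((π.stopsAt_disjoint_running (Finset.mem_range.1 ht)).symm.mono
      Set.inter_subset_right Set.inter_subset_right)
  have hd2 : Set.PairwiseDisjoint (Finset.range n : Set ℕ) fun t => B ∩ π.stopsAt t := by
    intro s _ t _ hst
    exact (π.stopsAt_disjoint hst).mono Set.inter_subset_right Set.inter_subset_right
  rw [hdec, lintegral_union hmU hd1, lintegral_biUnion_finset hd2 hm,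
    measure_union hd1 hmU, measure_biUnion_finset hd2 hm,
    setLIntegral_change_of_measure hπ.1 hg hμ n hBn]
  congr 1
  · refine setLIntegral_congr_fun (histAlg_le hπ.1 n _ hBn) fun ω hω => ?_
    rw [stoppedLogLik_of_running g hω.2]
  · refine Finset.sum_congr rfl fun t ht => ?_
    rw [setLIntegral_change_of_measure hπ.1 hg hμ t (hB t (Finset.mem_range.1 ht))]
    refine setLIntegral_congr_fun (hm t ht) fun ω hω => ?_
    rw [stoppedLogLik_of_stopsAt g (Finset.mem_range.1 ht) hω.2]

end Policy

/-- The reward of an arm at time `s` is independent of the history and of the uniform variable. -/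
theorem integral_hist_mul_reward {K : ℕ} {a : Alloc K} (ha : a.IsMeasurable)
    (μ : Fin K → Measure ℝ) [∀ i, IsProbabilityMeasure (μ i)] (s : ℕ) (i : Fin K)
    {φ : Hist K s × unitInterval → ℝ} (hφ : Measurable φ) (hφ1 : ∀ p, |φ p| ≤ 1)
    {f : ℝ → ℝ} (hf : Integrable f (μ i)) :
    Integrable (fun ω => φ (hist a ω s, (ω s).2) * f ((ω s).1 i)) (banditMeasure μ) ∧
    ∫ ω, φ (hist a ω s, (ω s).2) * f ((ω s).1 i) ∂(banditMeasure μ) =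
      (∫ ω, φ (hist a ω s, (ω s).2) ∂(banditMeasure μ)) * ∫ y, f y ∂(μ i) := by
  have hpair : Measurable (fun ω : BanditSpace K => (hist a ω s, ω s)) :=
    (measurable_hist ha s).prodMk (measurable_pi_apply s)
  have : IsProbabilityMeasure ((banditMeasure μ).map fun ω => hist a ω s) :=
    Measure.isProbabilityMeasure_map (measurable_hist ha s).aemeasurable
  set m := ((banditMeasure μ).map fun ω => hist a ω s).prod (stepMeasure μ) with hm
  have hmp : MeasurePreserving (fun ω : BanditSpace K => (hist a ω s, ω s)) (banditMeasure μ) m :=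
    ⟨hpair, map_hist_prod ha μ s⟩
  have hφm : Measurable (fun p : Hist K s × ((Fin K → ℝ) × unitInterval) => φ (p.1, p.2.2)) :=
    hφ.comp (measurable_fst.prodMk (measurable_snd.comp measurable_snd))
  have hmi : MeasurePreserving (fun p : Hist K s × ((Fin K → ℝ) × unitInterval) => p.2.1 i)
      m (μ i) :=
    (measurePreserving_eval μ i).comp
      ((measurePreserving_fst (μ := Measure.pi μ) (ν := volume)).comp
        (measurePreserving_snd (μ := (banditMeasure μ).map fun ω => hist a ω s)
          (ν := stepMeasure μ)))
  have gen : ∀ f : ℝ → ℝ, Integrable f (μ i) →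
      Integrable (fun ω => φ (hist a ω s, (ω s).2) * f ((ω s).1 i)) (banditMeasure μ) ∧
      ∫ ω, φ (hist a ω s, (ω s).2) * f ((ω s).1 i) ∂(banditMeasure μ) =
        (∫ h, ∫ u, φ (h, u) ∂volume ∂((banditMeasure μ).map fun ω => hist a ω s)) *
          ∫ y, f y ∂(μ i) := by
    intro f hf
    have h1 : Integrable (fun p : Hist K s × ((Fin K → ℝ) × unitInterval) => f (p.2.1 i)) m :=
      hmi.integrable_comp_of_integrable hf
    have h2 : Integrable (fun p : Hist K s × ((Fin K → ℝ) × unitInterval) =>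
        φ (p.1, p.2.2) * f (p.2.1 i)) m :=
      h1.bdd_mul (c := 1) hφm.aestronglyMeasurable (Eventually.of_forall fun p => hφ1 _)
    refine ⟨hmp.integrable_comp_of_integrable h2, ?_⟩
    have h3 : ∫ ω, φ (hist a ω s, (ω s).2) * f ((ω s).1 i) ∂(banditMeasure μ) =
        ∫ p, φ (p.1, p.2.2) * f (p.2.1 i) ∂m := by
      rw [← hmp.map_eq] at h2 ⊢
      rw [integral_map hpair.aemeasurable h2.aestronglyMeasurable]
    rw [h3, hm, integral_prod _ h2, ← integral_mul_const]
    congr 1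
    funext h
    have h4 : ∫ z, φ (h, z.2) * f (z.1 i) ∂(stepMeasure μ) =
        ∫ z, (fun y : Fin K → ℝ => f (y i)) z.1 * (fun u => φ (h, u)) z.2
          ∂((Measure.pi μ).prod volume) := by
      simp only [stepMeasure, mul_comm]
    show ∫ z, φ (h, z.2) * f (z.1 i) ∂(stepMeasure μ) = _
    rw [h4]
    refine (integral_prod_mul (fun y : Fin K → ℝ => f (y i)) (fun u => φ (h, u))).trans ?_
    rw [integral_comp_eval hf.aestronglyMeasurable, mul_comm]
  refine ⟨(gen f hf).1, ?_⟩
  -- The case `f = 1` identifies the iterated integral of `φ` with its expectation.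
  have h1 := (gen (fun _ => 1) (integrable_const 1)).2
  simp only [mul_one, integral_const, probReal_univ, smul_eq_mul] at h1
  rw [(gen f hf).2, h1]

/-- Wald's identity for one step. -/
theorem integral_indicator_logLikIncr {K : ℕ} {a : Alloc K} (ha : a.IsMeasurable)
    (μ : Fin K → Measure ℝ) [∀ i, IsProbabilityMeasure (μ i)] (s : ℕ) {g : Fin K → ℝ → ℝ}
    (hg : ∀ i, Integrable (g i) (μ i)) {C : Set (BanditSpace K)}
    (hC : MeasurableSet[histAlg a s] C) :
    Integrable (C.indicator (logLikIncr a g s)) (banditMeasure μ) ∧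
    ∫ ω, C.indicator (logLikIncr a g s) ω ∂(banditMeasure μ) =
      ∑ i, (banditMeasure μ).real (C ∩ {ω | a s (hist a ω s) (ω s).2 = i}) * ∫ y, g i y ∂(μ i) := by
  obtain ⟨B, hB, rfl⟩ := hC
  have hmI : ∀ i, MeasurableSet (B ×ˢ Set.univ ∩ {p : Hist K s × unitInterval | a s p.1 p.2 = i}) :=
    fun i => (hB.prod MeasurableSet.univ).inter ((ha s) (measurableSet_singleton i))
  set φ : Fin K → Hist K s × unitInterval → ℝ := fun i =>
    (B ×ˢ Set.univ ∩ {p : Hist K s × unitInterval | a s p.1 p.2 = i}).indicator 1 with hφ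
  have hφm : ∀ i, Measurable (φ i) := fun i => measurable_one.indicator (hmI i)
  have hφ1 : ∀ i p, |φ i p| ≤ 1 := by
    intro i p
    by_cases hp : p ∈ B ×ˢ Set.univ ∩ {p : Hist K s × unitInterval | a s p.1 p.2 = i}
    · simp only [hφ, Set.indicator_of_mem hp]; simp
    · simp only [hφ, Set.indicator_of_notMem hp]; simp
  have key := fun i => integral_hist_mul_reward ha μ s i (hφm i) (hφ1 i) (hg i)
  -- Splitting by the sampled arm makes each term a product of a function of history and uniform
  -- variable with the reward of a fixed arm.
  have hdec : ((fun ω => hist a ω s) ⁻¹' B).indicator (logLikIncr a g s) =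
      fun ω => ∑ i, φ i (hist a ω s, (ω s).2) * g i ((ω s).1 i) := by
    funext ω
    by_cases hω : hist a ω s ∈ B
    · rw [Set.indicator_of_mem (show ω ∈ (fun ω => hist a ω s) ⁻¹' B from hω),
        Finset.sum_eq_single (a s (hist a ω s) (ω s).2)]
      · simp [hφ, hω, logLikIncr]
      · intro i _ hi
        simp [hφ, hω, hi.symm]
      · simp
    · rw [Set.indicator_of_notMem (show ω ∉ (fun ω => hist a ω s) ⁻¹' B from hω)]
      simp [hφ, hω]
  rw [hdec]
  refine ⟨integrable_finsetSum _ fun i _ => (key i).1, ?_⟩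
  rw [integral_finsetSum _ fun i _ => (key i).1]
  refine Finset.sum_congr rfl fun i _ => ?_
  rw [(key i).2]
  congr 1
  have hms : MeasurableSet ((fun ω => hist a ω s) ⁻¹' B ∩ {ω | a s (hist a ω s) (ω s).2 = i}) := by
    have h1 : Measurable (fun ω : BanditSpace K => (hist a ω s, (ω s).2)) :=
      (measurable_hist ha s).prodMk (measurable_snd.comp (measurable_pi_apply s))
    refine MeasurableSet.inter ((measurable_hist ha s) hB) ?_
    exact ((ha s).comp h1) (measurableSet_singleton i)
  rw [← integral_indicator_one hms]
  congr 1
  funext ω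
  by_cases h1 : hist a ω s ∈ B <;> by_cases h2 : a s (hist a ω s) (ω s).2 = i <;>
    simp [hφ, h1, h2]

/-! ### Transportation inequality and the lower bound -/

namespace ExpFamily

variable {E : ExpFamily} {K : ℕ} {thr : ℝ}

variable (E) in
/-- The expected number of samples of arm `i` before the stopping time and before time `n`. -/
noncomputable def expSamples (θ : Fin K → ℝ) (π : Policy K) (n : ℕ) (i : Fin K) : ℝ :=
  ∑ s ∈ Finset.range n, (E.prob θ).real
    (π.running (s + 1) ∩ {ω | π.alloc s (hist π.alloc ω s) (ω s).2 = i})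

/-- Wald's identity: under `θ` a sample of arm `i` has mean log ratio $-d(\theta_i,\vartheta_i)$,
because the ratio is that of `ϑ` to `θ`. Truncation at `n` avoids any assumption on $\tau$. -/
theorem integral_stoppedLogLik {π : Policy K} (hπ : π.IsMeasurable) {θ ϑ : Fin K → ℝ}
    (hθ : ∀ i, θ i ∈ E.meanSpace) (n : ℕ) :
    Integrable (π.stoppedLogLik (fun i => E.logRatio (E.natParam (ϑ i)) (E.natParam (θ i))) n)
      (E.prob θ) ∧
    ∫ ω, π.stoppedLogLik (fun i => E.logRatio (E.natParam (ϑ i)) (E.natParam (θ i))) n ω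
      ∂(E.prob θ) = -∑ i, E.expSamples θ π n i * E.dist (θ i) (ϑ i) := by
  have hP := fun i => isProbabilityMeasure_law (hθ i)
  have key := fun s => integral_indicator_logLikIncr hπ.1 (fun i => E.law (θ i)) s
    (g := fun i => E.logRatio (E.natParam (ϑ i)) (E.natParam (θ i)))
    (fun i => integrable_logRatio (hθ i) _ _) (Policy.measurableSet_running hπ s)
  refine ⟨integrable_finsetSum _ fun s _ => (key s).1, ?_⟩
  have h1 := integral_finsetSum (μ := E.prob θ) (Finset.range n) fun s _ => (key s).1
  refine h1.trans ((Finset.sum_congr rfl fun s _ => (key s).2).trans ?_)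
  have h2 : ∀ i, ∫ y, E.logRatio (E.natParam (ϑ i)) (E.natParam (θ i)) y ∂(E.law (θ i)) =
      -E.dist (θ i) (ϑ i) := by
    intro i
    rw [integral_logRatio (hθ i), dist]
    have := E.logRatio_add (E.natParam (ϑ i)) (E.natParam (θ i)) (E.natParam (ϑ i)) (θ i)
    rw [logRatio_self] at this
    linarith
  rw [Finset.sum_comm, ← Finset.sum_neg_distrib]
  refine Finset.sum_congr rfl fun i _ => ?_
  rw [h2, expSamples, Finset.sum_mul, ← Finset.sum_neg_distrib]
  exact Finset.sum_congr rfl fun s _ => mul_neg _ _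

/-- The transportation inequality up to time `n`. -/
theorem transportation_le {π : Policy K} (hπ : π.IsMeasurable) {θ ϑ : Fin K → ℝ}
    (hθ : ∀ i, θ i ∈ E.meanSpace) (hϑ : ∀ i, ϑ i ∈ E.meanSpace) {δ : ℝ} (hδ : 0 < δ) (n : ℕ)
    {B : Set (BanditSpace K)} (hBm : MeasurableSet B)
    (hB : ∀ t < n, MeasurableSet[histAlg π.alloc t] (B ∩ π.stopsAt t))
    (hBn : B ∩ π.running n = ∅) (hBδ : E.prob ϑ B ≤ ENNReal.ofReal δ) :
    (E.prob θ).real B * Real.log (1 / δ) - 2 ≤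
      ∑ i, E.expSamples θ π n i * E.dist (θ i) (ϑ i) := by
  have hP := fun i => isProbabilityMeasure_law (hθ i)
  have hP' := fun i => isProbabilityMeasure_law (hϑ i)
  have hPθ := isProbabilityMeasure_prob hθ
  have hPϑ := isProbabilityMeasure_prob hϑ
  set g : Fin K → ℝ → ℝ := fun i => E.logRatio (E.natParam (ϑ i)) (E.natParam (θ i)) with hgdef
  have hg : ∀ i, Measurable (g i) := fun i => E.measurable_logRatio _ _
  have hμ : ∀ i, E.law (ϑ i) =
      (E.law (θ i)).withDensity (fun y => ENNReal.ofReal (Real.exp (g i y))) := fun i =>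
    have := base_ne_zero (hθ i)
    natLaw_eq_withDensity (natParam_mem_natSpace (hϑ i)) (natParam_mem_natSpace (hθ i))
  obtain ⟨hZi, hZ⟩ := integral_stoppedLogLik (E := E) (ϑ := ϑ) hπ hθ n
  set Z := π.stoppedLogLik g n with hZdef
  have hcB : ∫⁻ ω in B, ENNReal.ofReal (Real.exp (Z ω)) ∂(E.prob θ) = E.prob ϑ B :=
    Policy.setLIntegral_stoppedLogLik hπ hg hμ n hB (by
      rw [hBn]; exact @MeasurableSet.empty _ (histAlg π.alloc n))
  have hcBc : ∫⁻ ω in Bᶜ, ENNReal.ofReal (Real.exp (Z ω)) ∂(E.prob θ) = E.prob ϑ Bᶜ := by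
    refine Policy.setLIntegral_stoppedLogLik hπ hg hμ n (fun t ht => ?_) ?_
    · have h1 : Bᶜ ∩ π.stopsAt t = π.stopsAt t \ (B ∩ π.stopsAt t) := by
        ext ω; simp only [Set.mem_inter_iff, Set.mem_compl_iff, Set.mem_sdiff]; tauto
      rw [h1]
      exact MeasurableSet.diff (Policy.measurableSet_stopsAt hπ t) (hB t ht)
    · have h1 : Bᶜ ∩ π.running n = π.running n := by
        refine Set.inter_eq_right.2 fun ω h1 h2 => ?_
        have : ω ∈ B ∩ π.running n := ⟨h2, h1⟩
        simp [hBn] at this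
      rw [h1]
      exact Policy.measurableSet_running' hπ n
  have hem : AEStronglyMeasurable (fun ω => Real.exp (Z ω)) (E.prob θ) :=
    Real.continuous_exp.comp_aestronglyMeasurable hZi.aestronglyMeasurable
  have hreal : ∀ A : Set (BanditSpace K),
      ∫⁻ ω in A, ENNReal.ofReal (Real.exp (Z ω)) ∂(E.prob θ) = E.prob ϑ A →
      IntegrableOn (fun ω => Real.exp (Z ω)) A (E.prob θ) ∧
        ∫ ω in A, Real.exp (Z ω) ∂(E.prob θ) = (E.prob ϑ).real A := by
    intro A hA
    refine ⟨⟨hem.restrict, ?_⟩, ?_⟩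
    · rw [hasFiniteIntegral_iff_ofReal (Eventually.of_forall fun ω => (Real.exp_pos _).le), hA]
      exact measure_lt_top _ _
    · rw [integral_eq_lintegral_of_nonneg_ae (Eventually.of_forall fun ω => (Real.exp_pos _).le)
        hem.restrict, hA, measureReal_def]
  obtain ⟨hi1, he1⟩ := hreal B hcB
  obtain ⟨hi2, he2⟩ := hreal Bᶜ hcBc
  -- The bound $Z\le\log\delta+e^Z/\delta$ is integrated over $B$. The change of measure turns the
  -- last term into $\mathbb P_\vartheta(B)/\delta\le 1$. On the complement $Z\le e^Z$ costs another
  -- 1, whence the 2 in the statement.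
  have h1 : ∫ ω in B, Z ω ∂(E.prob θ) ≤ (E.prob θ).real B * Real.log δ + 1 := by
    have h2 : ∫ ω in B, Z ω ∂(E.prob θ) ≤ ∫ ω in B, (Real.log δ + Real.exp (Z ω) / δ) ∂(E.prob θ) := by
      refine integral_mono hZi.integrableOn
        ((integrable_const _).add (hi1.div_const _)) fun ω => ?_
      have h3 := Real.add_one_le_exp (Z ω - Real.log δ)
      rw [Real.exp_sub, Real.exp_log hδ] at h3
      show Z ω ≤ Real.log δ + Real.exp (Z ω) / δ
      linarith
    rw [integral_add (integrable_const _) (hi1.div_const _), integral_div, he1,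
      setIntegral_const, smul_eq_mul] at h2
    have h3 : (E.prob ϑ).real B / δ ≤ 1 := by
      rw [div_le_one hδ]
      exact ENNReal.toReal_le_of_le_ofReal hδ.le hBδ
    linarith
  have h2 : ∫ ω in Bᶜ, Z ω ∂(E.prob θ) ≤ 1 := by
    have h3 : ∫ ω in Bᶜ, Z ω ∂(E.prob θ) ≤ ∫ ω in Bᶜ, Real.exp (Z ω) ∂(E.prob θ) := by
      refine integral_mono hZi.integrableOn hi2 fun ω => ?_
      linarith [Real.add_one_le_exp (Z ω)]
    rw [he2] at h3
    exact h3.trans measureReal_le_one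
  have h3 := integral_add_compl hBm hZi
  rw [one_div, Real.log_inv]
  linarith

theorem expSamples_nonneg (θ : Fin K → ℝ) (π : Policy K) (n : ℕ) (i : Fin K) :
    0 ≤ E.expSamples θ π n i :=
  Finset.sum_nonneg fun _ _ => measureReal_nonneg

theorem measurableSet_arm {a : Alloc K} (ha : a.IsMeasurable) (s : ℕ) (i : Fin K) :
    MeasurableSet {ω : BanditSpace K | a s (hist a ω s) (ω s).2 = i} := by
  have h1 : Measurable (fun ω : BanditSpace K => (hist a ω s, (ω s).2)) :=
    (measurable_hist ha s).prodMk (measurable_snd.comp (measurable_pi_apply s))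
  exact ((ha s).comp h1) (measurableSet_singleton i)

/-- Summing over arms leaves the expectation of $\min(\tau,n)$. -/
theorem sum_expSamples_le {π : Policy K} (hπ : π.IsMeasurable) {θ : Fin K → ℝ}
    (hθ : ∀ i, θ i ∈ E.meanSpace) (n : ℕ) :
    ENNReal.ofReal (∑ i, E.expSamples θ π n i) ≤ E.expTau θ π := by
  have hPθ := isProbabilityMeasure_prob hθ
  have hr : ∀ s, MeasurableSet (π.running (s + 1)) := fun s =>
    histAlg_le hπ.1 s _ (Policy.measurableSet_running hπ s)
  have h1 : ∑ i, E.expSamples θ π n i =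
      ∑ s ∈ Finset.range n, (E.prob θ).real (π.running (s + 1)) := by
    simp only [expSamples]
    rw [Finset.sum_comm]
    refine Finset.sum_congr rfl fun s _ => ?_
    rw [← measureReal_biUnion_finset]
    · congr 1
      ext ω; simp
    · intro i _ j _ hij
      refine Set.disjoint_left.2 fun ω h2 h3 => hij ?_
      exact h2.2.symm.trans h3.2
    · exact fun i _ => (hr s).inter (measurableSet_arm hπ.1 s i)
  rw [h1, ENNReal.ofReal_sum_of_nonneg fun _ _ => measureReal_nonneg]
  rw [Finset.sum_congr rfl fun s _ => (ofReal_measureReal (measure_ne_top _ _)).trans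
      (lintegral_indicator_one (hr s)).symm,
    ← lintegral_finsetSum _ fun s _ => measurable_one.indicator (hr s)]
  exact lintegral_mono fun ω => π.sum_running_le_tau ω n

/-- The event that the policy stops before time `n` with the answer `S`. -/
def answersBefore (π : Policy K) (S : Set (Fin K)) (n : ℕ) : Set (BanditSpace K) :=
  ⋃ t ∈ Finset.range n, π.stopsAt t ∩ {ω | π.decision t (hist π.alloc ω t) = S}

theorem measurableSet_answersBefore {π : Policy K} (hπ : π.IsMeasurable) (S : Set (Fin K))
    (n : ℕ) : MeasurableSet (answersBefore π S n) :=
  Finset.measurableSet_biUnion _ fun t _ =>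
    (histAlg_le hπ.1 t _ (Policy.measurableSet_stopsAt hπ t)).inter
      ((measurable_hist hπ.1 t) (hπ.2.2 t S))

theorem answersBefore_inter_stopsAt {π : Policy K} (S : Set (Fin K)) {n t : ℕ} (ht : t < n) :
    answersBefore π S n ∩ π.stopsAt t =
      π.stopsAt t ∩ {ω | π.decision t (hist π.alloc ω t) = S} := by
  ext ω
  simp only [answersBefore, Set.mem_inter_iff, Set.mem_iUnion, Finset.mem_range]
  constructor
  · rintro ⟨⟨s, -, h1, h2⟩, h3⟩
    obtain rfl : s = t := by
      by_contra hst
      exact Set.disjoint_left.1 (π.stopsAt_disjoint hst) h1 h3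
    exact ⟨h3, h2⟩
  · rintro ⟨h1, h2⟩
    exact ⟨⟨t, ht, h1, h2⟩, h1⟩

theorem answersBefore_inter_running {π : Policy K} (S : Set (Fin K)) (n : ℕ) :
    answersBefore π S n ∩ π.running n = ∅ := by
  refine Set.eq_empty_of_forall_notMem ?_
  rintro ω ⟨h1, h2⟩
  obtain ⟨t, ht, h3, -⟩ := Set.mem_iUnion₂.1 h1
  exact Set.disjoint_left.1 (π.stopsAt_disjoint_running (Finset.mem_range.1 ht)) h3 h2

theorem iUnion_answersBefore (π : Policy K) (S : Set (Fin K)) :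
    ⋃ n, answersBefore π S n = {ω | ∃ t : ℕ, π.tau ω = t ∧
      π.decision t (hist π.alloc ω t) = S} := by
  ext ω
  simp only [answersBefore, Set.mem_iUnion, Finset.mem_range, Policy.tau_eq_iff]
  constructor
  · rintro ⟨n, t, -, h1, h2⟩
    exact ⟨t, h1, h2⟩
  · rintro ⟨t, h1, h2⟩
    exact ⟨t + 1, t, t.lt_succ_self, h1, h2⟩

theorem answersBefore_mono (π : Policy K) (S : Set (Fin K)) : Monotone (answersBefore π S) :=
  fun _ _ hmn => Set.biUnion_subset_biUnion_left fun _ ht =>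
    Finset.range_subset_range.2 hmn ht

/-- A policy which is correct in an instance with another answer is unlikely to give the answer
`S`. -/
theorem measure_answersBefore_le {π : Policy K} (hπ : π.IsMeasurable) {ϑ : Fin K → ℝ}
    (hϑ : ∀ i, ϑ i ∈ E.meanSpace) {δ : ℝ} (hδ : δ ≤ 1) {S : Set (Fin K)}
    (hS : answer thr ϑ ≠ S)
    (hcor : ENNReal.ofReal (1 - δ) ≤ E.prob ϑ {ω | ∃ t : ℕ, π.tau ω = t ∧
      π.decision t (hist π.alloc ω t) = answer thr ϑ}) (n : ℕ) :
    E.prob ϑ (answersBefore π S n) ≤ ENNReal.ofReal δ := by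
  have hPϑ := isProbabilityMeasure_prob hϑ
  have hd : Disjoint (answersBefore π S n) {ω | ∃ t : ℕ, π.tau ω = t ∧
      π.decision t (hist π.alloc ω t) = answer thr ϑ} := by
    refine Set.disjoint_left.2 fun ω h1 ⟨t, h2, h3⟩ => hS ?_
    have h4 : ω ∈ ⋃ n, answersBefore π S n := Set.mem_iUnion.2 ⟨n, h1⟩
    rw [iUnion_answersBefore] at h4
    obtain ⟨s, h5, h6⟩ := h4
    obtain rfl : s = t := Nat.cast_inj.1 (h5.symm.trans h2)
    exact h3.symm.trans h6
  have h1 := measure_union' (μ := E.prob ϑ) hd (measurableSet_answersBefore hπ S n)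
  have h2 : E.prob ϑ (answersBefore π S n) + ENNReal.ofReal (1 - δ) ≤ 1 := by
    refine (add_le_add_right hcor _).trans ?_
    rw [← h1]; exact prob_le_one
  have h3 := ENNReal.le_sub_of_add_le_right ENNReal.ofReal_ne_top h2
  refine h3.trans_eq ?_
  rw [← ENNReal.ofReal_one, ← ENNReal.ofReal_sub _ (by linarith)]
  congr 1; ring

/-- The lower bound on the sample complexity of a correct policy. -/
theorem le_expTau_of_correct {π : Policy K} (hπ : π.IsMeasurable) (ht : thr ∈ E.meanSpace)
    (hK : 0 < K) {δ : ℝ} (hδ : 0 < δ) (hδ1 : δ < 1)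
    (hcor : ∀ θ ∈ E.instances K thr, ENNReal.ofReal (1 - δ) ≤ E.prob θ {ω | ∃ t : ℕ,
      π.tau ω = t ∧ π.decision t (hist π.alloc ω t) = answer thr θ})
    {θ : Fin K → ℝ} (hθ : θ ∈ E.instances K thr) :
    ENNReal.ofReal ((1 - δ) * Real.log (1 / δ) - 2) ≤
      ENNReal.ofReal (E.optValue thr θ) * E.expTau θ π := by
  have hθm : ∀ i, θ i ∈ E.meanSpace := fun i => (hθ i).1
  have hPθ := isProbabilityMeasure_prob hθm
  have hlog : 0 < Real.log (1 / δ) := Real.log_pos (by rw [lt_div_iff₀ hδ]; linarith)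
  have hV := optValue_pos ht hK hθ
  set S := answer thr θ
  have hn : ∀ n, ENNReal.ofReal ((E.prob θ).real (answersBefore π S n) * Real.log (1 / δ) - 2) ≤
      ENNReal.ofReal (E.optValue thr θ) * E.expTau θ π := by
    intro n
    set b := (E.prob θ).real (answersBefore π S n) * Real.log (1 / δ) - 2 with hb
    have htr : ∀ x, ∀ ϑ ∈ E.alt thr x θ, b ≤ ∑ i, E.expSamples θ π n i * E.dist (θ i) (ϑ i) := by
      intro x ϑ hϑ
      have hϑm : ∀ i, ϑ i ∈ E.meanSpace := fun i => (hϑ.1 i).1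
      refine transportation_le hπ hθm hϑm hδ n (measurableSet_answersBefore hπ S n)
        (fun t htn => ?_) (answersBefore_inter_running S n)
        (measure_answersBefore_le hπ hϑm hδ1.le ?_ (hcor ϑ hϑ.1) n)
      · rw [answersBefore_inter_stopsAt S htn]
        exact (Policy.measurableSet_stopsAt hπ t).inter
          (measurableSet_hist_preimage π.alloc le_rfl (hπ.2.2 t S))
      · intro heq
        have h1 : thr < ϑ x ↔ thr < θ x := Set.ext_iff.1 heq x
        have h2 := hϑ.2
        by_cases h3 : thr < θ x
        · have := h1.2 h3
          nlinarith
        · have h4 : ¬ thr < ϑ x := fun h => h3 (h1.1 h)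
          nlinarith [not_lt.1 h3, not_lt.1 h4]
    set N := ∑ i, E.expSamples θ π n i with hN
    have hN0 : 0 ≤ N := Finset.sum_nonneg fun i _ => expSamples_nonneg θ π n i
    have hle : ENNReal.ofReal b ≤ ENNReal.ofReal (E.optValue thr θ) * ENNReal.ofReal N := by
      rcases hN0.eq_or_lt with h0 | hpos
      -- Without samples any single alternative yields `b ≤ 0`. One exists, since otherwise the
      -- infimum defining the Chernoff information would be `⊤`, against `chernoffInfo_le`.
      · have h1 : ∀ i, E.expSamples θ π n i = 0 := fun i =>
          (Finset.sum_eq_zero_iff_of_nonneg fun i _ => expSamples_nonneg θ π n i).1 h0.symm i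
            (Finset.mem_univ i)
        have h2 : (E.alt thr ⟨0, hK⟩ θ).Nonempty := by
          by_contra hne
          have h3 := chernoffInfo_le ht hθ ⟨0, hK⟩ 0
          rw [chernoffInfo, Set.not_nonempty_iff_eq_empty.1 hne] at h3
          simp at h3
        obtain ⟨ϑ, hϑ⟩ := h2
        have h3 := htr _ ϑ hϑ
        simp only [h1, zero_mul, Finset.sum_const_zero] at h3
        rw [ENNReal.ofReal_of_nonpos h3]
        exact zero_le
      -- The normalised expected counts form an allocation whose value is at most $V$; the
      -- transportation inequality bounds that value below by $b/N$.
      · set p : Fin K → ℝ := fun i => E.expSamples θ π n i / N with hp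
        have hps : p ∈ stdSimplex ℝ (Fin K) :=
          ⟨fun i => div_nonneg (expSamples_nonneg θ π n i) hN0, by
            simp only [hp]; rw [← Finset.sum_div, ← hN, div_self hpos.ne']⟩
        have h1 : ENNReal.ofReal (b / N) ≤ E.Gam thr θ p := by
          refine le_iInf fun x => le_iInf₂ fun ϑ hϑ => ?_
          have h2 := htr x ϑ hϑ
          have h3 : ∑ i, ENNReal.ofReal (p i) * E.kl (θ i) (ϑ i) =
              ENNReal.ofReal (∑ i, p i * E.dist (θ i) (ϑ i)) := by
            rw [ENNReal.ofReal_sum_of_nonneg fun i _ =>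
              mul_nonneg (hps.1 i) (dist_nonneg (hθm i) (hϑ.1 i).1)]
            refine Finset.sum_congr rfl fun i _ => ?_
            rw [kl_eq_ofReal (hθm i) (hϑ.1 i).1, ENNReal.ofReal_mul (hps.1 i)]
            rfl
          rw [h3]
          refine ENNReal.ofReal_le_ofReal ?_
          rw [div_le_iff₀ hpos, Finset.sum_mul]
          refine h2.trans_eq (Finset.sum_congr rfl fun i _ => ?_)
          simp only [hp]
          field_simp
        have h2 := h1.trans (Gam_le_optValue ht hK hθ hps)
        rw [← ENNReal.ofReal_mul hV.le]
        refine ENNReal.ofReal_le_ofReal ?_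
        rw [ENNReal.ofReal_le_ofReal_iff hV.le, div_le_iff₀ hpos] at h2
        exact h2
    exact hle.trans (by gcongr; exact sum_expSamples_le hπ hθm n)
  -- As $n\to\infty$ the truncated events increase to the event of a correct stop, of probability at
  -- least $1-\delta$.
  have hlim : Tendsto (fun n => (E.prob θ).real (answersBefore π S n)) atTop
      (𝓝 ((E.prob θ).real (⋃ n, answersBefore π S n))) :=
    (ENNReal.tendsto_toReal (measure_ne_top _ _)).comp
      (tendsto_measure_iUnion_atTop (answersBefore_mono π S))
  have h1 := le_of_tendsto (ENNReal.tendsto_ofReal ((hlim.mul_const (Real.log (1 / δ))).sub_const 2))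
    (Eventually.of_forall hn)
  refine le_trans (ENNReal.ofReal_le_ofReal ?_) h1
  have h2 : 1 - δ ≤ (E.prob θ).real (⋃ n, answersBefore π S n) := by
    rw [iUnion_answersBefore]
    exact (ENNReal.ofReal_le_iff_le_toReal (measure_ne_top _ _)).1 (hcor θ hθ)
  have := mul_le_mul_of_nonneg_right h2 hlog.le
  linarith

end ExpFamily

/-! ### The sample complexity of the rule -/

theorem Cexp_nonneg {x : ℝ} (hx : 0 ≤ x) : 0 ≤ Cexp x := by
  obtain ⟨u, hu, hu', h⟩ := exists_Cexp_eq x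
  have h1 := one_le_hInv (by linarith : 1 ≤ 1 + x)
  have h2 : 0 ≤ Real.log (2 * ∑' n : ℕ, 1 / ((n : ℝ) + 1) ^ 2) :=
    Real.log_nonneg (by linarith [one_le_tsum_one_div_succ_sq])
  have hlu : 0 < Real.log u := Real.log_pos hu
  have hlu1 : Real.log u ≤ 1 := by linarith [Real.log_le_sub_one_of_pos (by linarith : 0 < u)]
  have hll : Real.log (Real.log u) ≤ 0 := Real.log_nonpos hlu.le hlu1
  rw [h]
  exact mul_nonneg (by linarith) (by linarith)

theorem count_le {K t : ℕ} (h : Hist K t) (i : Fin K) : count h i ≤ t := by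
  exact (Finset.single_le_sum (f := fun i => count h i) (fun _ _ => Nat.zero_le _)
    (Finset.mem_univ i)).trans_eq (sum_count h)

/-- The iterated logarithm is bounded crudely through $1+\log t\le t$; anything $o(t)$ is good
enough for the upper bound. -/
theorem stopThreshold_le {K t : ℕ} (ht : 0 < t) (h : Hist K t) (δ : ℝ) :
    stopThreshold h δ ≤ 3 * K * Real.log t + K * Cexp (Real.log (1 / δ) / K) := by
  have ht1 : (1 : ℝ) ≤ t := by exact_mod_cast ht
  have h1 : ∀ i, Real.log (1 + Real.log (count h i)) ≤ Real.log t := by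
    intro i
    have h2 : Real.log (count h i) ≤ Real.log t := by
      rcases Nat.eq_zero_or_pos (count h i) with h0 | h0
      · rw [h0]; simpa using Real.log_nonneg ht1
      · exact Real.log_le_log (by exact_mod_cast h0) (by exact_mod_cast count_le h i)
    have h3 := Real.log_natCast_nonneg (count h i)
    have h4 := Real.log_le_sub_one_of_pos (by linarith : (0 : ℝ) < t)
    exact Real.log_le_log (by linarith) (by linarith)
  have h5 : ∑ i, Real.log (1 + Real.log (count h i)) ≤ K * Real.log t := by
    calc _ ≤ ∑ _i : Fin K, Real.log t := Finset.sum_le_sum fun i _ => h1 i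
      _ = _ := by simp
  rw [stopThreshold]
  linarith

theorem tendsto_log_one_div : Tendsto (fun δ : ℝ => Real.log (1 / δ)) (𝓝[>] 0) atTop := by
  simp only [one_div, Real.log_inv]
  exact tendsto_neg_atBot_atTop.comp Real.tendsto_log_nhdsGT_zero

namespace ExpFamily

variable {E : ExpFamily} {K : ℕ} {thr : ℝ}

/-- The stopping time is at most an integrable random time plus a deterministic time. -/
theorem exists_tau_le {a : Alloc K} (ha : a.IsMeasurable) (hEB : E.IsEBKKTIDS thr a)
    (ht : thr ∈ E.meanSpace) (hK : 0 < K) {θ : Fin K → ℝ} (hθ : θ ∈ E.instances K thr)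
    {ε : ℝ} (hε : 0 < ε) (hεV : 2 * ε < E.optValue thr θ) :
    ∃ T : BanditSpace K → ℝ, Integrable T (E.prob θ) ∧ (∀ ω, 0 ≤ T ω) ∧ ∀ δ ∈ Set.Ioo (0 : ℝ) 1,
      ∀ᵐ ω ∂(E.prob θ), ∃ n : ℕ, (E.chernoffPolicy thr a δ).tau ω ≤ n ∧
        (n : ℝ) ≤ T ω + K * Cexp (Real.log (1 / δ) / K) / (E.optValue thr θ - 2 * ε) := by
  have hP := isProbabilityMeasure_prob fun i => (hθ i).1
  have hdp := dist_thr_pos ht hθ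
  have hpp := optAlloc_pos ht hK hθ
  have hK' : (0 : ℝ) < K := by exact_mod_cast hK
  -- Proportion and statistic may each be off by $e$; their product must still exceed
  -- $V-\varepsilon$. At $e=0$ it equals $V$.
  obtain ⟨e, he, hes⟩ : ∃ e > 0, ∀ i, e < E.optAlloc thr θ i ∧ e < E.dist (θ i) thr ∧
      E.optValue thr θ - ε < (E.optAlloc thr θ i - e) * (E.dist (θ i) thr - e) := by
    have hev : ∀ᶠ e in 𝓝 (0 : ℝ), ∀ i, e < E.optAlloc thr θ i ∧ e < E.dist (θ i) thr ∧
        E.optValue thr θ - ε < (E.optAlloc thr θ i - e) * (E.dist (θ i) thr - e) := by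
      refine eventually_all.2 fun i => (gt_mem_nhds (hpp i)).and ((gt_mem_nhds (hdp i)).and ?_)
      have hc : Continuous fun e : ℝ =>
          (E.optAlloc thr θ i - e) * (E.dist (θ i) thr - e) := by fun_prop
      refine hc.continuousAt.eventually (lt_mem_nhds ?_)
      simp only [sub_zero]
      rw [optAlloc_mul_dist ht hθ]
      linarith
    obtain ⟨e, he, he0⟩ := ((hev.filter_mono nhdsWithin_le_nhds).and
      (self_mem_nhdsWithin (s := Set.Ioi (0 : ℝ)))).exists
    exact ⟨e, he0, he⟩
  obtain ⟨T, hT, hae⟩ := exists_integrable_time ha hEB ht hK hθ he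
  obtain ⟨t₁, ht₁⟩ : ∃ t₁ : ℝ, ∀ t ≥ t₁, 3 * K * Real.log t ≤ ε * t := by
    have h1 := Real.isLittleO_log_id_atTop.def (show 0 < ε / (3 * K) by positivity)
    obtain ⟨t₁, h2⟩ := eventually_atTop.1 (h1.and (eventually_gt_atTop 0))
    refine ⟨t₁, fun t htt => ?_⟩
    obtain ⟨h3, h4⟩ := h2 t htt
    rw [Real.norm_eq_abs, id_eq, Real.norm_eq_abs, abs_of_pos h4] at h3
    have h5 := (le_abs_self _).trans h3
    calc 3 * K * Real.log t ≤ 3 * K * (ε / (3 * K) * t) := by gcongr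
      _ = ε * t := by field_simp
  refine ⟨fun ω => max (T ω) 0 + (|t₁| + 2), ?_, fun ω => by positivity, fun δ hδ => ?_⟩
  · exact (hT.sup (integrable_const 0)).add (integrable_const _)
  have hlog : 0 < Real.log (1 / δ) := Real.log_pos (by rw [lt_div_iff₀ hδ.1]; linarith [hδ.2])
  set C := K * Cexp (Real.log (1 / δ) / K) with hC
  have hC0 : 0 ≤ C := mul_nonneg hK'.le (Cexp_nonneg (by positivity))
  have hV : 0 < E.optValue thr θ - 2 * ε := by linarith
  filter_upwards [hae] with ω h
  set c := C / (E.optValue thr θ - 2 * ε) with hc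
  have hc0 : 0 ≤ c := div_nonneg hC0 hV.le
  -- Beyond $T$ the statistic is at least $n(V-\varepsilon)$, beyond $t_1$ the threshold is at most
  -- $\varepsilon n+C$, and beyond $c=C/(V-2\varepsilon)$ the first exceeds the second. The strict
  -- crossing costs the extra `+ 1`.
  set r := max (T ω) 0 + |t₁| + c with hr
  have hm0 : 0 ≤ max (T ω) 0 := le_max_right _ _
  have hr0 : 0 ≤ r := by positivity
  have hn1 : r ≤ (⌈r⌉₊ : ℝ) := Nat.le_ceil r
  refine ⟨⌈r⌉₊ + 1, ?_, ?_⟩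
  swap
  · have := Nat.ceil_lt_add_one hr0
    push_cast
    show (⌈r⌉₊ : ℝ) + 1 ≤ max (T ω) 0 + (|t₁| + 2) + c
    linarith
  set n := ⌈r⌉₊ + 1 with hn
  have hnr : r < (n : ℝ) := by rw [hn]; push_cast; linarith
  refine iInf₂_le n ?_
  have hTn : T ω ≤ n := by
    have := le_max_left (T ω) 0
    have := abs_nonneg t₁
    linarith
  have htn : t₁ ≤ n := by
    have := le_abs_self t₁
    linarith
  have hcn : c < n := by
    have := abs_nonneg t₁
    linarith
  have hn0 : (0 : ℝ) < n := by linarith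
  show ENNReal.ofReal (stopThreshold (hist a ω n) δ) < n * ⨅ i, E.empInfo thr (hist a ω n) i
  have h1 : ENNReal.ofReal (E.optValue thr θ - ε) ≤ ⨅ i, E.empInfo thr (hist a ω n) i := by
    refine le_iInf fun i => ?_
    obtain ⟨h2, h3⟩ := h n hTn i
    obtain ⟨h4, h5, h6⟩ := hes i
    refine (ENNReal.ofReal_le_ofReal h6.le).trans ?_
    rw [ENNReal.ofReal_mul (by linarith), empInfo]
    exact mul_le_mul' (ENNReal.ofReal_le_ofReal h2) h3
  refine lt_of_lt_of_le ?_ (mul_le_mul_right h1 _)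
  rw [← ENNReal.ofReal_natCast, ← ENNReal.ofReal_mul hn0.le,
    ENNReal.ofReal_lt_ofReal_iff (mul_pos hn0 (by linarith))]
  have h2 := stopThreshold_le (Nat.succ_pos _) (hist a ω n) δ
  have h3 := ht₁ n htn
  rw [hc, div_lt_iff₀ hV] at hcn
  have h4 : stopThreshold (hist a ω n) δ ≤ ε * n + C := by linarith
  linarith

theorem exists_expTau_le {a : Alloc K} (ha : a.IsMeasurable) (hEB : E.IsEBKKTIDS thr a)
    (ht : thr ∈ E.meanSpace) (hK : 0 < K) {θ : Fin K → ℝ} (hθ : θ ∈ E.instances K thr)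
    {ε : ℝ} (hε : 0 < ε) (hεV : 2 * ε < E.optValue thr θ) :
    ∃ M : ℝ, ∀ δ ∈ Set.Ioo (0 : ℝ) 1, E.expTau θ (E.chernoffPolicy thr a δ) ≤
      ENNReal.ofReal (M + K * Cexp (Real.log (1 / δ) / K) / (E.optValue thr θ - 2 * ε)) := by
  have hP := isProbabilityMeasure_prob fun i => (hθ i).1
  obtain ⟨T, hT, hT0, h⟩ := exists_tau_le ha hEB ht hK hθ hε hεV
  refine ⟨∫ ω, T ω ∂(E.prob θ), fun δ hδ => ?_⟩
  set c := K * Cexp (Real.log (1 / δ) / K) / (E.optValue thr θ - 2 * ε) with hc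
  have hc0 : 0 ≤ c := by
    have hlog : 0 < Real.log (1 / δ) := Real.log_pos (by rw [lt_div_iff₀ hδ.1]; linarith [hδ.2])
    exact div_nonneg (mul_nonneg (Nat.cast_nonneg _) (Cexp_nonneg (by positivity))) (by linarith)
  have h1 : ∫ ω, (T ω + c) ∂(E.prob θ) = ∫ ω, T ω ∂(E.prob θ) + c := by
    rw [integral_add hT (integrable_const _)]; simp
  have hTc : Integrable (fun ω => T ω + c) (E.prob θ) := hT.add (integrable_const _)
  rw [← h1, ofReal_integral_eq_lintegral_ofReal hTc
    (Eventually.of_forall fun ω => add_nonneg (hT0 ω) hc0)]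
  refine lintegral_mono_ae ?_
  filter_upwards [h δ hδ] with ω ⟨n, h2, h3⟩
  calc (((E.chernoffPolicy thr a δ).tau ω : ℕ∞) : ℝ≥0∞) ≤ ((n : ℕ∞) : ℝ≥0∞) := by
        exact_mod_cast h2
    _ = ENNReal.ofReal n := by simp
    _ ≤ _ := ENNReal.ofReal_le_ofReal h3

/-- Almost sure stopping comes from `exists_tau_le` with any admissible slack, here $V/4$; the error
probability comes from `measure_wrong_answer_le`. -/
theorem isCorrect_chernoffPolicy {a : Alloc K} (ha : a.IsMeasurable) (hEB : E.IsEBKKTIDS thr a)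
    (ht : thr ∈ E.meanSpace) (hK : 0 < K) :
    E.IsCorrect thr (fun δ => E.chernoffPolicy thr a δ (K := K)) := by
  intro δ hδ
  refine ⟨isMeasurable_chernoffPolicy ha δ, fun θ hθ => ?_⟩
  have hP := isProbabilityMeasure_prob fun i => (hθ i).1
  have hV := optValue_pos ht hK hθ
  obtain ⟨T, -, -, h⟩ := exists_tau_le ha hEB ht hK hθ (ε := E.optValue thr θ / 4) (by linarith)
    (by linarith)
  have h1 := h δ hδ
  rw [ae_iff] at h1
  have hsub : (Set.univ : Set (BanditSpace K)) ⊆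
      {ω | ∃ t : ℕ, (E.chernoffPolicy thr a δ).tau ω = t ∧
        (E.chernoffPolicy thr a δ).decision t (hist a ω t) = answer thr θ} ∪
      ({ω | ∃ t, hist a ω t ∈ (E.chernoffPolicy thr a δ).stopSet t ∧
        answer thr (sampleMean (hist a ω t)) ≠ answer thr θ} ∪
      {ω | ¬ ∃ n : ℕ, (E.chernoffPolicy thr a δ).tau ω ≤ n ∧ (n : ℝ) ≤ T ω +
        K * Cexp (Real.log (1 / δ) / K) / (E.optValue thr θ - 2 * (E.optValue thr θ / 4))}) := by
    intro ω _
    by_cases h2 : ω ∈ {ω | ¬ ∃ n : ℕ, (E.chernoffPolicy thr a δ).tau ω ≤ n ∧ (n : ℝ) ≤ T ω +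
        K * Cexp (Real.log (1 / δ) / K) / (E.optValue thr θ - 2 * (E.optValue thr θ / 4))}
    · exact Or.inr (Or.inr h2)
    · obtain ⟨n, h3, -⟩ := not_not.1 h2
      have h4 : (E.chernoffPolicy thr a δ).tau ω ≠ ⊤ := fun h5 => by
        rw [h5] at h3; exact absurd h3 (by simp)
      obtain ⟨t, h5⟩ := ENat.ne_top_iff_exists.1 h4
      have h6 := Policy.tau_eq_iff.1 h5.symm
      by_cases h7 : answer thr (sampleMean (hist a ω t)) = answer thr θ
      · exact Or.inl ⟨t, h5.symm, h7⟩
      · exact Or.inr (Or.inl ⟨t, h6.1, h7⟩)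
  have h2 : 1 ≤ E.prob θ {ω | ∃ t : ℕ, (E.chernoffPolicy thr a δ).tau ω = t ∧
      (E.chernoffPolicy thr a δ).decision t (hist a ω t) = answer thr θ} + ENNReal.ofReal δ := by
    calc 1 = E.prob θ Set.univ := measure_univ.symm
      _ ≤ _ := (measure_mono hsub).trans ((measure_union_le _ _).trans
          (add_le_add_right ((measure_union_le _ _).trans
            (add_le_add (measure_wrong_answer_le ha ht hK hθ hδ.1 hδ.2) h1.le)) _))
      _ = _ := by rw [add_zero]
  rw [ENNReal.ofReal_sub _ hδ.1.le, ENNReal.ofReal_one]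
  exact tsub_le_iff_right.2 h2

/-! ### Asymptotics as $\delta\to 0$ -/

theorem eventually_mem_Ioo : ∀ᶠ δ in 𝓝[>] (0 : ℝ), δ ∈ Set.Ioo (0 : ℝ) 1 :=
  Ioo_mem_nhdsGT one_pos

variable (E thr) in
/-- The lower bound on `𝔼[τ] / log (1 / δ)`. -/
noncomputable def lowerRate (θ : Fin K → ℝ) (δ : ℝ) : ℝ≥0∞ :=
  ENNReal.ofReal (((1 - δ) * Real.log (1 / δ) - 2) / Real.log (1 / δ)) *
    (ENNReal.ofReal (E.optValue thr θ))⁻¹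

theorem tendsto_lowerRate (θ : Fin K → ℝ) :
    Tendsto (E.lowerRate thr θ) (𝓝[>] 0) (𝓝 (ENNReal.ofReal (E.optValue thr θ))⁻¹) := by
  have h1 : Tendsto (fun δ : ℝ => (1 - δ) - 2 * (Real.log (1 / δ))⁻¹) (𝓝[>] 0)
      (𝓝 ((1 - 0) - 2 * 0)) := by
    refine Tendsto.sub ?_ (tendsto_log_one_div.inv_tendsto_atTop.const_mul 2)
    exact (tendsto_const_nhds.sub tendsto_id).mono_left nhdsWithin_le_nhds
  have h2 : Tendsto (fun δ : ℝ => ((1 - δ) * Real.log (1 / δ) - 2) / Real.log (1 / δ)) (𝓝[>] 0)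
      (𝓝 1) := by
    have e : ((1 : ℝ) - 0) - 2 * 0 = 1 := by norm_num
    rw [e] at h1
    refine h1.congr' ?_
    filter_upwards [tendsto_log_one_div.eventually (eventually_gt_atTop 0)] with δ h
    field_simp
  have h3 := ENNReal.Tendsto.mul_const (b := (ENNReal.ofReal (E.optValue thr θ))⁻¹)
    (ENNReal.tendsto_ofReal h2) (Or.inl (by simp))
  rw [ENNReal.ofReal_one, one_mul] at h3
  exact h3

theorem lowerRate_mul_le {π : ℝ → Policy K} (hπ : E.IsCorrect thr π) (ht : thr ∈ E.meanSpace)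
    (hK : 0 < K) {θ : Fin K → ℝ} (hθ : θ ∈ E.instances K thr) {δ : ℝ} (hδ : δ ∈ Set.Ioo (0 : ℝ) 1) :
    E.lowerRate thr θ δ * ENNReal.ofReal (Real.log (1 / δ)) ≤ E.expTau θ (π δ) := by
  have hlog : 0 < Real.log (1 / δ) := Real.log_pos (by rw [lt_div_iff₀ hδ.1]; linarith [hδ.2])
  have hV := optValue_pos ht hK hθ
  have h := le_expTau_of_correct (hπ δ hδ).1 ht hK hδ.1 hδ.2 (hπ δ hδ).2 hθ
  rw [lowerRate, mul_right_comm, ← ENNReal.ofReal_mul' hlog.le, div_mul_cancel₀ _ hlog.ne',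
    ← div_eq_mul_inv]
  exact ENNReal.div_le_of_le_mul' h

/-- A sandwich: the rule is itself correct, so the lower bound applies to it. The upper bound has
limit $1/(V-2\varepsilon)$ for every small $\varepsilon$. -/
theorem tendsto_expTau_div {a : Alloc K} (ha : a.IsMeasurable) (hEB : E.IsEBKKTIDS thr a)
    (ht : thr ∈ E.meanSpace) (hK : 0 < K) {θ : Fin K → ℝ} (hθ : θ ∈ E.instances K thr) :
    Tendsto (fun δ : ℝ => E.expTau θ (E.chernoffPolicy thr a δ) /
      ENNReal.ofReal (Real.log (1 / δ))) (𝓝[>] 0) (𝓝 (ENNReal.ofReal (E.optValue thr θ))⁻¹) := by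
  have hV := optValue_pos ht hK hθ
  have hK' : (0 : ℝ) < K := by exact_mod_cast hK
  have hlogpos := tendsto_log_one_div.eventually (eventually_gt_atTop 0)
  refine tendsto_order.2 ⟨fun b hb => ?_, fun b hb => ?_⟩
  · filter_upwards [(tendsto_lowerRate θ).eventually (lt_mem_nhds hb), eventually_mem_Ioo, hlogpos]
      with δ h1 h2 h3
    refine h1.trans_le ?_
    rw [ENNReal.le_div_iff_mul_le (Or.inl (by simpa using h3)) (Or.inl ENNReal.ofReal_ne_top)]
    exact lowerRate_mul_le (isCorrect_chernoffPolicy ha hEB ht hK) ht hK hθ h2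
  · obtain ⟨ε, hε, hε2, hεb⟩ : ∃ ε > 0, 2 * ε < E.optValue thr θ ∧
        ENNReal.ofReal (1 / (E.optValue thr θ - 2 * ε)) < b := by
      have hc : Tendsto (fun ε : ℝ => ENNReal.ofReal (1 / (E.optValue thr θ - 2 * ε))) (𝓝 0)
          (𝓝 (ENNReal.ofReal (E.optValue thr θ))⁻¹) := by
        rw [← ENNReal.ofReal_inv_of_pos hV]
        refine ENNReal.tendsto_ofReal ?_
        have : ContinuousAt (fun ε : ℝ => 1 / (E.optValue thr θ - 2 * ε)) 0 := by
          refine ContinuousAt.div (by fun_prop) (by fun_prop) ?_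
          simpa using hV.ne'
        simpa [ContinuousAt] using this
      have hev : ∀ᶠ ε in 𝓝 (0 : ℝ), 2 * ε < E.optValue thr θ := by
        have : Continuous fun ε : ℝ => 2 * ε := by fun_prop
        exact this.continuousAt.eventually (gt_mem_nhds (by simpa using hV))
      obtain ⟨ε, ⟨h1, h2⟩, h3⟩ := (((hev.and (hc.eventually (gt_mem_nhds hb))).filter_mono
        nhdsWithin_le_nhds).and (self_mem_nhdsWithin (s := Set.Ioi (0 : ℝ)))).exists
      exact ⟨ε, h3, h1, h2⟩
    obtain ⟨M, hM⟩ := exists_expTau_le ha hEB ht hK hθ hε hε2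
    have hlim : Tendsto (fun δ : ℝ => ENNReal.ofReal ((M + K * Cexp (Real.log (1 / δ) / K) /
        (E.optValue thr θ - 2 * ε)) / Real.log (1 / δ))) (𝓝[>] 0)
        (𝓝 (ENNReal.ofReal (1 / (E.optValue thr θ - 2 * ε)))) := by
      refine ENNReal.tendsto_ofReal ?_
      have h1 : Tendsto (fun δ : ℝ => Cexp (Real.log (1 / δ) / K) / (Real.log (1 / δ) / K))
          (𝓝[>] 0) (𝓝 1) :=
        tendsto_Cexp_div.comp (tendsto_log_one_div.atTop_div_const hK')
      have h2 := (tendsto_log_one_div.inv_tendsto_atTop.const_mul M).add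
        (h1.div_const (E.optValue thr θ - 2 * ε))
      rw [mul_zero, zero_add] at h2
      refine h2.congr' ?_
      filter_upwards [hlogpos] with δ h3
      have : E.optValue thr θ - 2 * ε ≠ 0 := by linarith
      simp only [Pi.inv_apply]
      field_simp
    filter_upwards [hlim.eventually (gt_mem_nhds hεb), eventually_mem_Ioo, hlogpos] with δ h1 h2 h3
    refine lt_of_le_of_lt ?_ h1
    rw [ENNReal.ofReal_div_of_pos h3]
    exact ENNReal.div_le_div_right (hM δ h2) _

/-- The competitor enters only through the lower bound, so its own ratio to $\log(1/\delta)$ need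
not converge or even be finite. -/
theorem limsup_expTau_ratio_le {a : Alloc K} (ha : a.IsMeasurable) (hEB : E.IsEBKKTIDS thr a)
    (ht : thr ∈ E.meanSpace) (hK : 0 < K) {π : ℝ → Policy K} (hπ : E.IsCorrect thr π)
    {θ : Fin K → ℝ} (hθ : θ ∈ E.instances K thr) :
    limsup (fun δ : ℝ => E.expTau θ (E.chernoffPolicy thr a δ) / E.expTau θ (π δ)) (𝓝[>] 0)
      ≤ 1 := by
  have hV := optValue_pos ht hK hθ
  have hV0 : (ENNReal.ofReal (E.optValue thr θ))⁻¹ ≠ 0 := by simp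
  have hVt : (ENNReal.ofReal (E.optValue thr θ))⁻¹ ≠ ⊤ := by simpa using hV
  have h1 := ENNReal.Tendsto.div (tendsto_expTau_div ha hEB ht hK hθ) (Or.inl hV0)
    (tendsto_lowerRate θ) (Or.inl hVt)
  rw [ENNReal.div_self hV0 hVt] at h1
  rw [← h1.limsup_eq]
  refine limsup_le_limsup ?_
  filter_upwards [eventually_mem_Ioo, tendsto_log_one_div.eventually (eventually_gt_atTop 0)]
    with δ h2 h3
  have h4 := lowerRate_mul_le hπ ht hK hθ h2
  refine (ENNReal.div_le_div_left h4 _).trans_eq ?_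
  simp only [div_eq_mul_inv]
  rw [ENNReal.mul_inv (Or.inr ENNReal.ofReal_ne_top) (Or.inr (by simpa using h3))]
  ring

end ExpFamily

theorem theorem5 (E : ExpFamily) (thr : ℝ) (hthr : thr ∈ E.meanSpace) (K : ℕ) (hK : 0 < K)
    (a : Alloc K) (ha : a.IsMeasurable) (hEB : E.IsEBKKTIDS thr a) :
    (∀ θ ∈ E.instances K thr, ∃ pstar : Fin K → ℝ,
      E.IsUniqueOptimal thr θ pstar ∧ (∀ i, 0 < pstar i) ∧
      ∀ i, LConv (E.prob θ) (fun t ω => prop (hist a ω t) i) (pstar i)) ∧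
    E.IsUniversallyEfficient thr (fun δ => E.chernoffPolicy thr a δ) ∧
    ∀ θ ∈ E.instances K thr,
      Tendsto (fun δ : ℝ => E.expTau θ (E.chernoffPolicy thr a δ) /
        ENNReal.ofReal (Real.log (1 / δ))) (𝓝[>] 0) (𝓝 (E.GamStar thr θ)⁻¹) := by
  refine ⟨fun θ hθ => ⟨E.optAlloc thr θ, ExpFamily.isUniqueOptimal_optAlloc hthr hK hθ,
      ExpFamily.optAlloc_pos hthr hK hθ, fun i => ExpFamily.lconv_prop ha hEB hthr hK hθ i⟩,
    ⟨ExpFamily.isCorrect_chernoffPolicy ha hEB hthr hK, fun π' hπ' θ hθ =>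
      ExpFamily.limsup_expTau_ratio_le ha hEB hthr hK hπ' hθ⟩, fun θ hθ => ?_⟩
  rw [ExpFamily.GamStar_eq hthr hK hθ]
  exact ExpFamily.tendsto_expTau_div ha hEB hthr hK hθ
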